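/- **Model.** $M\le K$ players pull arms in $[K]$ for $T$ rounds. If player $m$ pulls arm $A^m(t)$ in round $t$, she observes whether some other player pulled the same arm (a collision), and her reward $R^m(t)$, which is $0$ in a collision and $Y^m_{A^m(t),t}$ otherwise. The qualities $Y^m_{k,t}\in[0,1]$ are i.i.d. over $t$ with mean $\mu^m_k$ (the vectors $(Y^m_{k,t})_{m,k}$ are independent over $t$). A matching is a one-to-one map $\pi:[M]\to[K]$; $U(\pi)=\sum_m\mu^m_{\pi(m)}$, $U^\star=\max_\pi U(\pi)$, $\Delta(\pi)=U^\star-U(\pi)$, and $\Delta=\inf\{\Delta(\pi):\Delta(\pi)>0\}$, with $\Delta=\infty$ if all matchings are optimal. The regret is $R_T=TU^\star-\mathbb E\big[\sum_{t=1}^T\sum_{m=1}^M R^m(t)\big]$. **Algorithm M-ETC-Elim with integer parameter $c\ge1$** (every player knows $T$ and $K$ only). *Initialization:* for $\lceil K\ln(K^2T)\rceil$ rounds each player pulls independent uniformly random arms until she meets no collision, and then stays on that arm; a player on arm $k$ then pulls $k$ for $2k-2$ rounds, then the arms $k+1,\dots,K$ once each, then arm $1$ for $K-k$ rounds. She takes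 as her rank one plus the number of collisions in the first $2k-2$ of these rounds, and as $M$ one plus the number of collisions in the first $K+k-2$ of them. The player of rank $1$ is the leader. Players are now named by rank. Every player has a communication arm, at first her rank. A bit is sent to another player in one round by pulling that player's communication arm (bit $1$) or one's own (bit $0$), while everybody else pulls her own communication arm. Let $\delta=1/(M^2KT^2)$ and $\varepsilon_p=\sqrt{\ln(2/\delta)/2^{1+p^c}}$. The leader keeps a set $\mathcal E$ of edges, at first $[M]\times[K]$, and weights $\tilde\mu^m_k$, at first $0$; let $\tilde U(\pi)=\sum_m\tilde\mu^m_{\pi(m)}$. *Epoch $p=1,2,\dots$:* the leader computes a matching $\pi_1$ maximizing $\tilde U$ and, for each $(m,k)\in\mathcal E$, a matching $\tilde\pi^{m,k}$ maximizing $\tilde U$ among those with $\pi(m)=k$ (ties are broken by a fixed rule). She removes $(m,k)$ from $\mathcal E$ if $\tilde U(\pi_1)-\tilde U(\tilde\pi^{m,k})>4M\varepsilon_{p-1}$, and puts $\mathcal C=\{\tilde\pi^{m,k}:(m,k)\in\mathcal E\}$. She sends $|\mathcal C|$ to each follower in turn, and then to each follower in turn her arms in the matchings of $\mathcal C$, and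 $\pi_1(1)$ and the follower's arm in $\pi_1$, which become the communication arms. Arms are sent with $\lceil\log_2K\rceil$ bits and $|\mathcal C|$ with $\lceil\log_2(MK+1)\rceil$ bits. If $|\mathcal C|=1$, all players play the matching in $\mathcal C$ for ever. Otherwise they play each matching of $\mathcal C$ for $2^{p^c}$ rounds; each player computes the empirical means of her arms over these rounds of this epoch ($0$ for arms not pulled), and the followers in turn send theirs to the leader, truncated to the $\lceil(p^c+1)/2\rceil$ most significant bits. The received values and the leader's own means are the new weights $\tilde\mu^m_k$. **Theorem.** Let $c\ge1$ be an integer, $T_0(c)=\exp\!\Big(2^{\,c^c/\ln^c(1+\frac1{2c})}\Big)$ and $T\ge T_0(c)$. For $(m,k)\in[M]\times[K]$ let $\pi^{m,k}$ be a matching of maximal utility among the matchings with $\pi(m)=k$ and $U(\pi)<U^\star$, if there are any. If $\Delta\ne\infty$, then the regret of M-ETC-Elim with parameter $c$ satisfies $$\begin{aligned} R_T\le{}& 2+MK\ln(e^2K^2T)+6M^2K\lg(K)(\lg T)^{1/c}+e^2MK(\lg T)^{1+1/c}\\ &+\frac{2M^3K\lg(K)}{\sqrt2-1}\sqrt{\ln(2M^2KT^2)}+\frac{2\sqrt2}{3-2\sqrt2}M^2K\sqrt{\ln(2M^2KT^2)}\,\lg(\ln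 T)\\ &+\frac{2\sqrt2-1}{\sqrt2-1}\sum_{(m,k)}\left(\frac{32M^2\ln(2M^2KT^2)}{\Delta(\pi^{m,k})}\right)^{1+1/c}, \end{aligned}$$ where $\ln$ and $\lg$ are the logarithms in base $e$ and $2$ and the sum is over the $(m,k)\in[M]\times[K]$ for which $\pi^{m,k}$ exists. -/

import Mathlib

open MeasureTheory ProbabilityTheory

noncomputable section

open scoped Classical in
/-- Collision indicator of player `m` when the players pull the arms `a`: some other player pulls
the same arm. -/
def collided {M K : ℕ} (a : Fin M → Fin K) (m : Fin M) : Bool :=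
  decide (∃ m', m' ≠ m ∧ a m' = a m)

/-- Reward of player `m` when the players pull the arms `a` and the channel qualities are `y`. -/
def reward {M K : ℕ} (a : Fin M → Fin K) (y : Fin M → Fin K → ℝ) (m : Fin M) : ℝ :=
  if collided a m then 0 else y m (a m)

/-! ### Programs of a single player -/

/-- A program run by one player. `pull k next` pulls arm `k` for one round, observes the reward and
the collision indicator of that round, and goes on with `next reward collision`; `done x` ends
with the value `x`. A program can react to nothing but the player's own observations. -/
inductive Prog (K : ℕ) (α : Type) : Type
  | done (x : α) : Prog K α
  | pull (k : Fin K) (next : ℝ → Bool → Prog K α) : Prog K α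

namespace Prog

/-- Sequential composition of programs. -/
def andThen {K : ℕ} {α β : Type} : Prog K α → (α → Prog K β) → Prog K β
  | done x, f => f x
  | pull k next, f => pull k fun r b => (next r b).andThen f

instance {K : ℕ} : Monad (Prog K) where
  pure := done
  bind := andThen

/-- The arm pulled in the present round by a complete program. A complete program which has ended
with the value `k` pulls arm `k` for the rest of the game. -/
def arm {K : ℕ} : Prog K (Fin K) → Fin K
  | done k => k
  | pull k _ => k

/-- What is left of a complete program after a round in which the given reward and collision
indicator were observed. -/
def rest {K : ℕ} : Prog K (Fin K) → ℝ → Bool → Prog K (Fin K)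
  | done k, _, _ => done k
  | pull _ next, r, b => next r b

/-- Pull the listed arms one after the other and return the list of observations. -/
def pullList {K : ℕ} : List (Fin K) → Prog K (List (ℝ × Bool))
  | [] => done []
  | k :: ks => pull k fun r b => (pullList ks).andThen fun obs => done ((r, b) :: obs)

end Prog

/-- The programs left to the players at the beginning of round `t` (rounds are numbered from `0`),
when all of them run in parallel on the channel qualities `y m k t`. -/
def progsAt {M K : ℕ} (prog : Fin M → Prog K (Fin K)) (y : Fin M → Fin K → ℕ → ℝ) :
    ℕ → Fin M → Prog K (Fin K)
  | 0 => prog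
  | t + 1 => fun m =>
      let a : Fin M → Fin K := fun m' => (progsAt prog y t m').arm
      (progsAt prog y t m).rest (reward a (fun m' k => y m' k t) m) (collided a m)

/-- The arms pulled by the players in round `t`. -/
def armsAt {M K : ℕ} (prog : Fin M → Prog K (Fin K)) (y : Fin M → Fin K → ℕ → ℝ)
    (t : ℕ) (m : Fin M) : Fin K :=
  (progsAt prog y t m).arm

/-- The reward of player `m` in round `t`. -/
def rewardAt {M K : ℕ} (prog : Fin M → Prog K (Fin K)) (y : Fin M → Fin K → ℕ → ℝ)
    (t : ℕ) (m : Fin M) : ℝ :=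
  reward (armsAt prog y t) (fun m' k => y m' k t) m

/-! ### The initialization procedure -/

/-- `n` rounds of musical chairs; `u` holds the private random arms, one for every round, and the
second argument is the arm that has been occupied so far, if any. -/
def musicalChairs {K : ℕ} (u : ℕ → Fin K) : ℕ → Option (Fin K) → Prog K (Option (Fin K))
  | 0, o => Prog.done o
  | n + 1, none => Prog.pull (u n) fun _ b => musicalChairs u n (if b then none else some (u n))
  | n + 1, some k => Prog.pull k fun _ _ => musicalChairs u n (some k)

/-- Sequential hopping of a player on arm `k` (arms are numbered from `0`): she stays on `k` for
`2 k` rounds, sweeps through the arms above `k` and ends on arm `0`. She returns her rank (numbered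
from `0`) and the number of the other players. -/
def hopping {K : ℕ} [NeZero K] (k : Fin K) : Prog K (ℕ × ℕ) := do
  let waiting ← Prog.pullList (List.replicate (2 * (k : ℕ)) k)
  let sweep ← Prog.pullList ((List.finRange K).filter fun i => k < i)
  let _ ← Prog.pullList (List.replicate (K - 1 - (k : ℕ)) (0 : Fin K))
  let below := waiting.countP fun o => o.2
  let above := sweep.countP fun o => o.2
  return (below, below + above)

/-- The initialization with failure probability `δ₀`: returns the rank (numbered from `0`) and the
number of the other players. (A player who has not found an arm during the musical chairs goes on
with arm `0`.) -/
def initPhase (K : ℕ) [NeZero K] (δ₀ : ℝ) (u : ℕ → Fin K) : Prog K (ℕ × ℕ) := do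
  let o ← musicalChairs u ⌈(K : ℝ) * Real.log (K / δ₀)⌉₊ none
  hopping (o.getD 0)

/-! ### Messages -/

/-- The `b` lowest binary digits of `n`. -/
def toBits (b n : ℕ) : List Bool := (List.range b).map n.testBit

/-- The number with the given binary digits, lowest digit first. -/
def ofBits : List Bool → ℕ
  | [] => 0
  | d :: ds => d.toNat + 2 * ofBits ds

/-- The block number `i` (from `0`) when a list is cut into blocks of length `len`. -/
def block {α : Type} (len : ℕ) (l : List α) (i : ℕ) : List α := (l.drop (i * len)).take len

/-- The pulls with which a player with communication arm `own` sends bits to a player with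
communication arm `target`. -/
def sendArms {K : ℕ} (own target : Fin K) (bits : List Bool) : List (Fin K) :=
  bits.map fun d => if d then target else own

/-- Stay on the communication arm `own` for `len` rounds, and return the collision indicators. -/
def listen {K : ℕ} (own : Fin K) (len : ℕ) : Prog K (List Bool) := do
  let obs ← Prog.pullList (List.replicate len own)
  return obs.map Prod.snd

/-- Number of bits for an arm. -/
def armBits (K : ℕ) : ℕ := Nat.clog 2 K

/-- Number of bits for the number of candidate matchings, which is at most `M * K`. -/
def sizeBits (M K : ℕ) : ℕ := Nat.clog 2 (M * K + 1)

/-- Number of bits for an estimated mean in epoch `p`: `(p ^ c + 1) / 2`, rounded up. -/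
def meanBits (c p : ℕ) : ℕ := (p ^ c + 2) / 2

/-- The integer formed by the `b` most significant bits after the binary point of `x ∈ [0, 1]`
(all of them are `1` if `x = 1`). -/
def truncBits (b : ℕ) (x : ℝ) : ℕ := min ⌊x * 2 ^ b⌋₊ (2 ^ b - 1)

open scoped Classical in
/-- Empirical mean of the rewards obtained from arm `k` when the arms `arms` were pulled with the
observations `obs`, and `0` if `k` is not among them. -/
def empiricalMean {K : ℕ} (arms : List (Fin K)) (obs : List (ℝ × Bool)) (k : Fin K) : ℝ :=
  let rs := ((arms.zip obs).filter fun x => x.1 = k).map fun x => x.2.1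
  if rs.length = 0 then 0 else rs.sum / rs.length

/-- The pulls of the exploration phase of epoch `p`, given a player's arms in the successive
candidate matchings. -/
def exploreArms {K : ℕ} (c p : ℕ) (l : List (Fin K)) : List (Fin K) :=
  l.flatMap fun k => List.replicate (2 ^ p ^ c) k

/-! ### Leader and followers -/

/-- The utility (weight) of an assignment of arms to players, for the weights `w`. -/
def utility {M K : ℕ} (w : Fin M → Fin K → ℝ) (π : Fin M → Fin K) : ℝ := ∑ m, w m (π m)

open scoped Classical in
/-- The set of all matchings, i.e. one-to-one maps from players to arms. -/
def matchings (M K : ℕ) : Finset (Fin M → Fin K) :=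
  Finset.univ.filter fun π => Function.Injective π

/-- A tie-breaking rule: it picks an element of every non-empty finite set of assignments. -/
structure TieBreak (K : ℕ) where
  /-- the selected element -/
  pick : ∀ {M : ℕ}, Finset (Fin M → Fin K) → (Fin M → Fin K)
  pick_mem : ∀ {M : ℕ} (S : Finset (Fin M → Fin K)), S.Nonempty → pick S ∈ S

open scoped Classical in
/-- The element of `S` of maximal utility for the weights `w`, with ties broken by `tie`. -/
def argmax {M K : ℕ} (tie : TieBreak K) (S : Finset (Fin M → Fin K)) (w : Fin M → Fin K → ℝ) :
    Fin M → Fin K :=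
  tie.pick (S.filter fun π => ∀ π' ∈ S, utility w π' ≤ utility w π)

/-- The confidence radius `ε_p = √(ln (2 / δ) / 2 ^ (1 + p ^ c))` with `δ = 1 / (M² K T²)`. -/
def epsRadius (M K T c p : ℕ) : ℝ :=
  Real.sqrt (Real.log (2 / (1 / ((M : ℝ) ^ 2 * K * (T : ℝ) ^ 2))) / 2 ^ (1 + p ^ c))

/-- The estimated maximum matching. -/
def bestMatching {M K : ℕ} (tie : TieBreak K) (w : Fin M → Fin K → ℝ) : Fin M → Fin K :=
  argmax tie (matchings M K) w

open scoped Classical in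
/-- The matching associated with the edge `e`: the estimated maximum matching containing `e`. -/
def edgeMatching {M K : ℕ} (tie : TieBreak K) (w : Fin M → Fin K → ℝ) (e : Fin M × Fin K) :
    Fin M → Fin K :=
  argmax tie ((matchings M K).filter fun π => π e.1 = e.2) w

open scoped Classical in
/-- The edges which survive the elimination at the beginning of epoch `p`. The weights `w` were
estimated in epoch `p - 1`, and the threshold is `4 M` times the confidence radius of these
estimates. -/
def survivingEdges {M K : ℕ} (tie : TieBreak K) (T c p : ℕ) (E : List (Fin M × Fin K))
    (w : Fin M → Fin K → ℝ) : List (Fin M × Fin K) :=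
  E.filter fun e =>
    utility w (bestMatching tie w) - utility w (edgeMatching tie w e)
      ≤ 4 * M * epsRadius M K T c (p - 1)

open scoped Classical in
/-- The candidate matchings, without repetition. -/
def candidates {M K : ℕ} (tie : TieBreak K) (E : List (Fin M × Fin K))
    (w : Fin M → Fin K → ℝ) : List (Fin M → Fin K) :=
  (E.map (edgeMatching tie w)).dedup

/-- The epochs `p, p + 1, …, p + fuel - 1` of the leader, who has rank `0` among `n + 1` players.
Here `E` are the candidate edges, `w` the estimated weights, `κ` the communication arms. -/
def leaderLoop {K : ℕ} [NeZero K] (tie : TieBreak K) (T c n : ℕ) :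
    (fuel p : ℕ) → List (Fin (n + 1) × Fin K) → (Fin (n + 1) → Fin K → ℝ) →
      (Fin (n + 1) → Fin K) → Prog K (Fin K)
  | 0, _, _, _, _ => Prog.done 0
  | fuel + 1, p, E, w, κ => do
    let π₁ := bestMatching tie w
    let E' := survivingEdges tie T c p E w
    let C := candidates tie E' w
    -- send the number of candidate matchings to every follower
    let _ ← Prog.pullList ((List.finRange n).flatMap fun i =>
      sendArms (κ 0) (κ i.succ) (toBits (sizeBits (n + 1) K) C.length))
    -- send every follower her arms in the candidate matchings and the two communication arms
    let _ ← Prog.pullList ((List.finRange n).flatMap fun i =>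
      sendArms (κ 0) (κ i.succ)
        ((C.map (fun π => π i.succ) ++ [π₁ 0, π₁ i.succ]).flatMap fun k => toBits (armBits K) k))
    match C with
    | [π] => return π 0
    | _ => do
      let arms := exploreArms c p (C.map fun π => π 0)
      let obs ← Prog.pullList arms
      -- receive the estimates of the followers, one follower after the other
      let msg ← listen (π₁ 0) (n * (K * meanBits c p))
      let w' : Fin (n + 1) → Fin K → ℝ := Fin.cons (empiricalMean arms obs) fun i k =>
        (ofBits (block (meanBits c p) (block (K * meanBits c p) msg i) k) : ℝ) / 2 ^ meanBits c p
      leaderLoop tie T c n fuel (p + 1) E' w' π₁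

/-- The leader's algorithm with `n` followers, for at most `T` epochs (no more fit into `T`
rounds). -/
def leaderAlg {K : ℕ} [NeZero K] (tie : TieBreak K) (T c n : ℕ) : Prog K (Fin K) :=
  leaderLoop tie T c n T 1 ((List.finRange (n + 1)).product (List.finRange K)) (fun _ _ => 0)
    (fun i => Fin.ofNat K i)

/-- The epochs `p, …, p + fuel - 1` of the follower number `j` (from `0`; her rank is `j + 1`)
among `n` followers; `κ₁` and `κ` are the communication arms of the leader and of herself. -/
def followerLoop {K : ℕ} [NeZero K] (c n j : ℕ) :
    (fuel p : ℕ) → (κ₁ κ : Fin K) → Prog K (Fin K)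
  | 0, _, _, _ => Prog.done 0
  | fuel + 1, p, _, κ => do
    let sizes ← listen κ (n * sizeBits (n + 1) K)
    let size := ofBits (block (sizeBits (n + 1) K) sizes j)
    let msgs ← listen κ (n * ((size + 2) * armBits K))
    let msg := block ((size + 2) * armBits K) msgs j
    let armNo : ℕ → Fin K := fun i => Fin.ofNat K (ofBits (block (armBits K) msg i))
    let κ₁' := armNo size
    let κ' := armNo (size + 1)
    if size = 1 then return armNo 0
    else do
      let arms := exploreArms c p ((List.range size).map armNo)
      let obs ← Prog.pullList arms
      let _ ← Prog.pullList ((List.range n).flatMap fun i =>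
        if i = j then
          sendArms κ' κ₁' ((List.finRange K).flatMap fun k =>
            toBits (meanBits c p) (truncBits (meanBits c p) (empiricalMean arms obs k)))
        else List.replicate (K * meanBits c p) κ')
      followerLoop c n j fuel (p + 1) κ₁' κ'

/-- The follower's algorithm for the follower number `j` among `n` followers. The communication
arms of the first epoch are given by the ranks. -/
def followerAlg {K : ℕ} [NeZero K] (T c n j : ℕ) : Prog K (Fin K) :=
  followerLoop c n j T 1 0 (Fin.ofNat K (j + 1))

/-- M-ETC-Elim with parameter `c`, for the horizon `T`, as run by one player; `u` is the player's
private source of uniformly random arms. -/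
def metcElim {K : ℕ} [NeZero K] (tie : TieBreak K) (T c : ℕ) (u : ℕ → Fin K) :
    Prog K (Fin K) := do
  let x ← initPhase K (1 / ((K : ℝ) * T)) u
  match x with
  | (0, n) => leaderAlg tie T c n
  | (j + 1, n) => followerAlg T c n j

/-! ### The bandit model and the regret -/

/-- The randomness of the game: `Y m k t` is the quality of arm `k` for player `m` in round `t`, it
takes values in `[0, 1]`, is i.i.d. over the rounds and has mean `μ m k`; `U m i` are independent
uniformly random arms, the private randomness of the players, independent of the qualities. (Within
a single round the qualities may depend on one another.) -/
structure IsBandit {Ω : Type*} [MeasurableSpace Ω] {M K : ℕ} (P : Measure Ω)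
    (μ : Fin M → Fin K → ℝ) (Y : Fin M → Fin K → ℕ → Ω → ℝ) (U : Fin M → ℕ → Ω → Fin K) :
    Prop where
  measurable_Y : ∀ m k t, Measurable (Y m k t)
  mem_Icc : ∀ m k t ω, Y m k t ω ∈ Set.Icc (0 : ℝ) 1
  identDistrib : ∀ m k t, IdentDistrib (Y m k t) (Y m k 0) P P
  mean : ∀ m k, ∫ ω, Y m k 0 ω ∂P = μ m k
  indep_Y : iIndepFun (fun (t : ℕ) (ω : Ω) (m : Fin M) (k : Fin K) => Y m k t ω) P
  measurable_U : ∀ m i, Measurable (U m i)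
  uniform_U : ∀ m i k, P.real {ω | U m i ω = k} = 1 / K
  indep_U : iIndepFun (fun (q : Fin M × ℕ) (ω : Ω) => U q.1 q.2 ω) P
  indep_YU : IndepFun (fun (ω : Ω) (t : ℕ) (m : Fin M) (k : Fin K) => Y m k t ω)
    (fun (ω : Ω) (m : Fin M) (i : ℕ) => U m i ω) P

/-- The maximal utility `U⋆` of a matching. -/
def maxUtility {M K : ℕ} (μ : Fin M → Fin K → ℝ) : ℝ :=
  ⨆ π : {π : Fin M → Fin K // Function.Injective π}, utility μ π.1

/-- The gap `Δ(π) = U⋆ - U(π)`. -/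
def gap {M K : ℕ} (μ : Fin M → Fin K → ℝ) (π : Fin M → Fin K) : ℝ := maxUtility μ - utility μ π

/-- The infimum `Δ` of the positive gaps of matchings; it is `⊤` if all matchings are optimal. -/
def minGap {M K : ℕ} (μ : Fin M → Fin K → ℝ) : EReal :=
  ⨅ π : {π : Fin M → Fin K // Function.Injective π ∧ 0 < gap μ π}, (gap μ π.1 : EReal)

/-- The suboptimal matchings which assign arm `k` to player `m`. -/
def suboptimalThrough {M K : ℕ} (μ : Fin M → Fin K → ℝ) (m : Fin M) (k : Fin K) :
    Set (Fin M → Fin K) :=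
  {π | Function.Injective π ∧ π m = k ∧ utility μ π < maxUtility μ}

/-- The expected regret of M-ETC-Elim with parameter `c` after `T` rounds. -/
def regret {Ω : Type*} [MeasurableSpace Ω] {M K : ℕ} [NeZero K] (P : Measure Ω)
    (μ : Fin M → Fin K → ℝ) (Y : Fin M → Fin K → ℕ → Ω → ℝ) (U : Fin M → ℕ → Ω → Fin K)
    (tie : TieBreak K) (T c : ℕ) : ℝ :=
  T * maxUtility μ -
    ∫ ω, (∑ t ∈ Finset.range T, ∑ m : Fin M,
      rewardAt (fun m' => metcElim tie T c fun i => U m' i ω) (fun m' k s => Y m' k s ω) t m) ∂P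

/-- The horizon `T₀(c)`. -/
def minHorizon (c : ℕ) : ℝ :=
  Real.exp ((2 : ℝ) ^ ((c : ℝ) ^ c / Real.log (1 + 1 / (2 * (c : ℝ))) ^ c))

end

/-! ### Running programs in parallel -/

namespace Prog

variable {K : ℕ} {α β γ : Type}

/-! The arms of a round are a function of the private randomness and of earlier qualities, hence
independent of the qualities of that round. So every reward may be replaced by its mean, and the
regret is the expectation of `totalLoss` (`IsBandit.regret_eq`). The loss of a round is at most M.
Outside a good event, whose complement has probability at most M/(K²T) + 1/(MT), this costs at most
(M/K)² + 1 ≤ 2; on the good event the loss is bounded path by path (`totalLoss_metcElim_le`).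

The good event has two halves. First, musical chairs seats everybody: an unseated player fails in
one round with probability at most 1 - 1/K (`IsBandit.measure_finalSeats_le`). Second, the empirical
means of every epoch p lie within ε_p of the truth (`Clean`). Here the candidates and the starting
round of an exploration phase are themselves random. But the state `epochStateAt` has countably many
values and, like a stopping time, is determined by the qualities before the exploration phase
(`epochStateAt_congr`). Given its value, the coming samples are fresh and of fixed number, so
Hoeffding's inequality applies, and `measure_mem_le_of_indep` sums over the values. The choice of δ
makes the union over MK edges and T epochs cost 1/(MT).

On the good event messages arrive intact (`run_announcement`, `run_followersSend`), and a round of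
communication loses at most two rewards on top of the gap of the communication matching
(`loss_update_le`). Fix an optimal matching π. The weights never exceed the means by more than 2ε,
and on the edges of π they fall short by at most 2ε (`GoodWeights`): one ε for sampling, one for
truncation. Therefore the edges of π are never eliminated, the estimated best matching has gap at
most 4Mε_{p-1}, and every candidate has gap at most 8Mε_{p-1}. An edge (m,k) thus contributes to
epoch p only while Δ(π^{m,k}) ≤ 8Mε_{p-1}, that is, while 2^((p-1)^c) is at most X = 32M²
ln(2M²KT²)/Δ(π^{m,k})².

It remains to sum (`totalLoss_loop_le`, `sum_epochCost_le`). The exploration costs of an edge grow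
geometrically, so the last one dominates; T ≥ T₀(c) makes X so large that one more epoch enlarges
the exponent (lg X) at most by the factor 1 + 1/(2c), whence the power 1 + 1/c. A nonfinal epoch
explores for at least 2·2^(p^c) rounds, so there are about (lg T)^(1/c) epochs to communicate in,
and the gaps of the communication matchings decay geometrically. -/

theorem andThen_assoc (p : Prog K α) (f : α → Prog K β) (g : β → Prog K γ) :
    (p.andThen f).andThen g = p.andThen fun x => (f x).andThen g := by
  induction p with
  | done x => rfl
  | pull k next ih =>
    simp only [andThen]
    congr 1
    funext r b
    exact ih r b

theorem bind_eq (p : Prog K α) (f : α → Prog K β) : (p >>= f) = p.andThen f := rfl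

theorem pure_eq (x : α) : (pure x : Prog K α) = done x := rfl

theorem done_andThen (x : α) (f : α → Prog K β) : (done x).andThen f = f x := rfl

theorem pullList_nil_andThen (F : List (ℝ × Bool) → Prog K β) :
    (pullList []).andThen F = F [] := rfl

theorem pullList_cons_andThen (k : Fin K) (ks : List (Fin K)) (F : List (ℝ × Bool) → Prog K β) :
    (pullList (k :: ks)).andThen F =
      pull k fun r b => (pullList ks).andThen fun obs => F ((r, b) :: obs) := by
  simp only [pullList, andThen, andThen_assoc]

theorem pullList_append_andThen (l₁ l₂ : List (Fin K)) (F : List (ℝ × Bool) → Prog K β) :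
    (pullList (l₁ ++ l₂)).andThen F =
      (pullList l₁).andThen fun o₁ => (pullList l₂).andThen fun o₂ => F (o₁ ++ o₂) := by
  induction l₁ generalizing F with
  | nil => rfl
  | cons k ks ih => simp only [List.cons_append, pullList_cons_andThen, ih]

/-- The result of `pullList` has the length of the list of pulls. -/
theorem pullList_andThen_congr (l : List (Fin K)) (F G : List (ℝ × Bool) → Prog K β)
    (h : ∀ o, o.length = l.length → F o = G o) :
    (pullList l).andThen F = (pullList l).andThen G := by
  induction l generalizing F G with
  | nil => exact h [] rfl
  | cons k ks ih =>
    simp only [pullList_cons_andThen]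
    congr 1
    funext r b
    exact ih _ _ fun o ho => h _ (by simp [ho])

end Prog

section Run

variable {M K : ℕ}

/-- The channel qualities from round `s` on. -/
def shift (s : ℕ) (y : Fin M → Fin K → ℕ → ℝ) : Fin M → Fin K → ℕ → ℝ := fun m k t => y m k (s + t)

theorem shift_shift (s s' : ℕ) (y : Fin M → Fin K → ℕ → ℝ) :
    shift s' (shift s y) = shift (s + s') y := by
  funext m k t
  simp [shift, add_assoc]

theorem shift_zero (y : Fin M → Fin K → ℕ → ℝ) : shift 0 y = y := by
  funext m k t
  simp [shift]

theorem progsAt_add (prog : Fin M → Prog K (Fin K)) (y : Fin M → Fin K → ℕ → ℝ) (s t : ℕ) :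
    progsAt prog y (s + t) = progsAt (progsAt prog y s) (shift s y) t := by
  induction t with
  | zero => rfl
  | succ t ih =>
    funext m
    rw [← add_assoc]
    simp only [progsAt, ih]
    rfl

theorem armsAt_add (prog : Fin M → Prog K (Fin K)) (y : Fin M → Fin K → ℕ → ℝ) (s t : ℕ) :
    armsAt prog y (s + t) = armsAt (progsAt prog y s) (shift s y) t := by
  funext m
  simp only [armsAt, progsAt_add]

theorem progsAt_congr (prog : Fin M → Prog K (Fin K)) {y y' : Fin M → Fin K → ℕ → ℝ} {t : ℕ}
    (h : ∀ s < t, ∀ m k, y m k s = y' m k s) : progsAt prog y t = progsAt prog y' t := by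
  induction t with
  | zero => rfl
  | succ t ih =>
    funext m
    have h1 := ih fun s hs => h s (by omega)
    have h2 : (fun m' k => y m' k t) = fun m' k => y' m' k t := by
      funext m' k
      exact h t (by omega) m' k
    simp only [progsAt, h1, h2]

theorem collided_comp {M' : ℕ} (a : Fin M → Fin K) (σ : Fin M' ≃ Fin M) (m : Fin M') :
    collided (fun j => a (σ j)) m = collided a (σ m) := by
  unfold collided
  congr 1
  apply propext
  constructor
  · rintro ⟨j, hj, h⟩
    exact ⟨σ j, fun h' => hj (σ.injective h'), h⟩
  · rintro ⟨j, hj, h⟩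
    refine ⟨σ.symm j, fun h' => hj ?_, by simpa using h⟩
    rw [← h']
    simp

/-- Players are anonymous: a program sees only its own observations, and a collision does not depend
on how the players are numbered. This permits renaming the players by their random ranks. -/
theorem progsAt_relabel {M' : ℕ} (prog : Fin M → Prog K (Fin K)) (y : Fin M → Fin K → ℕ → ℝ)
    (σ : Fin M' ≃ Fin M) (t : ℕ) (j : Fin M') :
    progsAt (fun j => prog (σ j)) (fun j => y (σ j)) t j = progsAt prog y t (σ j) := by
  induction t generalizing j with
  | zero => rfl
  | succ t ih =>
    simp only [progsAt, ih]
    rw [collided_comp (fun m' => (progsAt prog y t m').arm) σ]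
    congr 1
    unfold reward
    rw [collided_comp (fun m' => (progsAt prog y t m').arm) σ]

theorem collided_eq_false_of_injective {a : Fin M → Fin K} (ha : Function.Injective a)
    (m : Fin M) : collided a m = false := by
  unfold collided
  rw [decide_eq_false]
  rintro ⟨m', h, h'⟩
  exact h (ha h')

theorem collided_eq_true_iff {a : Fin M → Fin K} {m : Fin M} :
    collided a m = true ↔ ∃ m', m' ≠ m ∧ a m' = a m := by
  unfold collided
  rw [decide_eq_true_iff]

/-- The observations of player `m` when the players pull the arms `a t` in round `t`, during `len`
rounds. -/
noncomputable def observations (a : ℕ → Fin M → Fin K) (y : Fin M → Fin K → ℕ → ℝ) (len : ℕ)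
    (m : Fin M) : List (ℝ × Bool) :=
  (List.range len).map fun t => (reward (a t) (fun m' k => y m' k t) m, collided (a t) m)

theorem observations_succ (a : ℕ → Fin M → Fin K) (y : Fin M → Fin K → ℕ → ℝ) (len : ℕ)
    (m : Fin M) : observations a y (len + 1) m =
      (reward (a 0) (fun m' k => y m' k 0) m, collided (a 0) m) ::
        observations (fun t => a (t + 1)) (shift 1 y) len m := by
  unfold observations
  rw [List.range_succ_eq_map, List.map_cons, List.map_map]
  congr 1
  apply List.map_congr_left
  intro t _
  simp [shift, add_comm]

theorem length_observations (a : ℕ → Fin M → Fin K) (y : Fin M → Fin K → ℕ → ℝ) (len : ℕ)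
    (m : Fin M) : (observations a y len m).length = len := by
  simp [observations]

theorem observations_snd (a : ℕ → Fin M → Fin K) (y : Fin M → Fin K → ℕ → ℝ) (len : ℕ)
    (m : Fin M) : (observations a y len m).map Prod.snd =
      (List.range len).map fun t => collided (a t) m := by
  simp [observations, Function.comp_def]

/-- When all players execute lists of pulls of the same length, the arms and the observations are
determined by these lists. -/
theorem run_pullList (len : ℕ) (a : ℕ → Fin M → Fin K) (y : Fin M → Fin K → ℕ → ℝ)
    (F : Fin M → List (ℝ × Bool) → Prog K (Fin K)) :
    (∀ t < len, armsAt (fun m => (Prog.pullList ((List.range len).map fun t => a t m)).andThen (F m))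
      y t = a t) ∧
    progsAt (fun m => (Prog.pullList ((List.range len).map fun t => a t m)).andThen (F m)) y len =
      fun m => F m (observations a y len m) := by
  induction len generalizing a y F with
  | zero => exact ⟨fun t ht => absurd ht (by omega), rfl⟩
  | succ len ih =>
    have hp : (fun m => (Prog.pullList ((List.range (len + 1)).map fun t => a t m)).andThen (F m)) =
        fun m => Prog.pull (a 0 m) fun r b =>
          (Prog.pullList ((List.range len).map fun t => a (t + 1) m)).andThen
            fun obs => F m ((r, b) :: obs) := by
      funext m
      rw [List.range_succ_eq_map, List.map_cons, List.map_map, Prog.pullList_cons_andThen]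
      rfl
    rw [hp]
    set q : Fin M → Prog K (Fin K) := fun m => Prog.pull (a 0 m) fun r b =>
          (Prog.pullList ((List.range len).map fun t => a (t + 1) m)).andThen
            fun obs => F m ((r, b) :: obs) with hq
    have h1 : progsAt q y 1 = fun m =>
        (Prog.pullList ((List.range len).map fun t => a (t + 1) m)).andThen
          fun obs => F m ((reward (a 0) (fun m' k => y m' k 0) m, collided (a 0) m) :: obs) := rfl
    have ih' := ih (fun t => a (t + 1)) (shift 1 y)
      (fun m obs => F m ((reward (a 0) (fun m' k => y m' k 0) m, collided (a 0) m) :: obs))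
    constructor
    · intro t ht
      rcases t with _ | t
      · rfl
      · rw [add_comm, armsAt_add, h1, ih'.1 t (by omega), add_comm]
    · rw [add_comm, progsAt_add, h1, ih'.2]
      funext m
      rw [add_comm, observations_succ]

theorem list_eq_map_getD {α : Type*} (l : List α) (d : α) :
    l = (List.range l.length).map fun t => l.getD t d := by
  apply List.ext_getElem
  · simp
  · intro i h1 h2
    simp [h1]

variable [NeZero K]

/-- The arms pulled in the successive rounds by players who execute the lists `l` of pulls. -/
def armsOfLists (l : Fin M → List (Fin K)) (t : ℕ) (m : Fin M) : Fin K := (l m).getD t 0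

theorem run_lists {len : ℕ} {l : Fin M → List (Fin K)} (hl : ∀ m, (l m).length = len)
    (y : Fin M → Fin K → ℕ → ℝ) (F : Fin M → List (ℝ × Bool) → Prog K (Fin K)) :
    (∀ t < len, armsAt (fun m => (Prog.pullList (l m)).andThen (F m)) y t = armsOfLists l t) ∧
    progsAt (fun m => (Prog.pullList (l m)).andThen (F m)) y len =
      fun m => F m (observations (armsOfLists l) y len m) := by
  have h : (fun m => (Prog.pullList (l m)).andThen (F m)) = fun m =>
      (Prog.pullList ((List.range len).map fun t => armsOfLists l t m)).andThen (F m) := by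
    funext m
    congr 2
    rw [← hl m]
    exact list_eq_map_getD _ _
  rw [h]
  exact run_pullList len (armsOfLists l) y F

end Run

/-! ### The loss of a round -/

section Loss

variable {M K : ℕ}

/-- The difference between the maximal utility and the expected total reward of a round. -/
noncomputable def loss (μ : Fin M → Fin K → ℝ) (a : Fin M → Fin K) : ℝ :=
  maxUtility μ - ∑ m, if collided a m then 0 else μ m (a m)

theorem loss_of_injective (μ : Fin M → Fin K → ℝ) {a : Fin M → Fin K}
    (ha : Function.Injective a) : loss μ a = gap μ a := by
  simp [loss, gap, utility, collided_eq_false_of_injective ha]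

theorem utility_le_maxUtility (μ : Fin M → Fin K → ℝ) {π : Fin M → Fin K}
    (hπ : Function.Injective π) : utility μ π ≤ maxUtility μ :=
  le_ciSup (f := fun π : {π : Fin M → Fin K // Function.Injective π} => utility μ π.1)
    (Set.finite_range _).bddAbove ⟨π, hπ⟩

theorem gap_nonneg (μ : Fin M → Fin K → ℝ) {π : Fin M → Fin K}
    (hπ : Function.Injective π) : 0 ≤ gap μ π :=
  sub_nonneg.2 (utility_le_maxUtility μ hπ)

theorem utility_le_card {μ : Fin M → Fin K → ℝ} (hμ : ∀ m k, μ m k ≤ 1) (π : Fin M → Fin K) :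
    utility μ π ≤ M := by
  unfold utility
  calc ∑ m, μ m (π m) ≤ ∑ _m : Fin M, (1 : ℝ) := Finset.sum_le_sum fun m _ => hμ m _
    _ = M := by simp

theorem maxUtility_le {μ : Fin M → Fin K → ℝ} (hμ : ∀ m k, μ m k ≤ 1) : maxUtility μ ≤ M :=
  Real.iSup_le (fun π => utility_le_card hμ π.1) (Nat.cast_nonneg _)

theorem exists_optimal (hMK : M ≤ K) (μ : Fin M → Fin K → ℝ) :
    ∃ π : Fin M → Fin K, Function.Injective π ∧ utility μ π = maxUtility μ := by
  have : Nonempty {π : Fin M → Fin K // Function.Injective π} :=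
    ⟨⟨Fin.castLE hMK, Fin.castLE_injective hMK⟩⟩
  obtain ⟨π, hπ⟩ := exists_eq_ciSup_of_finite
    (f := fun π : {π : Fin M → Fin K // Function.Injective π} => utility μ π.1)
  exact ⟨π.1, π.2, hπ⟩

theorem loss_le_card {μ : Fin M → Fin K → ℝ} (h0 : ∀ m k, 0 ≤ μ m k) (h1 : ∀ m k, μ m k ≤ 1)
    (a : Fin M → Fin K) : loss μ a ≤ M := by
  have : 0 ≤ ∑ m, if collided a m then 0 else μ m (a m) :=
    Finset.sum_nonneg fun m _ => by split_ifs <;> simp [h0]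
  unfold loss
  linarith [maxUtility_le h1]

theorem gap_le_card {μ : Fin M → Fin K → ℝ} (h0 : ∀ m k, 0 ≤ μ m k) (h1 : ∀ m k, μ m k ≤ 1)
    (a : Fin M → Fin K) : gap μ a ≤ M := by
  have : 0 ≤ utility μ a := Finset.sum_nonneg fun m _ => h0 _ _
  unfold gap
  linarith [maxUtility_le h1]

/-- When player `i` leaves her own arm for the one of player `j`, at most two rewards are lost. -/
theorem loss_update_le {μ : Fin M → Fin K → ℝ} (h1 : ∀ m k, μ m k ≤ 1)
    (h0 : ∀ m k, 0 ≤ μ m k) {κ : Fin M → Fin K} (hκ : Function.Injective κ) {i j : Fin M}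
    {a : Fin M → Fin K} (ha : ∀ m, m ≠ i → a m = κ m) (hi : a i = κ j) :
    loss μ a ≤ 2 + gap μ κ := by
  have key : utility μ κ - 2 ≤ ∑ m, if collided a m then 0 else μ m (a m) := by
    unfold utility
    -- One reward each is charged to the sender `i` and to the owner `j` of the arm; everybody else
    -- stays alone on her arm of `κ`. The case `i = j`, the bit 0, is included.
    have h : ∀ m, μ m (κ m) - ((if m = i then 1 else 0) + if m = j then 1 else 0) ≤
        if collided a m then 0 else μ m (a m) := by
      intro m
      have hnn : 0 ≤ if collided a m then 0 else μ m (a m) := by split_ifs <;> simp [h0]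
      have := h1 m (κ m)
      by_cases hmi : m = i
      · have : (0 : ℝ) ≤ if m = j then 1 else 0 := by split_ifs <;> norm_num
        rw [if_pos hmi]
        linarith
      by_cases hmj : m = j
      · rw [if_pos hmj, if_neg hmi]
        linarith
      · rw [if_neg hmi, if_neg hmj]
        have hc : collided a m = false := by
          rw [Bool.eq_false_iff]
          intro hc
          obtain ⟨m', hm', h'⟩ := collided_eq_true_iff.1 hc
          rw [ha m hmi] at h'
          by_cases hm'i : m' = i
          · rw [hm'i, hi] at h'
            exact hmj (hκ h').symm
          · rw [ha m' hm'i] at h'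
            exact hm' (hκ h')
        simp [hc, ha m hmi]
    calc (∑ m, μ m (κ m)) - 2
        = ∑ m, (μ m (κ m) - ((if m = i then 1 else 0) + if m = j then 1 else 0)) := by
          rw [Finset.sum_sub_distrib, Finset.sum_add_distrib]
          simp
          norm_num
      _ ≤ _ := Finset.sum_le_sum fun m _ => h m
  unfold loss gap
  linarith

/-- The total loss of the first `R` rounds. -/
noncomputable def totalLoss (μ : Fin M → Fin K → ℝ) (prog : Fin M → Prog K (Fin K))
    (y : Fin M → Fin K → ℕ → ℝ) (R : ℕ) : ℝ :=
  ∑ t ∈ Finset.range R, loss μ (armsAt prog y t)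

theorem totalLoss_add (μ : Fin M → Fin K → ℝ) (prog : Fin M → Prog K (Fin K))
    (y : Fin M → Fin K → ℕ → ℝ) (s R : ℕ) :
    totalLoss μ prog y (s + R) =
      totalLoss μ prog y s + totalLoss μ (progsAt prog y s) (shift s y) R := by
  unfold totalLoss
  rw [Finset.sum_range_add]
  simp only [armsAt_add]

/-- Bound on the total loss by that of a first phase and that of the remaining rounds. -/
theorem totalLoss_le_phase {μ : Fin M → Fin K → ℝ} {prog prog' : Fin M → Prog K (Fin K)}
    {y : Fin M → Fin K → ℕ → ℝ} {len R : ℕ} {b : ℕ → ℝ} {B : ℝ}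
    (hb : ∀ t < len, loss μ (armsAt prog y t) ≤ b t) (hb0 : ∀ t < len, 0 ≤ b t) (hB : 0 ≤ B)
    (hprog : progsAt prog y len = prog')
    (hrest : ∀ R', R = len + R' → totalLoss μ prog' (shift len y) R' ≤ B) :
    totalLoss μ prog y R ≤ ∑ t ∈ Finset.range len, b t + B := by
  -- The horizon may fall inside the phase; then the unplayed rounds are added to the bound, which
  -- needs `b` and `B` to be nonnegative.
  rcases le_or_gt len R with h | h
  · obtain ⟨R', rfl⟩ := Nat.exists_eq_add_of_le h
    rw [totalLoss_add, hprog]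
    refine add_le_add (Finset.sum_le_sum fun t ht => hb t (Finset.mem_range.1 ht)) (hrest R' rfl)
  · calc totalLoss μ prog y R ≤ ∑ t ∈ Finset.range R, b t :=
          Finset.sum_le_sum fun t ht => hb t ((Finset.mem_range.1 ht).trans h)
      _ ≤ ∑ t ∈ Finset.range len, b t :=
          Finset.sum_le_sum_of_subset_of_nonneg (Finset.range_mono h.le)
            fun t ht _ => hb0 t (Finset.mem_range.1 ht)
      _ ≤ _ := by linarith

end Loss

/-! ### Measurability of the play -/

section Meas

universe u

variable {K : ℕ}

/-- The arms pulled during `N + 1` rounds by a program which depends on a parameter are measurable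
functions of this parameter and the observations. -/
def ArmsMeas : ℕ → ∀ {X : Type u} [MeasurableSpace X], (X → Prog K (Fin K)) → Prop
  | 0, _, _, f => Measurable fun x => (f x).arm
  | N + 1, X, _, f => (Measurable fun x => (f x).arm) ∧
      ArmsMeas N fun z : X × ℝ × Bool => (f z.1).rest z.2.1 z.2.2

/-- A program which depends measurably on a parameter. -/
def MeasProg {X : Type u} [MeasurableSpace X] (f : X → Prog K (Fin K)) : Prop :=
  ∀ N, ArmsMeas N f

theorem ArmsMeas.measurable_arm {N : ℕ} {X : Type u} [MeasurableSpace X] {f : X → Prog K (Fin K)}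
    (h : ArmsMeas N f) : Measurable fun x => (f x).arm := by
  cases N with
  | zero => exact h
  | succ N => exact h.1

theorem ArmsMeas.comp {N : ℕ} {X X' : Type u} [MeasurableSpace X] [MeasurableSpace X']
    {f : X → Prog K (Fin K)} (h : ArmsMeas N f) {g : X' → X} (hg : Measurable g) :
    ArmsMeas N fun x => f (g x) := by
  induction N generalizing X X' with
  | zero => exact Measurable.comp h hg
  | succ N ih =>
    refine ⟨h.1.comp hg, ?_⟩
    exact ih h.2 (g := fun z : X' × ℝ × Bool => (g z.1, z.2))
      ((hg.comp measurable_fst).prodMk measurable_snd)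

theorem MeasProg.comp {X X' : Type u} [MeasurableSpace X] [MeasurableSpace X']
    {f : X → Prog K (Fin K)} (h : MeasProg f) {g : X' → X} (hg : Measurable g) :
    MeasProg fun x => f (g x) := fun N => (h N).comp hg

theorem MeasProg.rest {X : Type u} [MeasurableSpace X] {f : X → Prog K (Fin K)} (h : MeasProg f)
    {r : X → ℝ} {b : X → Bool} (hr : Measurable r) (hb : Measurable b) :
    MeasProg fun x => (f x).rest (r x) (b x) := fun N =>
  (h (N + 1)).2.comp (g := fun x => (x, r x, b x)) (measurable_id.prodMk (hr.prodMk hb))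

/-- A preimage splits into countably many pieces, one for each value of `h`. Only the level sets of
`h` matter, so `ι` needs no σ-algebra; later it consists of decisions or states of an epoch. -/
theorem measurable_of_countable_cases {ι X Z : Type*} [Countable ι] [MeasurableSpace X]
    [MeasurableSpace Z] {h : X → ι} (hh : ∀ i, MeasurableSet {x | h x = i}) {F : ι → X → Z}
    (hF : ∀ i, Measurable (F i)) : Measurable fun x => F (h x) x := by
  intro s hs
  have : (fun x => F (h x) x) ⁻¹' s = ⋃ i, {x | h x = i} ∩ F i ⁻¹' s := by
    ext x
    simp
  rw [this]
  exact MeasurableSet.iUnion fun i => (hh i).inter (hF i hs)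

theorem ArmsMeas.cases {N : ℕ} {ι : Type*} {X : Type u} [Countable ι] [MeasurableSpace X]
    {h : X → ι} (hh : ∀ i, MeasurableSet {x | h x = i}) {F : ι → X → Prog K (Fin K)}
    (hF : ∀ i, ArmsMeas N (F i)) : ArmsMeas N fun x => F (h x) x := by
  induction N generalizing X with
  | zero => exact measurable_of_countable_cases hh (F := fun i x => (F i x).arm) hF
  | succ N ih =>
    refine ⟨measurable_of_countable_cases hh (F := fun i x => (F i x).arm) fun i => (hF i).1, ?_⟩
    exact ih (h := fun z : X × ℝ × Bool => h z.1)
      (F := fun i z => (F i z.1).rest z.2.1 z.2.2) (fun i => measurable_fst (hh i))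
      fun i => (hF i).2

/-- Distinction of cases by a measurable parameter with countably many values. -/
theorem MeasProg.cases {ι : Type*} {X : Type u} [Countable ι] [MeasurableSpace X]
    {h : X → ι} (hh : ∀ i, MeasurableSet {x | h x = i}) {F : ι → X → Prog K (Fin K)}
    (hF : ∀ i, MeasProg (F i)) : MeasProg fun x => F (h x) x := fun N =>
  ArmsMeas.cases hh fun i => hF i N

theorem MeasProg.done {X : Type u} [MeasurableSpace X] {g : X → Fin K} (hg : Measurable g) :
    MeasProg fun x => Prog.done (g x) := by
  intro N
  induction N generalizing X with
  | zero => exact hg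
  | succ N ih => exact ⟨hg, ih (g := fun z : X × ℝ × Bool => g z.1) (hg.comp measurable_fst)⟩

theorem MeasProg.pull {X : Type u} [MeasurableSpace X] {g : X → Fin K} (hg : Measurable g)
    {next : X → ℝ → Bool → Prog K (Fin K)}
    (h : MeasProg fun z : X × ℝ × Bool => next z.1 z.2.1 z.2.2) :
    MeasProg fun x => Prog.pull (g x) (next x) := by
  intro N
  cases N with
  | zero => exact hg
  | succ N => exact ⟨hg, h N⟩

theorem measurable_finCons {X α : Type*} [MeasurableSpace X] [MeasurableSpace α] {n : ℕ}
    {a : X → α} {v : X → Fin n → α} (ha : Measurable a) (hv : Measurable v) :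
    Measurable fun x => (Fin.cons (a x) (v x) : Fin (n + 1) → α) := by
  rw [measurable_pi_iff]
  intro i
  refine Fin.cases ?_ (fun i => ?_) i
  · simpa using ha
  · simpa using measurable_pi_iff.1 hv i

/-- Observations enter as a vector indexed by `Fin l.length`, so that the product σ-algebra applies.
The induction moves the observation of the first pull into the parameter. -/
theorem MeasProg.pullList {X : Type u} [MeasurableSpace X] (l : List (Fin K))
    {F : X → List (ℝ × Bool) → Prog K (Fin K)}
    (h : MeasProg fun z : X × (Fin l.length → ℝ × Bool) => F z.1 (List.ofFn z.2)) :
    MeasProg fun x => (Prog.pullList l).andThen (F x) := by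
  induction l generalizing X with
  | nil =>
    have := h.comp (g := fun x => (x, fun i : Fin 0 => i.elim0)) (by fun_prop)
    simpa [Prog.pullList_nil_andThen] using this
  | cons k ks ih =>
    simp only [Prog.pullList_cons_andThen]
    refine MeasProg.pull measurable_const ?_
    refine ih ?_
    have := h.comp (X' := (X × ℝ × Bool) × (Fin ks.length → ℝ × Bool))
      (g := fun w => (w.1.1, Fin.cons w.1.2 w.2))
      ((measurable_fst.comp measurable_fst).prodMk
        (measurable_finCons (measurable_snd.comp measurable_fst) measurable_snd))
    simpa using this

theorem measurableSet_discrete_comp {X Z : Type*} [MeasurableSpace X] {ι : Type*}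
    [MeasurableSpace Z] [MeasurableSingletonClass Z] [Countable Z] {g : X → Z} (hg : Measurable g)
    (h : Z → ι) (i : ι) : MeasurableSet {x | h (g x) = i} :=
  hg (Set.to_countable {z | h z = i}).measurableSet

/-- If only the collision indicators matter for the continuation. -/
theorem MeasProg.pullList_snd {X : Type u} [MeasurableSpace X] (l : List (Fin K))
    {F : X → List Bool → Prog K (Fin K)} (h : ∀ bs, MeasProg fun x => F x bs) :
    MeasProg fun x => (Prog.pullList l).andThen fun obs => F x (obs.map Prod.snd) := by
  refine MeasProg.pullList l ?_
  have : ∀ z : X × (Fin l.length → ℝ × Bool), F z.1 ((List.ofFn z.2).map Prod.snd) =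
      F z.1 (List.ofFn fun i => (z.2 i).2) := by
    intro z
    congr 1
    simp [List.map_ofFn, Function.comp_def]
  simp only [this]
  refine MeasProg.cases (ι := Fin l.length → Bool)
    (h := fun z : X × (Fin l.length → ℝ × Bool) => fun i => (z.2 i).2)
    (F := fun bs z => F z.1 (List.ofFn bs)) (fun bs => ?_) fun bs => ?_
  · refine measurableSet_discrete_comp (g := fun z : X × (Fin l.length → ℝ × Bool) =>
      fun i => (z.2 i).2) (by fun_prop) id bs
  · exact (h (List.ofFn bs)).comp (g := fun z : X × (Fin l.length → ℝ × Bool) => z.1)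
      measurable_fst

/-- If the observations do not matter for the continuation. -/
theorem MeasProg.pullList_const {X : Type u} [MeasurableSpace X] (l : List (Fin K))
    {F : X → Prog K (Fin K)} (h : MeasProg F) :
    MeasProg fun x => (Prog.pullList l).andThen fun _ => F x :=
  MeasProg.pullList_snd l (F := fun x _ => F x) fun _ => h

theorem listen_andThen {α : Type} (own : Fin K) (len : ℕ) (F : List Bool → Prog K α) :
    (listen own len).andThen F =
      (Prog.pullList (List.replicate len own)).andThen fun obs => F (obs.map Prod.snd) := by
  unfold _root_.listen
  rw [Prog.bind_eq, Prog.andThen_assoc]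
  rfl

theorem MeasProg.listen {X : Type u} [MeasurableSpace X] (own : Fin K) (len : ℕ)
    {F : X → List Bool → Prog K (Fin K)} (h : ∀ bs, MeasProg fun x => F x bs) :
    MeasProg fun x => (listen own len).andThen (F x) := by
  simp only [listen_andThen]
  exact MeasProg.pullList_snd _ h

theorem MeasProg.musicalChairs {X : Type u} [MeasurableSpace X] {u : X → ℕ → Fin K}
    (hu : Measurable u) (n : ℕ) (o : Option (Fin K)) {F : X → Option (Fin K) → Prog K (Fin K)}
    (h : ∀ o, MeasProg fun x => F x o) :
    MeasProg fun x => (musicalChairs (u x) n o).andThen (F x) := by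
  induction n generalizing X o with
  | zero =>
    cases o <;> exact h _
  | succ n ih =>
    have h' : ∀ o, MeasProg fun z : X × ℝ × Bool => F z.1 o := fun o =>
      (h o).comp measurable_fst
    have hu' : Measurable fun z : X × ℝ × Bool => u z.1 := hu.comp measurable_fst
    cases o with
    | none =>
      have hun : Measurable fun x => u x n := measurable_pi_iff.1 hu n
      refine MeasProg.pull hun ?_
      refine MeasProg.cases (ι := Fin K × Bool) (h := fun z : X × ℝ × Bool => (u z.1 n, z.2.2))
        (F := fun i z => (_root_.musicalChairs (u z.1) n
          (if i.2 then none else some i.1)).andThen (F z.1)) (fun i => ?_) fun i => ?_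
      · exact measurableSet_discrete_comp (g := fun z : X × ℝ × Bool => (u z.1 n, z.2.2))
          ((hun.comp measurable_fst).prodMk (measurable_snd.comp measurable_snd)) id i
      · exact ih hu' _ h'
    | some k =>
      refine MeasProg.pull measurable_const ?_
      exact ih hu' _ h'

end Meas

/-! ### Measurability of the algorithm as a function of the randomness -/

section MeasAlg

universe u

variable {K : ℕ}

theorem measurableSet_decide_le {X : Type*} [MeasurableSpace X] {f g : X → ℝ} (hf : Measurable f)
    (hg : Measurable g) : Measurable fun x => decide (f x ≤ g x) := by
  refine measurable_to_bool ?_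
  have : (fun x => decide (f x ≤ g x)) ⁻¹' {true} = {x | f x ≤ g x} := by
    ext x
    simp
  rw [this]
  exact measurableSet_le hf hg

theorem measurable_utility {M : ℕ} {X : Type*} [MeasurableSpace X] {w : X → Fin M → Fin K → ℝ}
    (hw : Measurable w) (π : Fin M → Fin K) : Measurable fun x => utility (w x) π :=
  Finset.measurable_sum _ fun m _ =>
    measurable_pi_iff.1 (measurable_pi_iff.1 hw m) (π m)

/-- The comparison of the utilities of all assignments. -/
noncomputable def comparison {M : ℕ} (w : Fin M → Fin K → ℝ) :
    (Fin M → Fin K) × (Fin M → Fin K) → Bool :=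
  fun q => decide (utility w q.1 ≤ utility w q.2)

theorem measurable_comparison {M : ℕ} {X : Type*} [MeasurableSpace X]
    {w : X → Fin M → Fin K → ℝ} (hw : Measurable w) : Measurable fun x => comparison (w x) :=
  measurable_pi_iff.2 fun q =>
    measurableSet_decide_le (measurable_utility hw q.1) (measurable_utility hw q.2)

open scoped Classical in
theorem argmax_eq_comparison {M : ℕ} (tie : TieBreak K) (S : Finset (Fin M → Fin K))
    (w : Fin M → Fin K → ℝ) : argmax tie S w =
      tie.pick (S.filter fun π => ∀ π' ∈ S, comparison w (π', π) = true) := by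
  simp [argmax, comparison]

/-- The maximizer depends on the weights only through the finite table `comparison` of pairwise
inequalities, and every function of a finite table is measurable. So an arbitrary tie-breaking rule
is allowed. -/
theorem measurable_argmax {M : ℕ} (tie : TieBreak K) (S : Finset (Fin M → Fin K))
    {X : Type*} [MeasurableSpace X] {w : X → Fin M → Fin K → ℝ} (hw : Measurable w) :
    Measurable fun x => argmax tie S (w x) := by
  classical
  simp only [argmax_eq_comparison]
  exact (measurable_of_countable fun b : (Fin M → Fin K) × (Fin M → Fin K) → Bool =>
    tie.pick (S.filter fun π => ∀ π' ∈ S, b (π', π) = true)).comp (measurable_comparison hw)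

theorem measurable_bestMatching {M : ℕ} (tie : TieBreak K) 
    {X : Type*} [MeasurableSpace X] {w : X → Fin M → Fin K → ℝ} (hw : Measurable w) :
    Measurable fun x => bestMatching tie (w x) := measurable_argmax tie _ hw

theorem measurable_edgeMatching {M : ℕ} (tie : TieBreak K) (e : Fin M × Fin K)
    {X : Type*} [MeasurableSpace X] {w : X → Fin M → Fin K → ℝ} (hw : Measurable w) :
    Measurable fun x => edgeMatching tie (w x) e := measurable_argmax tie _ hw

theorem measurable_utility_comp {M : ℕ} {X : Type*} [MeasurableSpace X]
    {w : X → Fin M → Fin K → ℝ} (hw : Measurable w) {π : X → Fin M → Fin K} (hπ : Measurable π) :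
    Measurable fun x => utility (w x) (π x) :=
  measurable_of_countable_cases (h := π) (F := fun π x => utility (w x) π)
    (fun π' => hπ (measurableSet_singleton π')) fun π => measurable_utility hw π

open scoped Classical in
/-- The leader's decisions at the beginning of an epoch: the surviving edges, the candidate
matchings and the estimated maximum matching. -/
noncomputable def decision {M : ℕ} (tie : TieBreak K) (T c p : ℕ) (E : List (Fin M × Fin K))
    (w : Fin M → Fin K → ℝ) :
    List (Fin M × Fin K) × List (Fin M → Fin K) × (Fin M → Fin K) :=
  (survivingEdges tie T c p E w, candidates tie (survivingEdges tie T c p E w) w,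
    bestMatching tie w)

open scoped Classical in
theorem measurableSet_decision {M : ℕ} (tie : TieBreak K) (T c p : ℕ) (E : List (Fin M × Fin K))
    {X : Type*} [MeasurableSpace X] {w : X → Fin M → Fin K → ℝ} (hw : Measurable w)
    (d : List (Fin M × Fin K) × List (Fin M → Fin K) × (Fin M → Fin K)) :
    MeasurableSet {x | decision tie T c p E (w x) = d} := by
  -- The decisions are a function of finitely many discrete data: the result of the elimination test
  -- for each edge, the edge matchings and the best matching.
  have hg : Measurable fun x => ((fun e : Fin M × Fin K => decide
      (utility (w x) (bestMatching tie (w x)) - utility (w x) (edgeMatching tie (w x) e)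
        ≤ 4 * M * epsRadius M K T c (p - 1))), (fun e => edgeMatching tie (w x) e),
      bestMatching tie (w x)) := by
    refine Measurable.prodMk (measurable_pi_iff.2 fun e => ?_) (Measurable.prodMk
      (measurable_pi_iff.2 fun e => measurable_edgeMatching tie e hw)
      (measurable_bestMatching tie hw))
    exact measurableSet_decide_le ((measurable_utility_comp hw (measurable_bestMatching tie hw)).sub
      (measurable_utility_comp hw (measurable_edgeMatching tie e hw))) measurable_const
  have := measurableSet_discrete_comp hg (fun z : (Fin M × Fin K → Bool) ×
    (Fin M × Fin K → Fin M → Fin K) × (Fin M → Fin K) =>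
      ((E.filter z.1, ((E.filter z.1).map z.2.1).dedup, z.2.2) :
        List (Fin M × Fin K) × List (Fin M → Fin K) × (Fin M → Fin K))) d
  convert this using 3 with x
  simp only [decision, candidates, survivingEdges]

/-- The part of a leader's epoch after her decisions have been sent. -/
noncomputable def leaderTail [NeZero K] (c n p : ℕ)
    (d : List (Fin (n + 1) × Fin K) × List (Fin (n + 1) → Fin K) × (Fin (n + 1) → Fin K))
    (next : (Fin (n + 1) → Fin K → ℝ) → Prog K (Fin K)) : Prog K (Fin K) :=
  match d.2.1 with
  | [π] => Prog.done (π 0)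
  | _ =>
    (Prog.pullList (exploreArms c p (d.2.1.map fun π => π 0))).andThen fun obs =>
    (listen (d.2.2 0) (n * (K * meanBits c p))).andThen fun msg =>
      next (Fin.cons (empiricalMean (exploreArms c p (d.2.1.map fun π => π 0)) obs) fun i k =>
        (ofBits (block (meanBits c p) (block (K * meanBits c p) msg i) k) : ℝ) / 2 ^ meanBits c p)

/-- The part of a leader's epoch after the decisions have been taken. -/
noncomputable def leaderEpoch [NeZero K] (c n p : ℕ) (κ : Fin (n + 1) → Fin K)
    (d : List (Fin (n + 1) × Fin K) × List (Fin (n + 1) → Fin K) × (Fin (n + 1) → Fin K))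
    (next : (Fin (n + 1) → Fin K → ℝ) → Prog K (Fin K)) : Prog K (Fin K) :=
  (Prog.pullList ((List.finRange n).flatMap fun i =>
      sendArms (κ 0) (κ i.succ) (toBits (sizeBits (n + 1) K) d.2.1.length))).andThen fun _ =>
  (Prog.pullList ((List.finRange n).flatMap fun i =>
      sendArms (κ 0) (κ i.succ)
        ((d.2.1.map (fun π => π i.succ) ++ [d.2.2 0, d.2.2 i.succ]).flatMap fun k =>
          toBits (armBits K) k))).andThen fun _ =>
  leaderTail c n p d next

theorem leaderLoop_succ [NeZero K] (tie : TieBreak K) (T c n fuel p : ℕ)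
    (E : List (Fin (n + 1) × Fin K)) (w : Fin (n + 1) → Fin K → ℝ) (κ : Fin (n + 1) → Fin K) :
    leaderLoop tie T c n (fuel + 1) p E w κ = leaderEpoch c n p κ (decision tie T c p E w) fun w' =>
      leaderLoop tie T c n fuel (p + 1) (decision tie T c p E w).1 w'
        (decision tie T c p E w).2.2 := by
  rw [leaderLoop]
  unfold leaderEpoch leaderTail decision
  simp only [Prog.bind_eq]
  congr 1

theorem measurable_empiricalMean (arms : List (Fin K)) (k : Fin K) {len : ℕ} :
    Measurable fun v : Fin len → ℝ × Bool => empiricalMean arms (List.ofFn v) k := by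
  classical
  -- Which observations are selected is decided by `arms` alone, so their number is constant and
  -- only the sum varies with the observations.
  have h : ∀ (arms : List (Fin K)) (len : ℕ),
      (∀ v v' : Fin len → ℝ × Bool,
        (((arms.zip (List.ofFn v)).filter fun x => x.1 = k).map fun x => x.2.1).length =
          (((arms.zip (List.ofFn v')).filter fun x => x.1 = k).map fun x => x.2.1).length) ∧
      Measurable fun v : Fin len → ℝ × Bool =>
        (((arms.zip (List.ofFn v)).filter fun x => x.1 = k).map fun x => x.2.1).sum := by
    intro arms
    induction arms with
    | nil => exact fun len => ⟨fun _ _ => by simp, by simp⟩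
    | cons a arms ih =>
      intro len
      cases len with
      | zero => exact ⟨fun _ _ => by simp, by simp⟩
      | succ len =>
        obtain ⟨h1, h2⟩ := ih len
        have h2' : Measurable fun v : Fin (len + 1) → ℝ × Bool =>
            (((arms.zip (List.ofFn fun i => v i.succ)).filter fun x => x.1 = k).map
              fun x => x.2.1).sum :=
          h2.comp (g := fun v : Fin len → ℝ × Bool => _)
            (f := fun (v : Fin (len + 1) → ℝ × Bool) i => v i.succ) (by fun_prop)
        by_cases ha : a = k
        · constructor
          · intro v v'
            simp only [List.ofFn_succ, List.zip_cons_cons, List.filter_cons, ha, decide_true,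
              if_true, List.map_cons, List.length_cons]
            rw [h1 (fun i => v i.succ) (fun i => v' i.succ)]
          · simp only [List.ofFn_succ, List.zip_cons_cons, List.filter_cons, ha, decide_true,
              if_true, List.map_cons, List.sum_cons]
            exact Measurable.add (by fun_prop) h2'
        · constructor
          · intro v v'
            simp only [List.ofFn_succ, List.zip_cons_cons, List.filter_cons, ha, decide_false]
            exact h1 (fun i => v i.succ) (fun i => v' i.succ)
          · simp only [List.ofFn_succ, List.zip_cons_cons, List.filter_cons, ha, decide_false]
            exact h2'
  obtain ⟨h1, h2⟩ := h arms len
  have h3 : (fun v : Fin len → ℝ × Bool => empiricalMean arms (List.ofFn v) k) = fun v =>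
      if (((arms.zip (List.ofFn fun _ : Fin len => ((0 : ℝ), false))).filter
        fun x => x.1 = k).map fun x : Fin K × ℝ × Bool => x.2.1).length = 0 then 0 else
      (((arms.zip (List.ofFn v)).filter fun x => x.1 = k).map
        fun x : Fin K × ℝ × Bool => x.2.1).sum /
        (((arms.zip (List.ofFn fun _ : Fin len => ((0 : ℝ), false))).filter
        fun x => x.1 = k).map fun x : Fin K × ℝ × Bool => x.2.1).length := by
    funext v
    rw [h1 (fun _ => ((0 : ℝ), false)) v]
    simp only [empiricalMean]
  rw [h3]
  clear h3
  split_ifs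
  · exact measurable_const
  · exact h2.div_const _

theorem measurable_truncBits (b : ℕ) : Measurable (truncBits b) := by
  unfold truncBits
  exact (Nat.measurable_floor.comp (measurable_id.mul_const _)).min measurable_const

theorem measProg_leaderEpoch [NeZero K] {X : Type u} [MeasurableSpace X] (c n p : ℕ)
    (κ : Fin (n + 1) → Fin K)
    (d : List (Fin (n + 1) × Fin K) × List (Fin (n + 1) → Fin K) × (Fin (n + 1) → Fin K))
    {next : (Fin (n + 1) → Fin K → ℝ) → Prog K (Fin K)}
    (h : ∀ {X : Type u} [MeasurableSpace X] (w : X → Fin (n + 1) → Fin K → ℝ),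
      Measurable w → MeasProg fun x => next (w x)) :
    MeasProg fun _ : X => leaderEpoch c n p κ d next := by
  unfold leaderEpoch leaderTail
  refine MeasProg.pullList_const _ (MeasProg.pullList_const _ ?_)
  split
  · exact MeasProg.done measurable_const
  · refine MeasProg.pullList _ ?_
    refine MeasProg.listen _ _ fun msg => ?_
    refine h _ (measurable_finCons (measurable_pi_iff.2 fun k => ?_) measurable_const)
    exact (measurable_empiricalMean _ k).comp measurable_snd

theorem measProg_leaderLoop [NeZero K] (tie : TieBreak K) (T c n fuel p : ℕ)
    (E : List (Fin (n + 1) × Fin K)) (κ : Fin (n + 1) → Fin K) {X : Type u} [MeasurableSpace X]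
    {w : X → Fin (n + 1) → Fin K → ℝ} (hw : Measurable w) :
    MeasProg fun x => leaderLoop tie T c n fuel p E (w x) κ := by
  induction fuel generalizing p E κ X with
  | zero => exact MeasProg.done measurable_const
  | succ fuel ih =>
    simp only [leaderLoop_succ]
    refine MeasProg.cases (h := fun x => decision tie T c p E (w x))
      (F := fun d _ => leaderEpoch c n p κ d fun w' =>
        leaderLoop tie T c n fuel (p + 1) d.1 w' d.2.2)
      (measurableSet_decision tie T c p E hw) fun d => ?_
    exact measProg_leaderEpoch c n p κ d fun w hw => ih _ _ _ hw

/-- The pulls with which follower number `j` reports the integers `v` to the leader. -/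
def reportArms (c n j p : ℕ) (κ₁ κ : Fin K) (v : Fin K → ℕ) : List (Fin K) :=
  (List.range n).flatMap fun i =>
    if i = j then
      sendArms κ κ₁ ((List.finRange K).flatMap fun k => toBits (meanBits c p) (v k))
    else List.replicate (K * meanBits c p) κ

/-- The part of a follower's epoch after the number of the candidate matchings and her arms have
been received. -/
noncomputable def followerEpoch (c n j p size : ℕ) (armNo : ℕ → Fin K)
    (next : Prog K (Fin K)) : Prog K (Fin K) :=
  if size = 1 then Prog.done (armNo 0)
  else
    (Prog.pullList (exploreArms c p ((List.range size).map armNo))).andThen fun obs =>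
    (Prog.pullList (reportArms c n j p (armNo size) (armNo (size + 1)) fun k =>
      truncBits (meanBits c p)
        (empiricalMean (exploreArms c p ((List.range size).map armNo)) obs k))).andThen fun _ =>
    next

/-- The size announced to follower number `j`. -/
def decodeSize (n K j : ℕ) (b : List Bool) : ℕ :=
  ofBits (block (sizeBits (n + 1) K) b j)

/-- The arms announced to follower number `j`. -/
def decodeArm [NeZero K] (j size : ℕ) (b : List Bool) (i : ℕ) : Fin K :=
  Fin.ofNat K (ofBits (block (armBits K) (block ((size + 2) * armBits K) b j) i))

theorem followerLoop_succ [NeZero K] (c n j fuel p : ℕ) (κ₁ κ : Fin K) :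
    followerLoop c n j (fuel + 1) p κ₁ κ =
      (Prog.pullList (List.replicate (n * sizeBits (n + 1) K) κ)).andThen fun o₁ =>
      (Prog.pullList (List.replicate (n * ((decodeSize n K j (o₁.map Prod.snd) + 2) * armBits K))
        κ)).andThen fun o₂ =>
      followerEpoch c n j p (decodeSize n K j (o₁.map Prod.snd))
        (decodeArm j (decodeSize n K j (o₁.map Prod.snd)) (o₂.map Prod.snd))
        (followerLoop c n j fuel (p + 1)
          (decodeArm j (decodeSize n K j (o₁.map Prod.snd)) (o₂.map Prod.snd)
            (decodeSize n K j (o₁.map Prod.snd)))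
          (decodeArm j (decodeSize n K j (o₁.map Prod.snd)) (o₂.map Prod.snd)
            (decodeSize n K j (o₁.map Prod.snd) + 1))) := by
  rw [followerLoop]
  simp only [Prog.bind_eq, listen_andThen]
  rfl

theorem MeasProg.pullList_snd₂ {X : Type u} [MeasurableSpace X] (l₁ : List (Fin K))
    (l₂ : List Bool → List (Fin K)) (G : List Bool → List Bool → Prog K (Fin K))
    (h : ∀ b₁ b₂, MeasProg fun _ : X => G b₁ b₂) :
    MeasProg fun _ : X => (Prog.pullList l₁).andThen fun o₁ =>
      (Prog.pullList (l₂ (o₁.map Prod.snd))).andThen fun o₂ =>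
        G (o₁.map Prod.snd) (o₂.map Prod.snd) :=
  MeasProg.pullList_snd l₁ (F := fun _ b₁ => (Prog.pullList (l₂ b₁)).andThen fun o₂ =>
    G b₁ (o₂.map Prod.snd)) fun b₁ => MeasProg.pullList_snd _ (F := fun _ b₂ => G b₁ b₂) (h b₁)

theorem measProg_followerEpoch (c n j p size : ℕ) (armNo : ℕ → Fin K) {next : Prog K (Fin K)}
    {X : Type u} [MeasurableSpace X]
    (h : ∀ {X : Type u} [MeasurableSpace X], MeasProg fun _ : X => next) :
    MeasProg fun _ : X => followerEpoch c n j p size armNo next := by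
  unfold followerEpoch
  split_ifs
  · exact MeasProg.done measurable_const
  · refine MeasProg.pullList _ ?_
    generalize exploreArms c p ((List.range size).map armNo) = arms
    have hm : Measurable fun z : X × (Fin arms.length → ℝ × Bool) => fun k : Fin K =>
        truncBits (meanBits c p) (empiricalMean arms (List.ofFn z.2) k) :=
      measurable_pi_iff.2 fun k => (measurable_truncBits _).comp
        ((measurable_empiricalMean _ k).comp measurable_snd)
    have hF : ∀ v : Fin K → ℕ, MeasProg fun _ : X × (Fin arms.length → ℝ × Bool) =>
        (Prog.pullList (reportArms c n j p (armNo size) (armNo (size + 1)) v)).andThen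
          fun _ => next := fun v => MeasProg.pullList_const _ h
    -- The reported integers form a vector with countably many values, so the list of pulls can be
    -- frozen by a distinction of cases.
    have := MeasProg.cases (fun v => hm (measurableSet_singleton v)) hF
    exact this

theorem measProg_followerLoop [NeZero K] (c n j fuel p : ℕ) (κ₁ κ : Fin K) {X : Type u}
    [MeasurableSpace X] : MeasProg fun _ : X => followerLoop c n j fuel p κ₁ κ := by
  induction fuel generalizing p κ₁ κ X with
  | zero => exact MeasProg.done measurable_const
  | succ fuel ih =>
    simp only [followerLoop_succ]
    exact MeasProg.pullList_snd₂ _ (fun b₁ => List.replicate (n *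
      ((decodeSize n K j b₁ + 2) * armBits K)) κ) (fun b₁ b₂ =>
        followerEpoch c n j p (decodeSize n K j b₁)
        (decodeArm (K := K) j (decodeSize n K j b₁) b₂)
        (followerLoop c n j fuel (p + 1)
          (decodeArm j (decodeSize n K j b₁) b₂ (decodeSize n K j b₁))
          (decodeArm j (decodeSize n K j b₁) b₂ (decodeSize n K j b₁ + 1))))
      fun b₁ b₂ => measProg_followerEpoch _ _ _ _ _ _ (ih _ _ _)

theorem measProg_hopping [NeZero K] (k : Fin K) {X : Type u} [MeasurableSpace X]
    {F : X → ℕ × ℕ → Prog K (Fin K)} (h : ∀ r, MeasProg fun x => F x r) :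
    MeasProg fun x => (hopping k).andThen (F x) := by
  unfold hopping
  simp only [Prog.bind_eq, Prog.andThen_assoc, Prog.pure_eq, Prog.done_andThen]
  have hc : ∀ o : List (ℝ × Bool), (o.countP fun o => o.2) = (o.map Prod.snd).countP id := by
    intro o
    rw [List.countP_map]
    rfl
  simp only [hc]
  refine MeasProg.pullList_snd _ (F := fun x bs => (Prog.pullList _).andThen fun o =>
    (Prog.pullList _).andThen fun _ =>
      F x (bs.countP id, bs.countP id + (o.map Prod.snd).countP id)) fun bs => ?_
  refine MeasProg.pullList_snd _ (F := fun x bs' => (Prog.pullList _).andThen fun _ =>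
      F x (bs.countP id, bs.countP id + bs'.countP id)) fun bs' => ?_
  exact MeasProg.pullList_const _ (h _)

theorem measProg_metcElim [NeZero K] (tie : TieBreak K) (T c : ℕ) {X : Type u}
    [MeasurableSpace X] {u : X → ℕ → Fin K} (hu : Measurable u) :
    MeasProg fun x => metcElim tie T c (u x) := by
  unfold metcElim initPhase
  simp only [Prog.bind_eq, Prog.andThen_assoc]
  refine MeasProg.musicalChairs hu _ _ fun o => ?_
  refine measProg_hopping _ fun r => ?_
  rcases r with ⟨_ | j, n⟩
  · exact measProg_leaderLoop _ _ _ _ _ _ _ _ measurable_const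
  · exact measProg_followerLoop _ _ _ _ _ _ _

theorem measurable_reward {M : ℕ} {X : Type*} [MeasurableSpace X] {a : X → Fin M → Fin K}
    (ha : Measurable a) {y : X → Fin M → Fin K → ℝ} (hy : Measurable y) (m : Fin M) :
    Measurable fun x => reward (a x) (y x) m := by
  refine measurable_of_countable_cases (h := a) (F := fun a x => reward a (y x) m)
    (fun a' => ha (measurableSet_singleton a')) fun a' => ?_
  unfold reward
  split_ifs
  · exact measurable_const
  · exact measurable_pi_iff.1 (measurable_pi_iff.1 hy m) _

theorem measProg_progsAt {M : ℕ} {X : Type u} [MeasurableSpace X]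
    {prog : X → Fin M → Prog K (Fin K)} (hp : ∀ m, MeasProg fun x => prog x m)
    {y : X → Fin M → Fin K → ℕ → ℝ} (hy : ∀ m k t, Measurable fun x => y x m k t) (t : ℕ)
    (m : Fin M) : MeasProg fun x => progsAt (prog x) (y x) t m := by
  induction t generalizing m with
  | zero => exact hp m
  | succ t ih =>
    have ha : Measurable fun x => fun m' => (progsAt (prog x) (y x) t m').arm :=
      measurable_pi_iff.2 fun m' => (ih m' 0).measurable_arm
    refine MeasProg.rest (ih m) ?_ ?_
    · exact measurable_reward ha
        (measurable_pi_iff.2 fun m' => measurable_pi_iff.2 fun k => hy m' k t) m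
    · exact (measurable_of_countable fun a : Fin M → Fin K => collided a m).comp ha

theorem measurable_armsAt {M : ℕ} {X : Type u} [MeasurableSpace X]
    {prog : X → Fin M → Prog K (Fin K)} (hp : ∀ m, MeasProg fun x => prog x m)
    {y : X → Fin M → Fin K → ℕ → ℝ} (hy : ∀ m k t, Measurable fun x => y x m k t) (t : ℕ) :
    Measurable fun x => armsAt (prog x) (y x) t :=
  measurable_pi_iff.2 fun m => (measProg_progsAt hp hy t m 0).measurable_arm

end MeasAlg

/-! ### The initialization -/

section Chairs

variable {M K : ℕ}

/-- One round of musical chairs. -/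
def nextSeats (v : Fin M → Fin K) (o : Fin M → Option (Fin K)) (m : Fin M) : Option (Fin K) :=
  match o m with
  | some k => some k
  | none => if collided (fun m' => (o m').getD (v m')) m then none else some (v m)

/-- The seats after `n` rounds of musical chairs. -/
def finalSeats (u : Fin M → ℕ → Fin K) : ℕ → (Fin M → Option (Fin K)) → Fin M → Option (Fin K)
  | 0, o => o
  | n + 1, o => finalSeats u n (nextSeats (fun m => u m n) o)

theorem progsAt_musicalChairs (u : Fin M → ℕ → Fin K) (n : ℕ) (o : Fin M → Option (Fin K))
    (y : Fin M → Fin K → ℕ → ℝ) (F : Fin M → Option (Fin K) → Prog K (Fin K)) :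
    progsAt (fun m => (musicalChairs (u m) n (o m)).andThen (F m)) y n =
      fun m => F m (finalSeats u n o m) := by
  induction n generalizing o y with
  | zero =>
    funext m
    simp only [progsAt, finalSeats]
    cases o m <;> rfl
  | succ n ih =>
    have hadd := progsAt_add (fun m => (musicalChairs (u m) (n + 1) (o m)).andThen (F m)) y 1 n
    rw [Nat.add_comm 1 n] at hadd
    have harm : ∀ m, ((musicalChairs (u m) (n + 1) (o m)).andThen (F m)).arm =
        (o m).getD (u m n) := by
      intro m
      cases o m <;> rfl
    have h1 : progsAt (fun m => (musicalChairs (u m) (n + 1) (o m)).andThen (F m)) y 1 =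
        fun m => (musicalChairs (u m) n (nextSeats (fun m => u m n) o m)).andThen (F m) := by
      funext m
      change Prog.rest ((musicalChairs (u m) (n + 1) (o m)).andThen (F m)) _
        (collided (fun m' => ((musicalChairs (u m') (n + 1) (o m')).andThen (F m')).arm) m) = _
      simp only [harm]
      unfold nextSeats
      cases h : o m <;> rfl
    rw [hadd, h1, ih]
    rfl

/-- No arm is occupied by two players. -/
def SeatsDistinct (o : Fin M → Option (Fin K)) : Prop :=
  ∀ m m' k, o m = some k → o m' = some k → m = m'

theorem nextSeats_eq_some {v : Fin M → Fin K} {o : Fin M → Option (Fin K)} {m : Fin M} {k : Fin K}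
    (h : nextSeats v o m = some k) :
    o m = some k ∨
      (o m = none ∧ v m = k ∧ collided (fun m' => (o m').getD (v m')) m = false) := by
  unfold nextSeats at h
  cases ho : o m with
  | some k' =>
    rw [ho] at h
    exact Or.inl h
  | none =>
    rw [ho] at h
    right
    by_cases hc : collided (fun m' => (o m').getD (v m')) m = true
    · simp [hc] at h
    · simp only [hc] at h
      simp only [Bool.not_eq_true] at hc
      exact ⟨rfl, by simpa using h, hc⟩

/-- A seat is taken only without a collision, so nobody else, seated or not, pulled that arm in the
round. -/
theorem SeatsDistinct.next {o : Fin M → Option (Fin K)} (ho : SeatsDistinct o)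
    (v : Fin M → Fin K) : SeatsDistinct (nextSeats v o) := by
  have key : ∀ m m' k, o m = none → v m = k →
      collided (fun m' => (o m').getD (v m')) m = false → nextSeats v o m' = some k → m = m' := by
    intro m m' k hm hv hc h'
    by_contra hne
    rw [Bool.eq_false_iff] at hc
    refine hc (collided_eq_true_iff.2 ⟨m', fun h => hne h.symm, ?_⟩)
    rcases nextSeats_eq_some h' with h | ⟨h, hv', -⟩
    · simp [hm, h, hv]
    · simp [hm, h, hv, hv']
  intro m m' k h h'
  rcases nextSeats_eq_some h with h1 | ⟨h1, h2, h3⟩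
  · rcases nextSeats_eq_some h' with h1' | ⟨h1', h2', h3'⟩
    · exact ho m m' k h1 h1'
    · exact (key m' m k h1' h2' h3' h).symm
  · exact key m m' k h1 h2 h3 h'

theorem SeatsDistinct.final {o : Fin M → Option (Fin K)} (ho : SeatsDistinct o)
    (u : Fin M → ℕ → Fin K) (n : ℕ) : SeatsDistinct (finalSeats u n o) := by
  induction n generalizing o with
  | zero => exact ho
  | succ n ih => exact ih (ho.next _)

theorem finalSeats_eq_some (u : Fin M → ℕ → Fin K) (n : ℕ) {o : Fin M → Option (Fin K)}
    {m : Fin M} {k : Fin K} (h : o m = some k) : finalSeats u n o m = some k := by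
  induction n generalizing o with
  | zero => exact h
  | succ n ih =>
    refine ih ?_
    simp [nextSeats, h]

/-- The counter runs downwards: the first of `n` rounds uses the random arm with index `n - 1`, the
later ones use smaller indices. Hence each round is independent of the remaining ones. -/
theorem finalSeats_congr {u u' : Fin M → ℕ → Fin K} {n : ℕ} (h : ∀ i < n, ∀ m, u m i = u' m i)
    (o : Fin M → Option (Fin K)) : finalSeats u n o = finalSeats u' n o := by
  induction n generalizing o with
  | zero => rfl
  | succ n ih =>
    have : (fun m => u m n) = fun m => u' m n := funext fun m => h n (by omega) m
    simp only [finalSeats, this]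
    exact ih (fun i hi => h i (by omega)) _

end Chairs

/-! ### Ranks as numbers of occupied lower arms -/

section Rank

variable {M K : ℕ} {k : Fin M → Fin K}

/-- The number of players on a lower arm. -/
def rankOf (k : Fin M → Fin K) (m : Fin M) : ℕ := (Finset.univ.filter fun m' => k m' < k m).card

theorem rankOf_add_card (hk : Function.Injective k) (m : Fin M) :
    rankOf k m + (Finset.univ.filter fun m' => k m < k m').card = M - 1 := by
  unfold rankOf
  rw [← Finset.card_union_of_disjoint]
  · have : (Finset.univ.filter fun m' => k m' < k m) ∪ (Finset.univ.filter fun m' => k m < k m') =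
        Finset.univ.erase m := by
      ext m'
      simp only [Finset.mem_union, Finset.mem_filter, Finset.mem_univ, true_and,
        Finset.mem_erase, and_true]
      rw [← hk.ne_iff, ← lt_or_lt_iff_ne]
    rw [this, Finset.card_erase_of_mem (Finset.mem_univ m)]
    simp
  · rw [Finset.disjoint_filter]
    intro m' _ h h'
    exact absurd h (not_lt.2 h'.le)

theorem rankOf_lt (m : Fin M) : rankOf k m < M := by
  have : rankOf k m < (Finset.univ : Finset (Fin M)).card :=
    Finset.card_lt_card (Finset.filter_ssubset.2 ⟨m, Finset.mem_univ m, lt_irrefl _⟩)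
  simpa using this

theorem rankOf_injective (hk : Function.Injective k) : Function.Injective (rankOf k) := by
  have key : ∀ m m', k m < k m' → rankOf k m < rankOf k m' := by
    intro m m' h
    refine Finset.card_lt_card (Finset.ssubset_iff_of_subset ?_ |>.2 ⟨m, ?_, ?_⟩)
    · intro x hx
      simp only [Finset.mem_filter, Finset.mem_univ, true_and] at hx ⊢
      exact hx.trans h
    · simpa using h
    · simp
  intro m m' h
  by_contra hne
  rcases lt_or_gt_of_ne (hk.ne hne) with h' | h'
  · exact absurd h (key _ _ h').ne
  · exact absurd h (key _ _ h').ne'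

end Rank

/-! ### Sequential hopping: every two players meet exactly once -/

section Hopping

variable {M K : ℕ} [NeZero K]

/-- The arm pulled in round `t` of the sequential hopping by a player on arm `k`. -/
def hopArm (k : Fin K) (t : ℕ) : Fin K :=
  if t < 2 * (k : ℕ) then k else if t < k + K - 1 then Fin.ofNat K (t - k + 1) else 0

theorem val_hopArm (k : Fin K) (t : ℕ) : (hopArm k t : ℕ) =
    if t < 2 * (k : ℕ) then (k : ℕ) else if t < k + K - 1 then t - k + 1 else 0 := by
  unfold hopArm
  split_ifs with h1 h2
  · rfl
  · rw [Fin.val_ofNat, Nat.mod_eq_of_lt]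
    have := k.isLt
    omega
  · rfl

theorem finRange_eq_map_range : List.finRange K = (List.range K).map (Fin.ofNat K) := by
  apply List.ext_getElem
  · simp
  · intro i h1 h2
    apply Fin.ext
    simp only [List.length_finRange] at h1
    simp [Nat.mod_eq_of_lt h1]

theorem filter_finRange_lt (k : Fin K) : (List.finRange K).filter (fun i => k < i) =
    (List.range (K - 1 - k)).map fun i => Fin.ofNat K (k + 1 + i) := by
  have hk := k.isLt
  rw [finRange_eq_map_range, List.filter_map]
  have h1 : List.range K =
      List.range ((k : ℕ) + 1) ++ (List.range (K - 1 - k)).map ((k : ℕ) + 1 + ·) := by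
    rw [← List.range_add]
    congr 1
    omega
  conv_lhs => rw [h1]
  rw [List.filter_append, List.map_append]
  have h2 : (List.range ((k : ℕ) + 1)).filter ((fun i => decide (k < i)) ∘ Fin.ofNat K) = [] := by
    rw [List.filter_eq_nil_iff]
    intro i hi
    rw [List.mem_range] at hi
    simp only [Function.comp_apply, decide_eq_true_eq, Fin.lt_def, Fin.val_ofNat]
    rw [Nat.mod_eq_of_lt (by omega)]
    omega
  have h3 : ((List.range (K - 1 - k)).map ((k : ℕ) + 1 + ·)).filter
      ((fun i => decide (k < i)) ∘ Fin.ofNat K) =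
      (List.range (K - 1 - k)).map ((k : ℕ) + 1 + ·) := by
    rw [List.filter_eq_self]
    intro i hi
    rw [List.mem_map] at hi
    obtain ⟨i, hi, rfl⟩ := hi
    rw [List.mem_range] at hi
    simp only [Function.comp_apply, decide_eq_true_eq, Fin.lt_def, Fin.val_ofNat]
    rw [Nat.mod_eq_of_lt (by omega)]
    omega
  rw [h2, h3]
  simp [Function.comp_def]

theorem hopList_eq (k : Fin K) : List.replicate (2 * (k : ℕ)) k ++
    ((List.finRange K).filter (fun i => k < i) ++ List.replicate (K - 1 - (k : ℕ)) (0 : Fin K)) =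
      (List.range (2 * K - 2)).map (hopArm k) := by
  have hk := k.isLt
  rw [filter_finRange_lt]
  apply List.ext_getElem
  · simp
    omega
  · intro t h1 h2
    simp only [List.length_map, List.length_range] at h2
    apply Fin.ext
    rw [List.getElem_map, List.getElem_range, val_hopArm]
    simp only [List.getElem_append, List.length_replicate, List.length_map, List.length_range,
      List.getElem_replicate, List.getElem_map, List.getElem_range]
    split_ifs with h3 h4 h5 h6
    · rfl
    · rw [Fin.val_ofNat, Nat.mod_eq_of_lt (by omega)]
      omega
    · omega
    · omega
    · rfl

/-- The number of collisions among some observations. -/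
def collisions (obs : List (ℝ × Bool)) : ℕ := obs.countP fun o => o.2

theorem hopping_andThen (k : Fin K) (G : ℕ × ℕ → Prog K (Fin K)) :
    (hopping k).andThen G = (Prog.pullList ((List.range (2 * K - 2)).map (hopArm k))).andThen
      fun obs => G (collisions (obs.take (2 * k)),
        collisions (obs.take (2 * k)) + collisions ((obs.drop (2 * k)).take (K - 1 - k))) := by
  rw [← hopList_eq, Prog.pullList_append_andThen]
  unfold hopping
  simp only [Prog.bind_eq, Prog.andThen_assoc, Prog.pure_eq, Prog.done_andThen,
    Prog.pullList_append_andThen]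
  refine Prog.pullList_andThen_congr _ _ _ fun o₁ h₁ => ?_
  refine Prog.pullList_andThen_congr _ _ _ fun o₂ h₂ => ?_
  refine Prog.pullList_andThen_congr _ _ _ fun o₃ h₃ => ?_
  rw [List.length_replicate] at h₁
  rw [filter_finRange_lt, List.length_map, List.length_range] at h₂
  rw [List.take_left' h₁, List.drop_left' h₁, List.take_left' h₂]
  rfl

theorem countP_range_eq_card (n : ℕ) (p : ℕ → Bool) :
    (List.range n).countP p = ((Finset.range n).filter fun t => p t = true).card := by
  induction n with
  | zero => rfl
  | succ n ih =>
    rw [List.range_succ, List.countP_append, ih, Finset.range_add_one, Finset.filter_insert]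
    by_cases h : p n = true <;> simp [h]

variable {k : Fin M → Fin K}

/-- A player sweeping from arm `i` is on arm `t - i + 1` in round `t`. So two sweepers never meet,
and a sweeper from `i` hits the player on arm `j > i` in round `i + j - 1` only, before that player
stops waiting at round `2 j`. -/
theorem collided_hopArm_waiting (hk : Function.Injective k) {m : Fin M} {t : ℕ}
    (ht : t < 2 * (k m : ℕ)) : collided (fun m' => hopArm (k m') t) m = true ↔
      ∃ m', k m' < k m ∧ t + 1 = (k m : ℕ) + k m' := by
  rw [collided_eq_true_iff]
  constructor
  · rintro ⟨m', hne, h⟩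
    have hne' : (k m' : ℕ) ≠ k m := fun h' => hne (hk (Fin.ext h'))
    have h' := congrArg Fin.val h
    rw [val_hopArm, val_hopArm, if_pos ht] at h'
    have := (k m).isLt
    refine ⟨m', ?_, ?_⟩
    · rw [Fin.lt_def]
      split_ifs at h' <;> omega
    · split_ifs at h' <;> omega
  · rintro ⟨m', hlt, h⟩
    rw [Fin.lt_def] at hlt
    refine ⟨m', fun h' => by rw [h'] at hlt; omega, Fin.ext ?_⟩
    have := (k m).isLt
    rw [val_hopArm, val_hopArm, if_pos ht]
    split_ifs <;> omega

/-- The same encounter from the sweeper's side: in the `t`-th round of her sweep she is on arm `k m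
+ t + 1`, and a player seated there is still waiting because `2 (k m) + t < 2 (k m + t + 1)`. -/
theorem collided_hopArm_sweep (hk : Function.Injective k) {m : Fin M} {t : ℕ}
    (ht : t < K - 1 - (k m : ℕ)) :
    collided (fun m' => hopArm (k m') (2 * (k m : ℕ) + t)) m = true ↔
      ∃ m', (k m' : ℕ) = k m + t + 1 := by
  rw [collided_eq_true_iff]
  constructor
  · rintro ⟨m', hne, h⟩
    have hne' : (k m' : ℕ) ≠ k m := fun h' => hne (hk (Fin.ext h'))
    have h' := congrArg Fin.val h
    rw [val_hopArm, val_hopArm] at h'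
    have := (k m).isLt
    refine ⟨m', ?_⟩
    split_ifs at h' <;> omega
  · rintro ⟨m', h⟩
    refine ⟨m', fun h' => by rw [h'] at h; omega, Fin.ext ?_⟩
    have := (k m).isLt
    have := (k m').isLt
    rw [val_hopArm, val_hopArm]
    split_ifs <;> omega

theorem card_collided_waiting (hk : Function.Injective k) (m : Fin M) :
    ((Finset.range (2 * (k m : ℕ))).filter fun t =>
      collided (fun m' => hopArm (k m') t) m = true).card = rankOf k m := by
  symm
  refine Finset.card_bij (fun m' _ => (k m : ℕ) + k m' - 1) ?_ ?_ ?_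
  · intro m' h
    simp only [Finset.mem_filter, Finset.mem_univ, true_and, Fin.lt_def] at h
    rw [Finset.mem_filter, Finset.mem_range]
    have h1 : (k m : ℕ) + k m' - 1 < 2 * (k m : ℕ) := by omega
    exact ⟨h1, (collided_hopArm_waiting hk h1).2 ⟨m', h, by omega⟩⟩
  · intro m₁ h₁ m₂ h₂ h
    simp only [Finset.mem_filter, Finset.mem_univ, true_and, Fin.lt_def] at h₁ h₂
    exact hk (Fin.ext (by omega))
  · intro t ht
    rw [Finset.mem_filter, Finset.mem_range] at ht
    obtain ⟨m', h, h'⟩ := (collided_hopArm_waiting hk ht.1).1 ht.2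
    exact ⟨m', by simpa using h, by omega⟩

theorem card_collided_sweep (hk : Function.Injective k) (m : Fin M) :
    ((Finset.range (K - 1 - (k m : ℕ))).filter fun t =>
      collided (fun m' => hopArm (k m') (2 * (k m : ℕ) + t)) m = true).card =
        (Finset.univ.filter fun m' => k m < k m').card := by
  symm
  refine Finset.card_bij (fun m' _ => (k m' : ℕ) - k m - 1) ?_ ?_ ?_
  · intro m' h
    simp only [Finset.mem_filter, Finset.mem_univ, true_and, Fin.lt_def] at h
    rw [Finset.mem_filter, Finset.mem_range]
    have := (k m').isLt
    have h1 : (k m' : ℕ) - k m - 1 < K - 1 - (k m : ℕ) := by omega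
    exact ⟨h1, (collided_hopArm_sweep hk h1).2 ⟨m', by omega⟩⟩
  · intro m₁ h₁ m₂ h₂ h
    simp only [Finset.mem_filter, Finset.mem_univ, true_and, Fin.lt_def] at h₁ h₂
    exact hk (Fin.ext (by omega))
  · intro t ht
    rw [Finset.mem_filter, Finset.mem_range] at ht
    obtain ⟨m', h⟩ := (collided_hopArm_sweep hk ht.1).1 ht.2
    refine ⟨m', ?_, by omega⟩
    simp only [Finset.mem_filter, Finset.mem_univ, true_and, Fin.lt_def]
    omega

/-- Collisions while waiting count the players on lower arms, collisions during the sweep those on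
higher arms; together they count all the others. -/
theorem progsAt_hopping (hk : Function.Injective k) (y : Fin M → Fin K → ℕ → ℝ)
    (G : Fin M → ℕ × ℕ → Prog K (Fin K)) :
    progsAt (fun m => (hopping (k m)).andThen (G m)) y (2 * K - 2) =
      fun m => G m (rankOf k m, M - 1) := by
  simp only [hopping_andThen]
  rw [(run_pullList (2 * K - 2) (fun t m => hopArm (k m) t) y fun m obs =>
    G m (collisions (obs.take (2 * k m)), collisions (obs.take (2 * k m)) +
      collisions ((obs.drop (2 * k m)).take (K - 1 - k m)))).2]
  funext m
  have hkm := (k m).isLt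
  have h1 : collisions ((observations (fun t m => hopArm (k m) t) y (2 * K - 2) m).take
      (2 * k m)) = rankOf k m := by
    rw [← card_collided_waiting hk m, ← countP_range_eq_card]
    unfold collisions observations
    rw [← List.map_take, List.take_range, min_eq_left (by omega), List.countP_map]
    rfl
  have h2 : collisions (((observations (fun t m => hopArm (k m) t) y (2 * K - 2) m).drop
      (2 * k m)).take (K - 1 - k m)) = (Finset.univ.filter fun m' => k m < k m').card := by
    rw [← card_collided_sweep hk m, ← countP_range_eq_card]
    unfold collisions observations
    have : List.range (2 * K - 2) = List.range (2 * k m) ++ ((List.range (K - 1 - k m)).map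
        (2 * (k m : ℕ) + ·) ++ (List.range (K - 1 - k m)).map
          (2 * (k m : ℕ) + (K - 1 - k m) + ·)) := by
      rw [← List.append_assoc, ← List.range_add, ← List.range_add]
      congr 1
      omega
    rw [this, List.map_append, List.map_append, List.drop_left' (by simp),
      List.take_left' (by simp), List.map_map, List.countP_map]
    rfl
  rw [h1, h2, rankOf_add_card hk]

end Hopping

/-! ### The programs after the initialization, in the order of the ranks -/

section Init

variable {n K : ℕ}

theorem rankMap_bijective {k : Fin (n + 1) → Fin K} (hk : Function.Injective k) :
    Function.Bijective fun m : Fin (n + 1) => (⟨rankOf k m, rankOf_lt m⟩ : Fin (n + 1)) := by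
  rw [← Finite.injective_iff_bijective]
  intro m m' h
  exact rankOf_injective hk (congrArg Fin.val h)

variable [NeZero K]

/-- The programs of the players after the initialization, in the order of their ranks. -/
noncomputable def rankedProgs (tie : TieBreak K) (T c n : ℕ) : Fin (n + 1) → Prog K (Fin K) :=
  Fin.cases (leaderAlg tie T c n) fun j => followerAlg T c n j

/-- The number of rounds of musical chairs. -/
noncomputable def chairRounds (K T : ℕ) : ℕ := ⌈(K : ℝ) * Real.log (K / (1 / ((K : ℝ) * T)))⌉₊

/-- All players have found an arm in the musical chairs. -/
def AllSeated {M : ℕ} (T : ℕ) (u : Fin M → ℕ → Fin K) : Prop :=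
  ∀ m, finalSeats u (chairRounds K T) (fun _ => none) m ≠ none

open scoped Classical in
/-- The players in the order of their ranks, if they have found the arms `o`. -/
noncomputable def rankOrder (o : Fin (n + 1) → Option (Fin K)) : Equiv.Perm (Fin (n + 1)) :=
  if hk : Function.Injective fun m => (o m).getD 0 then
    (Equiv.ofBijective _ (rankMap_bijective hk)).symm else 1

/-- If all players have found an arm in the musical chairs, then they know their ranks at the end
of the initialization. -/
theorem progsAt_metcElim_rankOrder (tie : TieBreak K) (T c : ℕ) {u : Fin (n + 1) → ℕ → Fin K}
    (hu : AllSeated T u) (y : Fin (n + 1) → Fin K → ℕ → ℝ) (j : Fin (n + 1)) :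
    progsAt (fun m => metcElim tie T c (u m)) y (chairRounds K T + (2 * K - 2))
      (rankOrder (finalSeats u (chairRounds K T) fun _ => none) j) = rankedProgs tie T c n j := by
  set k : Fin (n + 1) → Fin K := fun m =>
    (finalSeats u (chairRounds K T) (fun _ => none) m).getD 0 with hkdef
  have hk : Function.Injective k := by
    have hd : SeatsDistinct (finalSeats u (chairRounds K T) fun _ => none) :=
      SeatsDistinct.final (fun m m' k h => by simp at h) u _
    have hs : ∀ m, finalSeats u (chairRounds K T) (fun _ => none) m = some (k m) := by
      intro m
      obtain ⟨x, hx⟩ := Option.ne_none_iff_exists'.1 (hu m)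
      simp [hkdef, hx]
    intro m m' h
    exact hd m m' (k m) (hs m) (by rw [h]; exact hs m')
  let r : Fin (n + 1) → Fin (n + 1) := fun m => ⟨rankOf k m, rankOf_lt m⟩
  have hr : Function.Bijective r := rankMap_bijective hk
  have hσ : rankOrder (finalSeats u (chairRounds K T) fun _ => none) =
      (Equiv.ofBijective r hr).symm := by
    unfold rankOrder
    rw [dif_pos hk]
  rw [hσ]
  obtain ⟨m, rfl⟩ := (Equiv.ofBijective r hr).surjective j
  rw [Equiv.symm_apply_apply, progsAt_add]
  have hprog : (fun m => metcElim tie T c (u m)) = fun m =>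
      (musicalChairs (u m) (chairRounds K T) none).andThen fun o => (hopping (o.getD 0)).andThen
        fun x => match x with
          | (0, n) => leaderAlg tie T c n
          | (j + 1, n) => followerAlg T c n j := by
    funext m
    unfold metcElim initPhase
    simp only [Prog.bind_eq, Prog.andThen_assoc]
    rfl
  rw [hprog, progsAt_musicalChairs u (chairRounds K T) (fun _ => none) y (fun _ o =>
    (hopping (o.getD 0)).andThen
        fun x => match x with
          | (0, n) => leaderAlg tie T c n
          | (j + 1, n) => followerAlg T c n j)]
  rw [progsAt_hopping hk]
  simp only [Nat.add_sub_cancel]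
  change _ = rankedProgs tie T c n (r m)
  have hrm : (r m : ℕ) = rankOf k m := rfl
  generalize r m = i at hrm
  rw [← hrm]
  refine Fin.cases ?_ (fun i => ?_) i
  · rfl
  · rfl

end Init

/-! ### Independence -/

section Independence

variable {Ω : Type*} [MeasurableSpace Ω] {P : Measure Ω}

/-- If `X` has countably many values, and, for every value `i`, the event `B i` is independent of
`X = i` and has probability at most `c`, then `B X` has probability at most `c`. -/
theorem measure_mem_le_of_indep {ι : Type*} [Countable ι] (X : Ω → ι)
    (hX : ∀ i, MeasurableSet {ω | X ω = i}) (B : ι → Set Ω) (S : Set ι) (c : ENNReal)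
    (hi : ∀ i ∈ S, P ({ω | X ω = i} ∩ B i) = P {ω | X ω = i} * P (B i))
    (hc : ∀ i ∈ S, P (B i) ≤ c) : P {ω | X ω ∈ S ∧ ω ∈ B (X ω)} ≤ c * P {ω | X ω ∈ S} := by
  have h1 : {ω | X ω ∈ S ∧ ω ∈ B (X ω)} = ⋃ i ∈ S, {ω | X ω = i} ∩ B i := by
    ext ω
    simp
  have h2 : {ω | X ω ∈ S} = ⋃ i ∈ S, {ω | X ω = i} := by
    ext ω
    simp
  rw [h1, h2, measure_biUnion (Set.to_countable S) _ fun i _ => hX i]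
  · refine (measure_biUnion_le P (Set.to_countable S) _).trans ?_
    rw [← ENNReal.tsum_mul_left]
    refine ENNReal.tsum_le_tsum fun i => ?_
    rw [hi i i.2, mul_comm]
    exact mul_le_mul_left (hc i i.2) _
  · intro i _ j _ hij
    refine Set.disjoint_left.2 fun ω h h' => hij ?_
    exact (Set.mem_ofPred_eq.mp h).symm.trans h'

/-- On rectangles, `B` first splits off from `(A, C)` and then `A` from `C`; rectangles determine a
finite measure. To be applied with `A` the past qualities, `C` the future ones and `B` the private
randomness. -/
theorem IndepFun.prodMk_left_of_prodMk {α β γ : Type*} [MeasurableSpace α] [MeasurableSpace β]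
    [MeasurableSpace γ] [IsProbabilityMeasure P] {A : Ω → α} {B : Ω → β} {C : Ω → γ}
    (hA : Measurable A) (hB : Measurable B) (hAC : IndepFun A C P)
    (h : IndepFun (fun ω => (A ω, C ω)) B P) : IndepFun (fun ω => (A ω, B ω)) C P := by
  rw [indepFun_iff_measure_inter_preimage_eq_mul]
  intro S T hS hT
  have hAB : IndepFun A B P := h.comp measurable_fst measurable_id
  have hmeas : Measurable fun ω => (A ω, B ω) := hA.prodMk hB
  have key : (P.restrict (C ⁻¹' T)).map (fun ω => (A ω, B ω)) =
      P (C ⁻¹' T) • P.map fun ω => (A ω, B ω) := by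
    have : IsFiniteMeasure (P (C ⁻¹' T) • P.map fun ω => (A ω, B ω)) :=
      Measure.smul_finite _ (measure_ne_top _ _)
    refine Measure.ext_prod fun {s t} hs ht => ?_
    rw [Measure.map_apply hmeas (hs.prod ht), Measure.restrict_apply (hmeas (hs.prod ht)),
      Measure.smul_apply, Measure.map_apply hmeas (hs.prod ht), smul_eq_mul]
    have e1 : (fun ω => (A ω, B ω)) ⁻¹' s ×ˢ t = A ⁻¹' s ∩ B ⁻¹' t := rfl
    have e2 : A ⁻¹' s ∩ B ⁻¹' t ∩ C ⁻¹' T = (fun ω => (A ω, C ω)) ⁻¹' s ×ˢ T ∩ B ⁻¹' t := by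
      ext ω
      simp only [Set.mem_inter_iff, Set.mem_preimage, Set.mem_prod]
      tauto
    have e3 : (fun ω => (A ω, C ω)) ⁻¹' s ×ˢ T = A ⁻¹' s ∩ C ⁻¹' T := rfl
    rw [e1, e2, h.measure_inter_preimage_eq_mul _ _ (hs.prod hT) ht, e3,
      hAC.measure_inter_preimage_eq_mul _ _ hs hT, hAB.measure_inter_preimage_eq_mul _ _ hs ht]
    ring
  have := congrArg (fun ν => ν S) key
  simp only [Measure.smul_apply, smul_eq_mul] at this
  rw [Measure.map_apply hmeas hS, Measure.restrict_apply (hmeas hS), Measure.map_apply hmeas hS]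
    at this
  rw [this, mul_comm]

theorem iIndepFun.indepFun_tuples {ι κ₁ κ₂ β : Type*} [Fintype κ₁] [Fintype κ₂]
    [MeasurableSpace β] {f : ι → Ω → β} (h : iIndepFun f P) (hf : ∀ i, Measurable (f i))
    (g₁ : κ₁ → ι) (g₂ : κ₂ → ι) (hd : ∀ a b, g₁ a ≠ g₂ b) :
    IndepFun (fun ω a => f (g₁ a) ω) (fun ω b => f (g₂ b) ω) P := by
  classical
  have h1 := h.indepFun_finset (Finset.univ.image g₁) (Finset.univ.image g₂)
    (by
      rw [Finset.disjoint_left]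
      intro i hi hi'
      simp only [Finset.mem_image, Finset.mem_univ, true_and] at hi hi'
      obtain ⟨a, rfl⟩ := hi
      obtain ⟨b, hb⟩ := hi'
      exact hd a b hb.symm) hf
  let φ : (↥(Finset.univ.image g₁) → β) → κ₁ → β := fun x a =>
    x ⟨g₁ a, Finset.mem_image_of_mem g₁ (Finset.mem_univ a)⟩
  let ψ : (↥(Finset.univ.image g₂) → β) → κ₂ → β := fun x b =>
    x ⟨g₂ b, Finset.mem_image_of_mem g₂ (Finset.mem_univ b)⟩
  have hφ : Measurable φ := measurable_pi_iff.2 fun a => measurable_pi_apply _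
  have hψ : Measurable ψ := measurable_pi_iff.2 fun b => measurable_pi_apply _
  exact h1.comp hφ hψ

end Independence

/-! ### The probability that the initialization fails -/

section InitProb

variable {Ω : Type*} [MeasurableSpace Ω] {P : Measure Ω} [IsProbabilityMeasure P] {M K : ℕ}
  {μ : Fin M → Fin K → ℝ} {Y : Fin M → Fin K → ℕ → Ω → ℝ} {U : Fin M → ℕ → Ω → Fin K}

theorem IsBandit.measure_U_mem (h : IsBandit P μ Y U) (m : Fin M) (i : ℕ) (s : Finset (Fin K)) :
    P.real {ω | U m i ω ∈ s} = s.card / K := by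
  have : {ω | U m i ω ∈ s} = ⋃ k ∈ s, {ω | U m i ω = k} := by
    ext ω
    simp
  rw [this, measureReal_biUnion_finset]
  · simp only [h.uniform_U m i, Finset.sum_const, nsmul_eq_mul]
    ring
  · intro k _ k' _ hkk'
    refine Set.disjoint_left.2 fun ω hω hω' => hkk' ?_
    exact (Set.mem_ofPred_eq.mp hω).symm.trans hω'
  · exact fun k _ => h.measurable_U m i (measurableSet_singleton k)

/-- The probability that a player without a seat does not find one in the next round. -/
theorem IsBandit.measure_collided_le (h : IsBandit P μ Y U) (hMK : M ≤ K) (n : ℕ)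
    (o : Fin M → Option (Fin K)) (m : Fin M) (hm : o m = none) :
    P {ω | collided (fun m' => (o m').getD (U m' n ω)) m = true} ≤
      ENNReal.ofReal (1 - 1 / K) := by
  classical
  have hM : 0 < M := m.pos
  set X : Ω → ({m' : Fin M // m' ≠ m} → Fin K) := fun ω m' => U m' n ω with hX
  have hXm : Measurable X := measurable_pi_iff.2 fun m' => h.measurable_U _ _
  set img : ({m' : Fin M // m' ≠ m} → Fin K) → Finset (Fin K) := fun x =>
    Finset.univ.image fun m' : {m' : Fin M // m' ≠ m} => (o m').getD (x m') with himg
  have hind : IndepFun X (U m n) P := by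
    have h1 := iIndepFun.indepFun_tuples h.indep_U (fun q => h.measurable_U q.1 q.2)
      (fun m' : {m' : Fin M // m' ≠ m} => ((m' : Fin M), n)) (fun _ : Unit => (m, n))
      (fun a _ hab => a.2 (congrArg Prod.fst hab))
    exact h1.comp (φ := id) (ψ := fun f : Unit → Fin K => f ()) measurable_id (by fun_prop)
  have := measure_mem_le_of_indep (P := P) X (fun x => hXm (measurableSet_singleton x))
    (fun x => {ω | U m n ω ∈ img x}) Set.univ (ENNReal.ofReal (1 - 1 / K))
    (fun x _ => hind.measure_inter_preimage_eq_mul {x} (img x) (measurableSet_singleton x)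
      (Finset.measurableSet _)) ?_
  · refine (measure_mono fun ω hω => ?_).trans (this.trans ?_)
    · obtain ⟨m', hm', h'⟩ := collided_eq_true_iff.1 hω
      refine ⟨Set.mem_univ _, ?_⟩
      simp only [himg, Set.mem_ofPred_eq, Finset.mem_image, Finset.mem_univ, true_and]
      refine ⟨⟨m', hm'⟩, ?_⟩
      simpa [hm] using h'
    · simp
  · intro x _
    rw [← ENNReal.ofReal_toReal (measure_ne_top P _)]
    refine ENNReal.ofReal_le_ofReal ?_
    change P.real {ω | U m n ω ∈ img x} ≤ _
    rw [h.measure_U_mem]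
    have hK : (0 : ℝ) < K := by exact_mod_cast hM.trans_le hMK
    -- For given arms of the others, at most `M - 1 ≤ K - 1` of the `K` arms lead to a collision.
    have h1 : (img x).card ≤ M - 1 := by
      refine Finset.card_image_le.trans ?_
      simp [Fintype.card_subtype_compl]
    have h2 : ((img x).card : ℝ) + 1 ≤ K := by
      have : (img x).card + 1 ≤ K := by omega
      exact_mod_cast this
    rw [div_le_iff₀ hK, sub_mul, one_div, inv_mul_cancel₀ hK.ne']
    linarith

/-- Induction on the number of rounds, conditioning on the arms `X` of the first round. What follows
depends on them only through the new seats and otherwise on `W`, the arms with smaller indices,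
which are independent of `X`. -/
theorem IsBandit.measure_finalSeats_le (h : IsBandit P μ Y U) (hMK : M ≤ K) (n : ℕ)
    (o : Fin M → Option (Fin K)) (m : Fin M) :
    P {ω | finalSeats (fun m i => U m i ω) n o m = none} ≤ ENNReal.ofReal (1 - 1 / K) ^ n := by
  classical
  induction n generalizing o with
  | zero =>
    rw [pow_zero]
    exact prob_le_one
  | succ n ih =>
    cases hm : o m with
    | some k =>
      have : {ω | finalSeats (fun m i => U m i ω) (n + 1) o m = none} = ∅ := by
        ext ω
        simp [finalSeats_eq_some _ (n + 1) hm]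
      simp [this]
    | none =>
      set X : Ω → (Fin M → Fin K) := fun ω m => U m n ω with hX
      have hXm : Measurable X := measurable_pi_iff.2 fun m' => h.measurable_U _ _
      set W : Ω → (Fin M × Fin n → Fin K) := fun ω q => U q.1 q.2 ω with hW
      have hind : IndepFun X W P :=
        iIndepFun.indepFun_tuples h.indep_U (fun q => h.measurable_U q.1 q.2)
          (fun m' : Fin M => (m', n)) (fun q : Fin M × Fin n => (q.1, (q.2 : ℕ)))
          (fun a b hab => b.2.isLt.ne (congrArg Prod.snd hab).symm)
      have hev : ∀ v : Fin M → Fin K, ∃ s : Set (Fin M × Fin n → Fin K),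
          {ω | finalSeats (fun m i => U m i ω) n (nextSeats v o) m = none} = W ⁻¹' s := by
        intro v
        refine ⟨{f | finalSeats (fun m i => if hi : i < n then f (m, ⟨i, hi⟩) else v m) n
          (nextSeats v o) m = none}, ?_⟩
        ext ω
        simp only [Set.mem_ofPred_eq, Set.mem_preimage, hW]
        rw [finalSeats_congr]
        intro i hi m
        simp [hi]
      have := measure_mem_le_of_indep (P := P) X (fun x => hXm (measurableSet_singleton x))
        (fun v => {ω | finalSeats (fun m i => U m i ω) n (nextSeats v o) m = none})
        {v | nextSeats v o m = none} (ENNReal.ofReal (1 - 1 / K) ^ n) ?_ fun v _ => ih _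
      · refine (measure_mono fun ω hω => ?_).trans (this.trans ?_)
        · refine ⟨?_, hω⟩
          by_contra hne
          obtain ⟨k, hk⟩ := Option.ne_none_iff_exists'.1 hne
          have hω' : finalSeats (fun m i => U m i ω) n (nextSeats (X ω) o) m = none := hω
          rw [finalSeats_eq_some _ n hk] at hω'
          simp at hω'
        · rw [pow_succ]
          refine mul_le_mul_right ((measure_mono fun ω hω => ?_).trans
            (h.measure_collided_le hMK n o m hm)) _
          simp only [Set.mem_ofPred_eq, nextSeats, hm, hX] at hω ⊢
          by_contra hc
          simp [hc] at hω
      · intro v _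
        obtain ⟨s, hs⟩ := hev v
        rw [hs]
        exact hind.measure_inter_preimage_eq_mul {v} s (measurableSet_singleton v)
          (Set.to_countable s).measurableSet

/-- With high probability, all players find an arm in the musical chairs. -/
theorem IsBandit.measureReal_not_allSeated_le (h : IsBandit P μ Y U) (hMK : M ≤ K) {T : ℕ}
    (hT : 0 < T) : P.real {ω | ¬ AllSeated T fun m i => U m i ω} ≤ M / ((K : ℝ) ^ 2 * T) := by
  rcases Nat.eq_zero_or_pos K with hK | hK
  · subst hK
    obtain rfl : M = 0 := by omega
    have : {ω | ¬ AllSeated T fun m i => U m i ω} = ∅ := by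
      ext ω
      simp [AllSeated]
    simp [this]
  have hK' : (0 : ℝ) < K := by exact_mod_cast hK
  have hT' : (0 : ℝ) < T := by exact_mod_cast hT
  have h1 : {ω | ¬ AllSeated T fun m i => U m i ω} = ⋃ m ∈ (Finset.univ : Finset (Fin M)),
      {ω | finalSeats (fun m i => U m i ω) (chairRounds K T) (fun _ => none) m = none} := by
    ext ω
    simp [AllSeated]
  rw [h1]
  refine (measureReal_biUnion_finset_le _ _).trans ?_
  have hle : (1 : ℝ) / K ≤ 1 := by
    rw [div_le_one hK']
    exact_mod_cast hK
  have h2 : ∀ m ∈ (Finset.univ : Finset (Fin M)),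
      P.real {ω | finalSeats (fun m i => U m i ω) (chairRounds K T) (fun _ => none) m = none} ≤
        1 / ((K : ℝ) ^ 2 * T) := by
    intro m _
    have h3 := h.measure_finalSeats_le hMK (chairRounds K T) (fun _ => none) m
    have h4 : P.real {ω | finalSeats (fun m i => U m i ω) (chairRounds K T) (fun _ => none) m =
        none} ≤ (1 - 1 / (K : ℝ)) ^ chairRounds K T := by
      rw [← ENNReal.ofReal_pow (by linarith)] at h3
      exact ENNReal.toReal_le_of_le_ofReal (pow_nonneg (by linarith) _) h3
    refine h4.trans ?_
    -- With the failure probability `1 / (K T)` passed to the initialization, the number of rounds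
    -- is at least K ln(K²T), and (1 - 1/K)^(K x) ≤ e^(-x).
    calc (1 - 1 / (K : ℝ)) ^ chairRounds K T ≤ Real.exp (-(1 / K)) ^ chairRounds K T :=
          pow_le_pow_left₀ (by linarith) (Real.one_sub_le_exp_neg _) _
      _ = Real.exp (-(chairRounds K T / K)) := by
          rw [← Real.exp_nat_mul]
          congr 1
          ring
      _ ≤ Real.exp (-Real.log ((K : ℝ) ^ 2 * T)) := by
          refine Real.exp_le_exp.2 (neg_le_neg ?_)
          rw [le_div_iff₀ hK', mul_comm]
          have e : (K : ℝ) / (1 / (K * T)) = K ^ 2 * T := by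
            field_simp
          have := Nat.le_ceil ((K : ℝ) * Real.log (K / (1 / ((K : ℝ) * T))))
          rw [e] at this
          unfold chairRounds
          rw [e]
          exact this
      _ = 1 / ((K : ℝ) ^ 2 * T) := by
          rw [Real.exp_neg, Real.exp_log (by positivity), one_div]
  refine (Finset.sum_le_sum h2).trans ?_
  simp only [Finset.sum_const, Finset.card_univ, Fintype.card_fin, nsmul_eq_mul]
  rw [mul_one_div]

end InitProb

/-! ### Lists of blocks and binary digits -/

section Blocks

variable {α β : Type}

theorem block_flatMap {len : ℕ} (l : List β) (f : β → List α) (hf : ∀ x ∈ l, (f x).length = len)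
    (i : ℕ) (hi : i < l.length) : block len (l.flatMap f) i = f l[i] := by
  induction l generalizing i with
  | nil => simp at hi
  | cons x l ih =>
    have hx := hf x (by simp)
    cases i with
    | zero => simp [block, ← hx]
    | succ i =>
      have := ih (fun x hx => hf x (by simp [hx])) i (by simpa using hi)
      rw [List.getElem_cons_succ, ← this]
      unfold block
      rw [List.flatMap_cons, add_mul, one_mul, add_comm, ← List.drop_drop,
        List.drop_left' hx]

theorem length_flatMap_const {len : ℕ} (l : List β) (f : β → List α)
    (hf : ∀ x ∈ l, (f x).length = len) : (l.flatMap f).length = l.length * len := by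
  induction l with
  | nil => simp
  | cons x l ih =>
    rw [List.flatMap_cons, List.length_append, hf x (by simp),
      ih fun x hx => hf x (by simp [hx]), List.length_cons]
    ring

theorem length_block {len n : ℕ} {l : List α} (hl : l.length = n * len) {i : ℕ} (hi : i < n) :
    (block len l i).length = len := by
  unfold block
  rw [List.length_take, List.length_drop, hl, min_eq_left]
  have : (i + 1) * len ≤ n * len := Nat.mul_le_mul_right _ hi
  rw [add_mul] at this
  omega

theorem getD_block {len : ℕ} {l : List α} {i r : ℕ} (hr : r < len) (d : α) :
    (block len l i).getD r d = l.getD (i * len + r) d := by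
  unfold block
  simp only [List.getD_eq_getElem?_getD, List.getElem?_take, hr, if_true, List.getElem?_drop]

theorem block_ext {len n : ℕ} {l l' : List α} {i : ℕ} (hl : l.length = n * len) (hi : i < n)
    (hl' : l'.length = len) (d : α) (h : ∀ r < len, l.getD (i * len + r) d = l'.getD r d) :
    block len l i = l' := by
  have hb := length_block hl hi
  rw [list_eq_map_getD (block len l i) d, list_eq_map_getD l' d, hb, hl']
  refine List.map_congr_left fun r hr => ?_
  rw [List.mem_range] at hr
  rw [getD_block hr, h r hr]

theorem toBits_succ (b n : ℕ) : toBits (b + 1) n = n.testBit 0 :: toBits b (n / 2) := by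
  unfold toBits
  rw [List.range_succ_eq_map, List.map_cons, List.map_map]
  congr 1
  refine List.map_congr_left fun i _ => ?_
  simp [Nat.testBit_succ]

theorem length_toBits (b n : ℕ) : (toBits b n).length = b := by simp [toBits]

theorem ofBits_toBits {b n : ℕ} (h : n < 2 ^ b) : ofBits (toBits b n) = n := by
  induction b generalizing n with
  | zero =>
    obtain rfl : n = 0 := by simpa using h
    rfl
  | succ b ih =>
    rw [toBits_succ, ofBits, ih (by rw [pow_succ] at h; omega), Nat.testBit_zero]
    rcases Nat.mod_two_eq_zero_or_one n with h2 | h2 <;> simp [h2] <;> omega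

theorem length_sendArms {K : ℕ} (own target : Fin K) (bits : List Bool) :
    (sendArms own target bits).length = bits.length := by simp [sendArms]

theorem getD_sendArms {K : ℕ} (own target d : Fin K) {bits : List Bool} {r : ℕ}
    (hr : r < bits.length) :
    (sendArms own target bits).getD r d = if bits.getD r false then target else own := by
  simp [sendArms, hr]

end Blocks

/-! ### Communication phases -/

section Communication

variable {n K : ℕ} [NeZero K] {μ : Fin (n + 1) → Fin K → ℝ} {κ : Fin (n + 1) → Fin K}

theorem exists_block_index {b t : ℕ} (ht : t < n * b) :
    ∃ i : Fin n, ∃ r < b, t = i * b + r := by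
  have hb : 0 < b := Nat.pos_of_ne_zero fun h => by simp [h] at ht
  refine ⟨⟨t / b, (Nat.div_lt_iff_lt_mul hb).2 ht⟩, t % b, Nat.mod_lt _ hb, ?_⟩
  exact (Nat.div_add_mod' t b).symm

/-- The leader sends bits to all followers in turn. -/
theorem run_leaderSends (hμ0 : ∀ m k, 0 ≤ μ m k) (hμ1 : ∀ m k, μ m k ≤ 1)
    (hκ : Function.Injective κ) {b : ℕ} {B : Fin n → List Bool} (hB : ∀ i, (B i).length = b)
    {prog : Fin (n + 1) → Prog K (Fin K)} {F₀ : Prog K (Fin K)}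
    {F : Fin n → List Bool → Prog K (Fin K)} (y : Fin (n + 1) → Fin K → ℕ → ℝ)
    (h0 : prog 0 = (Prog.pullList ((List.finRange n).flatMap fun i =>
      sendArms (κ 0) (κ i.succ) (B i))).andThen fun _ => F₀)
    (hF : ∀ j : Fin n, prog j.succ = (Prog.pullList (List.replicate (n * b) (κ j.succ))).andThen
      fun o => F j (o.map Prod.snd)) :
    ∃ bits : Fin n → List Bool, (∀ j : Fin n, block b (bits j) j = B j) ∧
      progsAt prog y (n * b) = Fin.cases F₀ (fun j => F j (bits j)) ∧
      ∀ t < n * b, loss μ (armsAt prog y t) ≤ 2 + gap μ κ := by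
  set l : Fin (n + 1) → List (Fin K) := Fin.cases
    ((List.finRange n).flatMap fun i => sendArms (κ 0) (κ i.succ) (B i))
    (fun j => List.replicate (n * b) (κ j.succ)) with hl
  have hprog : prog = fun m => (Prog.pullList (l m)).andThen
      ((Fin.cases (fun _ => F₀) (fun j o => F j (o.map Prod.snd)) :
        Fin (n + 1) → List (ℝ × Bool) → Prog K (Fin K)) m) := by
    funext m
    refine Fin.cases ?_ (fun j => ?_) m
    · rw [h0]
      rfl
    · rw [hF]
      rfl
  have hlen : ∀ m, (l m).length = n * b := by
    intro m
    refine Fin.cases ?_ (fun j => ?_) m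
    · simp only [hl, Fin.cases_zero]
      rw [length_flatMap_const (len := b) _ _ fun i _ => by rw [length_sendArms, hB]]
      simp
    · simp [hl]
  have harm0 : ∀ (i : Fin n) (r : ℕ), r < b → armsOfLists l (i * b + r) 0 =
      if (B i).getD r false then κ i.succ else κ 0 := by
    intro i r hr
    have h1 := block_flatMap (len := b) (List.finRange n)
      (fun i => sendArms (κ 0) (κ i.succ) (B i))
      (fun i _ => by rw [length_sendArms, hB]) i (by simp)
    have h2 := getD_block (l := (List.finRange n).flatMap
      fun i => sendArms (κ 0) (κ i.succ) (B i)) (i := i) hr 0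
    rw [h1, getD_sendArms _ _ _ (by rw [hB]; exact hr)] at h2
    simpa [armsOfLists, hl] using h2.symm
  have harmS : ∀ (j : Fin n) (t : ℕ), t < n * b → armsOfLists l t j.succ = κ j.succ := by
    intro j t ht
    simp [armsOfLists, hl, ht]
  obtain ⟨hrun1, hrun2⟩ := run_lists hlen y
    ((Fin.cases (fun _ => F₀) (fun j o => F j (o.map Prod.snd)) :
        Fin (n + 1) → List (ℝ × Bool) → Prog K (Fin K)))
  rw [← hprog] at hrun1 hrun2
  refine ⟨fun j => (observations (armsOfLists l) y (n * b) j.succ).map Prod.snd, ?_, ?_, ?_⟩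
  · intro j
    refine block_ext (n := n) (by simp [length_observations]) j.isLt (hB j) false fun r hr => ?_
    have ht : j * b + r < n * b := by
      have : (j + 1) * b ≤ n * b := Nat.mul_le_mul_right _ j.isLt
      rw [add_mul] at this
      omega
    beta_reduce
    rw [observations_snd]
    simp only [List.getD_eq_getElem?_getD, List.getElem?_map, List.getElem?_range ht,
      Option.map_some, Option.getD_some]
    -- Only the leader ever leaves her arm, so within her own block a follower collides exactly when
    -- the bit sent is 1.
    rw [Bool.eq_iff_iff, collided_eq_true_iff]
    have h0 := harm0 j r hr
    rw [List.getD_eq_getElem?_getD] at h0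
    rw [harmS j _ ht]
    constructor
    · rintro ⟨m', hm', h⟩
      revert hm' h
      refine Fin.cases ?_ (fun j' => ?_) m'
      · intro _ h
        rw [h0] at h
        by_contra hb
        rw [if_neg hb] at h
        exact absurd (hκ h) (Fin.succ_ne_zero j).symm
      · intro hne h
        rw [harmS j' _ ht] at h
        exact absurd (hκ h) hne
    · intro hb
      refine ⟨0, (Fin.succ_ne_zero j).symm, ?_⟩
      rw [h0, if_pos hb]
  · rw [hrun2]
    funext m
    refine Fin.cases ?_ (fun j => ?_) m <;> rfl
  · intro t ht
    rw [hrun1 t ht]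
    obtain ⟨i, r, hr, rfl⟩ := exists_block_index ht
    have h0 := harm0 i r hr
    have hS : ∀ m, m ≠ 0 → armsOfLists l (i * b + r) m = κ m := by
      intro m hm
      obtain ⟨j, rfl⟩ := Fin.exists_succ_eq.2 hm
      exact harmS j _ ht
    split_ifs at h0
    · exact loss_update_le hμ1 hμ0 hκ hS h0
    · exact loss_update_le hμ1 hμ0 hκ hS h0

/-- The followers send bits to the leader in turn. -/
theorem run_followersSend (hμ0 : ∀ m k, 0 ≤ μ m k) (hμ1 : ∀ m k, μ m k ≤ 1)
    (hκ : Function.Injective κ) {b : ℕ} {B : Fin n → List Bool} (hB : ∀ i, (B i).length = b)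
    {prog : Fin (n + 1) → Prog K (Fin K)} {F₀ : List Bool → Prog K (Fin K)}
    {F : Fin n → Prog K (Fin K)} (y : Fin (n + 1) → Fin K → ℕ → ℝ)
    (h0 : prog 0 = (Prog.pullList (List.replicate (n * b) (κ 0))).andThen
      fun o => F₀ (o.map Prod.snd))
    (hF : ∀ j : Fin n, prog j.succ = (Prog.pullList ((List.range n).flatMap fun i =>
      if i = (j : ℕ) then sendArms (κ j.succ) (κ 0) (B j) else List.replicate b (κ j.succ))).andThen
        fun _ => F j) :
    ∃ bits : List Bool, (∀ j : Fin n, block b bits j = B j) ∧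
      progsAt prog y (n * b) = Fin.cases (F₀ bits) F ∧
      ∀ t < n * b, loss μ (armsAt prog y t) ≤ 2 + gap μ κ := by
  set f : Fin n → ℕ → List (Fin K) := fun j i =>
    if i = (j : ℕ) then sendArms (κ j.succ) (κ 0) (B j) else List.replicate b (κ j.succ) with hf
  have hfl : ∀ j i, (f j i).length = b := by
    intro j i
    simp only [hf]
    split_ifs
    · rw [length_sendArms, hB]
    · simp
  set l : Fin (n + 1) → List (Fin K) := Fin.cases (List.replicate (n * b) (κ 0))
    (fun j => (List.range n).flatMap (f j)) with hl
  have hprog : prog = fun m => (Prog.pullList (l m)).andThen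
      ((Fin.cases (fun o => F₀ (o.map Prod.snd)) (fun j _ => F j) :
        Fin (n + 1) → List (ℝ × Bool) → Prog K (Fin K)) m) := by
    funext m
    refine Fin.cases ?_ (fun j => ?_) m
    · rw [h0]
      rfl
    · rw [hF]
      rfl
  have hlen : ∀ m, (l m).length = n * b := by
    intro m
    refine Fin.cases ?_ (fun j => ?_) m
    · simp [hl]
    · simp only [hl, Fin.cases_succ]
      rw [length_flatMap_const (len := b) _ _ fun i _ => hfl j i]
      simp
  have harm0 : ∀ t, t < n * b → armsOfLists l t 0 = κ 0 := by
    intro t ht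
    simp [armsOfLists, hl, ht]
  have harmS : ∀ (j i : Fin n) (r : ℕ), r < b → armsOfLists l (i * b + r) j.succ =
      if i = j ∧ (B j).getD r false then κ 0 else κ j.succ := by
    intro j i r hr
    have h1 := block_flatMap (len := b) (List.range n) (f j) (fun i _ => hfl j i) i (by simp)
    have h2 := getD_block (l := (List.range n).flatMap (f j)) (i := i) hr 0
    rw [h1, List.getElem_range] at h2
    have h3 : armsOfLists l (i * b + r) j.succ = (f j i).getD r 0 := h2.symm
    rw [h3]
    simp only [hf]
    by_cases hij : i = j
    · rw [if_pos (by rw [hij]), getD_sendArms _ _ _ (by rw [hB]; exact hr)]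
      simp [hij]
    · rw [if_neg (fun h => hij (Fin.ext h)), if_neg (fun h => hij h.1)]
      simp [hr]
  obtain ⟨hrun1, hrun2⟩ := run_lists hlen y
    ((Fin.cases (fun o => F₀ (o.map Prod.snd)) (fun j _ => F j) :
        Fin (n + 1) → List (ℝ × Bool) → Prog K (Fin K)))
  rw [← hprog] at hrun1 hrun2
  refine ⟨(observations (armsOfLists l) y (n * b) 0).map Prod.snd, ?_, ?_, ?_⟩
  · intro j
    refine block_ext (n := n) (by simp [length_observations]) j.isLt (hB j) false fun r hr => ?_
    have ht : j * b + r < n * b := by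
      have : (j + 1) * b ≤ n * b := Nat.mul_le_mul_right _ j.isLt
      rw [add_mul] at this
      omega
    rw [observations_snd]
    simp only [List.getD_eq_getElem?_getD, List.getElem?_map, List.getElem?_range ht,
      Option.map_some, Option.getD_some]
    rw [Bool.eq_iff_iff, collided_eq_true_iff]
    rw [harm0 _ ht]
    constructor
    · rintro ⟨m', hm', h⟩
      obtain ⟨j', rfl⟩ := Fin.exists_succ_eq.2 hm'
      rw [harmS j' j r hr] at h
      by_contra hb
      rw [if_neg (by rintro ⟨rfl, h'⟩; exact hb (by rwa [List.getD_eq_getElem?_getD] at h'))] at h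
      exact absurd (hκ h) (Fin.succ_ne_zero j')
    · intro hb
      refine ⟨j.succ, Fin.succ_ne_zero j, ?_⟩
      rw [harmS j j r hr, if_pos ⟨rfl, by rwa [List.getD_eq_getElem?_getD]⟩]
  · rw [hrun2]
    funext m
    refine Fin.cases ?_ (fun j => ?_) m <;> rfl
  · intro t ht
    rw [hrun1 t ht]
    obtain ⟨i, r, hr, rfl⟩ := exists_block_index ht
    have hS : ∀ m, m ≠ i.succ → armsOfLists l (i * b + r) m = κ m := by
      intro m hm
      rcases Fin.eq_zero_or_eq_succ m with rfl | ⟨j, rfl⟩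
      · exact harm0 _ ht
      · rw [harmS j i r hr, if_neg]
        rintro ⟨rfl, -⟩
        exact hm rfl
    have h0 := harmS i i r hr
    split_ifs at h0
    · exact loss_update_le hμ1 hμ0 hκ hS h0
    · exact loss_update_le hμ1 hμ0 hκ hS h0

end Communication

/-! ### One epoch -/

section Explore

variable {n K : ℕ}

/-- In the leader's program the list of arms is coerced to a list of numbers through the list monad;
this removes the coercion. -/
theorem flatMap_bind_pure_val {α : Type} (l : List (Fin K)) (f : ℕ → List α) :
    List.flatMap f (do let a ← l; pure (a : ℕ)) = l.flatMap fun k : Fin K => f k := by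
  induction l with
  | nil => rfl
  | cons k l ih =>
    rw [List.flatMap_cons, ← ih]
    rfl

theorem length_exploreArms (c p : ℕ) (l : List (Fin K)) :
    (exploreArms c p l).length = l.length * 2 ^ p ^ c :=
  length_flatMap_const _ _ fun _ _ => by simp

theorem exploreArms_map (c p : ℕ) (C : List (Fin (n + 1) → Fin K)) (m : Fin (n + 1)) :
    exploreArms c p (C.map fun π => π m) =
      (C.flatMap fun π => List.replicate (2 ^ p ^ c) π).map fun π => π m := by
  unfold exploreArms
  rw [List.flatMap_map, List.map_flatMap]
  simp

theorem totalLoss_done_le {μ : Fin (n + 1) → Fin K → ℝ} {π : Fin (n + 1) → Fin K}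
    (hπ : Function.Injective π) (h : gap μ π = 0) (y : Fin (n + 1) → Fin K → ℕ → ℝ) (R : ℕ) :
    totalLoss μ (fun m => Prog.done (π m)) y R ≤ 0 := by
  have h1 : ∀ t, progsAt (fun m => (Prog.done (π m) : Prog K (Fin K))) y t =
      fun m => Prog.done (π m) := by
    intro t
    induction t with
    | zero => rfl
    | succ t ih =>
      funext m
      simp only [progsAt, ih]
      rfl
  unfold totalLoss
  refine (Finset.sum_eq_zero fun t _ => ?_).le
  have h2 : armsAt (fun m => (Prog.done (π m) : Prog K (Fin K))) y t = π := by
    funext m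
    unfold armsAt
    rw [h1]
    rfl
  rw [h2, loss_of_injective μ hπ, h]

end Explore

/-! ### The course of an epoch: announcement, exploration, report -/

section Epoch

variable {n K : ℕ} [NeZero K]

/-- The number of rounds in which the leader sends her decisions, for `size` candidates. -/
def commRounds (n K size : ℕ) : ℕ :=
  n * sizeBits (n + 1) K + n * ((size + 2) * armBits K)

/-- The observations of player `m` in the exploration phase which starts in round `s`. -/
noncomputable def exploreObs (c p : ℕ) (C : List (Fin (n + 1) → Fin K))
    (y : Fin (n + 1) → Fin K → ℕ → ℝ) (s : ℕ) (m : Fin (n + 1)) : List (ℝ × Bool) :=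
  (List.range (C.length * 2 ^ p ^ c)).map fun t =>
    (y m ((exploreArms c p (C.map fun π => π m)).getD t 0) (s + t), false)

/-- The empirical means of the exploration phase of epoch `p` which starts in round `s`. -/
noncomputable def rawEstimate (c p : ℕ) (C : List (Fin (n + 1) → Fin K))
    (y : Fin (n + 1) → Fin K → ℕ → ℝ) (s : ℕ) (m : Fin (n + 1)) (k : Fin K) : ℝ :=
  empiricalMean (exploreArms c p (C.map fun π => π m)) (exploreObs c p C y s m) k

/-- The weights which the leader computes at the end of epoch `p`. -/
noncomputable def newWeights (c p : ℕ) (C : List (Fin (n + 1) → Fin K))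
    (y : Fin (n + 1) → Fin K → ℕ → ℝ) (s : ℕ) : Fin (n + 1) → Fin K → ℝ :=
  Fin.cons (rawEstimate c p C y s 0) fun i k =>
    (truncBits (meanBits c p) (rawEstimate c p C y s i.succ k) : ℝ) / 2 ^ meanBits c p

/-- The programs of all players at the beginning of epoch `p`. -/
noncomputable def loopProgs (tie : TieBreak K) (T c fuel p : ℕ) (E : List (Fin (n + 1) × Fin K))
    (w : Fin (n + 1) → Fin K → ℝ) (κ : Fin (n + 1) → Fin K) : Fin (n + 1) → Prog K (Fin K) :=
  Fin.cases (leaderLoop tie T c n fuel p E w κ)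
    fun j => followerLoop c n j fuel p (κ 0) (κ j.succ)

theorem sum_range_gap (μ : Fin (n + 1) → Fin K → ℝ) (N : ℕ) (C : List (Fin (n + 1) → Fin K)) :
    ∑ t ∈ Finset.range (C.length * N),
      gap μ ((C.flatMap fun π => List.replicate N π).getD t fun _ => 0) =
        N * (C.map (gap μ)).sum := by
  have h1 : (C.flatMap fun π => List.replicate N π).length = C.length * N :=
    length_flatMap_const _ _ fun _ _ => by simp
  have h2 : ((C.flatMap fun π => List.replicate N π).map (gap μ)).sum =
      N * (C.map (gap μ)).sum := by
    clear h1
    induction C with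
    | nil => simp
    | cons π C ih =>
      simp only [List.flatMap_cons, List.map_append, List.sum_append, ih, List.map_cons,
        List.sum_cons, List.map_replicate, List.sum_replicate, nsmul_eq_mul]
      ring
  rw [← h2]
  conv_rhs => rw [list_eq_map_getD (C.flatMap fun π => List.replicate N π) fun _ => 0]
  rw [h1, List.map_map, Finset.sum_range, ← List.sum_ofFn]
  congr 1
  apply List.ext_getElem
  · simp
  · intro i hi _
    have hi' : i < (C.flatMap fun π => List.replicate N π).length := by simpa [h1] using hi
    simp [List.getElem?_eq_getElem hi']

/-- The players work in step through the same list `L` of repeated candidates. Every round is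
therefore a matching: there are no collisions, the rewards are the qualities themselves, and the
loss is the gap. -/
theorem run_explore {μ : Fin (n + 1) → Fin K → ℝ} {c p : ℕ} {C : List (Fin (n + 1) → Fin K)}
    (hC : ∀ π ∈ C, Function.Injective π) (y : Fin (n + 1) → Fin K → ℕ → ℝ) (s : ℕ)
    {prog : Fin (n + 1) → Prog K (Fin K)} {F : Fin (n + 1) → List (ℝ × Bool) → Prog K (Fin K)}
    (hprog : ∀ m, prog m = (Prog.pullList (exploreArms c p (C.map fun π => π m))).andThen (F m)) :
    progsAt prog (shift s y) (C.length * 2 ^ p ^ c) = (fun m => F m (exploreObs c p C y s m)) ∧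
    (∀ t < C.length * 2 ^ p ^ c, loss μ (armsAt prog (shift s y) t) ≤
      gap μ ((C.flatMap fun π => List.replicate (2 ^ p ^ c) π).getD t fun _ => 0)) ∧
    (∀ t < C.length * 2 ^ p ^ c, 0 ≤
      gap μ ((C.flatMap fun π => List.replicate (2 ^ p ^ c) π).getD t fun _ => 0)) := by
  set L := C.flatMap fun π => List.replicate (2 ^ p ^ c) π with hL
  have hLlen : L.length = C.length * 2 ^ p ^ c :=
    length_flatMap_const _ _ fun _ _ => by simp
  have hinj : ∀ t < C.length * 2 ^ p ^ c, Function.Injective (L.getD t fun _ => 0) := by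
    intro t ht
    rw [← hLlen] at ht
    rw [List.getD_eq_getElem _ _ ht]
    obtain ⟨π, hπ, h⟩ := List.mem_flatMap.1 (List.getElem_mem ht)
    rw [List.eq_of_mem_replicate h]
    exact hC π hπ
  have hp : prog = fun m => (Prog.pullList (exploreArms c p (C.map fun π => π m))).andThen (F m) :=
    funext hprog
  obtain ⟨h1, h2⟩ := run_lists (l := fun m => exploreArms c p (C.map fun π => π m))
    (len := C.length * 2 ^ p ^ c) (fun m => by rw [length_exploreArms, List.length_map])
    (shift s y) F
  rw [← hp] at h1 h2
  have harm : ∀ t < C.length * 2 ^ p ^ c,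
      armsOfLists (fun m => exploreArms c p (C.map fun π => π m)) t = L.getD t fun _ => 0 := by
    intro t ht
    funext m
    unfold armsOfLists
    beta_reduce
    rw [exploreArms_map, ← hL]
    simp only [List.getD_eq_getElem?_getD, List.getElem?_map]
    rw [← hLlen] at ht
    simp [ht]
  refine ⟨?_, ?_, ?_⟩
  · rw [h2]
    funext m
    congr 1
    unfold observations exploreObs
    refine List.map_congr_left fun t ht => ?_
    rw [List.mem_range] at ht
    have hc : collided (armsOfLists (fun m => exploreArms c p (C.map fun π => π m)) t) m =
        false := collided_eq_false_of_injective (by rw [harm t ht]; exact hinj t ht) m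
    unfold reward
    rw [hc]
    rfl
  · intro t ht
    rw [h1 t ht, harm t ht, loss_of_injective μ (hinj t ht)]
  · intro t ht
    exact gap_nonneg μ (hinj t ht)

theorem le_two_pow_armBits (K : ℕ) : K ≤ 2 ^ armBits K := Nat.le_pow_clog (by norm_num) K

theorem truncBits_lt (b : ℕ) (x : ℝ) : truncBits b x < 2 ^ b := by
  unfold truncBits
  have := Nat.two_pow_pos b
  omega

/-- Two transmissions by the leader. The first tells every follower the number of candidates, hence
the length of the second, which keeps all players in step. Afterwards each player knows her own arms
in the matchings of `C`: a single candidate is played for ever, and otherwise the exploration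
begins. -/
theorem run_announcement {μ : Fin (n + 1) → Fin K → ℝ} (hμ0 : ∀ m k, 0 ≤ μ m k)
    (hμ1 : ∀ m k, μ m k ≤ 1) (tie : TieBreak K) (T c fuel p : ℕ)
    (E : List (Fin (n + 1) × Fin K)) (w : Fin (n + 1) → Fin K → ℝ)
    {κ : Fin (n + 1) → Fin K} (hκ : Function.Injective κ) (y : Fin (n + 1) → Fin K → ℕ → ℝ)
    {C : List (Fin (n + 1) → Fin K)} {π₁ : Fin (n + 1) → Fin K} {E' : List (Fin (n + 1) × Fin K)}
    (hd : decision tie T c p E w = (E', C, π₁)) (hClen : C.length ≤ (n + 1) * K) :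
    ∃ prog : Fin (n + 1) → Prog K (Fin K),
      progsAt (loopProgs tie T c (fuel + 1) p E w κ) y (commRounds n K C.length) = prog ∧
      (∀ t < commRounds n K C.length,
        loss μ (armsAt (loopProgs tie T c (fuel + 1) p E w κ) y t) ≤ 2 + gap μ κ) ∧
      (∀ π, C = [π] → prog = fun m => Prog.done (π m)) ∧
      (C.length ≠ 1 → prog 0 = (Prog.pullList (exploreArms c p (C.map fun π => π 0))).andThen
        (fun obs => (listen (π₁ 0) (n * (K * meanBits c p))).andThen fun msg =>
          leaderLoop tie T c n fuel (p + 1) E' (Fin.cons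
            (empiricalMean (exploreArms c p (C.map fun π => π 0)) obs) fun i k =>
            (ofBits (block (meanBits c p) (block (K * meanBits c p) msg i) k) : ℝ) /
              2 ^ meanBits c p) π₁) ∧
        ∀ j : Fin n, prog j.succ =
          (Prog.pullList (exploreArms c p (C.map fun π => π j.succ))).andThen fun obs =>
            (Prog.pullList (reportArms c n j p (π₁ 0) (π₁ j.succ) fun k =>
              truncBits (meanBits c p) (empiricalMean (exploreArms c p (C.map fun π => π j.succ))
                obs k))).andThen fun _ => followerLoop c n j fuel (p + 1) (π₁ 0) (π₁ j.succ)) := by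
  set msgs : Fin n → List (Fin K) := fun i => C.map (fun π => π i.succ) ++ [π₁ 0, π₁ i.succ]
    with hmsgs
  set tail : Prog K (Fin K) := leaderTail c n p (E', C, π₁) fun w' =>
    leaderLoop tie T c n fuel (p + 1) E' w' π₁ with htail
  set fnext : Fin n → List Bool → List Bool → Prog K (Fin K) := fun j b₁ b₂ =>
    followerEpoch c n j p (decodeSize n K j b₁)
        (decodeArm j (decodeSize n K j b₁) b₂)
        (followerLoop c n j fuel (p + 1)
          (decodeArm j (decodeSize n K j b₁) b₂ (decodeSize n K j b₁))
          (decodeArm j (decodeSize n K j b₁) b₂ (decodeSize n K j b₁ + 1))) with hfnext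
  have hmsglen : ∀ i, (msgs i).length = C.length + 2 := by
    intro i
    simp [hmsgs]
  have hsz : C.length < 2 ^ sizeBits (n + 1) K := by
    have : (n + 1) * K + 1 ≤ 2 ^ sizeBits (n + 1) K := Nat.le_pow_clog (by norm_num) _
    omega
  obtain ⟨bits₁, hb1, hp1, hl1⟩ := run_leaderSends (n := n) hμ0 hμ1 hκ
    (B := fun _ => toBits (sizeBits (n + 1) K) C.length)
    (fun i => length_toBits _ _) (prog := loopProgs tie T c (fuel + 1) p E w κ)
    (F₀ := (Prog.pullList ((List.finRange n).flatMap fun i =>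
      sendArms (κ 0) (κ i.succ) ((msgs i).flatMap fun k : Fin K => toBits (armBits K) k))).andThen
        fun _ => tail)
    (F := fun j b₁ => (Prog.pullList (List.replicate
      (n * ((decodeSize n K j b₁ + 2) * armBits K)) (κ j.succ))).andThen fun o₂ =>
        fnext j b₁ (o₂.map Prod.snd)) y
    (by
      simp only [loopProgs, Fin.cases_zero]
      rw [leaderLoop_succ, hd]
      unfold leaderEpoch
      simp only [flatMap_bind_pure_val]
      rfl)
    (by
      intro j
      simp only [loopProgs, Fin.cases_succ]
      rw [followerLoop_succ])
  have hdec : ∀ j : Fin n, decodeSize n K j (bits₁ j) = C.length := by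
    intro j
    unfold decodeSize
    rw [hb1, ofBits_toBits hsz]
  simp only [hdec] at hp1
  obtain ⟨bits₂, hb2, hp2, hl2⟩ := run_leaderSends (n := n) hμ0 hμ1 hκ
    (b := (C.length + 2) * armBits K)
    (B := fun i => (msgs i).flatMap fun k : Fin K => toBits (armBits K) k)
    (fun i => by rw [length_flatMap_const _ _ fun _ _ => length_toBits _ _, hmsglen])
    (prog := progsAt (loopProgs tie T c (fuel + 1) p E w κ) y (n * sizeBits (n + 1) K))
    (F₀ := tail) (F := fun j b₂ => fnext j (bits₁ j) b₂) (shift (n * sizeBits (n + 1) K) y)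
    (by rw [hp1]; rfl) (by intro j; rw [hp1]; rfl)
  have hnum : ∀ (j : Fin n) (i : ℕ) (hi : i < C.length + 2),
      decodeArm j C.length (bits₂ j) i = (msgs j)[i]'(by rw [hmsglen]; exact hi) := by
    intro j i hi
    unfold decodeArm
    rw [hb2, block_flatMap _ _ (fun _ _ => length_toBits _ _) i (by rw [hmsglen]; exact hi),
      ofBits_toBits ((Fin.is_lt _).trans_le (le_two_pow_armBits K))]
    exact Fin.ofNat_val_eq_self _
  have hnum0 : ∀ j : Fin n, decodeArm j C.length (bits₂ j) C.length = π₁ 0 := by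
    intro j
    rw [hnum j _ (by omega)]
    simp [hmsgs]
  have hnum1 : ∀ j : Fin n, decodeArm j C.length (bits₂ j) (C.length + 1) = π₁ j.succ := by
    intro j
    rw [hnum j _ (by omega)]
    simp [hmsgs]
  have hnumC : ∀ j : Fin n, (List.range C.length).map (decodeArm j C.length (bits₂ j)) =
      C.map fun π => π j.succ := by
    intro j
    apply List.ext_getElem
    · simp
    · intro i h1 h2
      simp only [List.length_map, List.length_range] at h1
      rw [List.getElem_map, List.getElem_range, hnum j _ (by omega)]
      simp [hmsgs, h1]
  refine ⟨_, rfl, ?_, ?_, ?_⟩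
  · intro t ht
    unfold commRounds at ht
    rcases lt_or_ge t (n * sizeBits (n + 1) K) with h | h
    · exact hl1 t h
    · obtain ⟨t', rfl⟩ := Nat.exists_eq_add_of_le h
      rw [armsAt_add]
      exact hl2 t' (by omega)
  · intro π hπ
    unfold commRounds
    rw [progsAt_add, hp2]
    funext m
    refine Fin.cases ?_ (fun j => ?_) m
    · simp only [Fin.cases_zero]
      rw [htail, hπ]
      rfl
    · simp only [Fin.cases_succ]
      rw [hfnext]
      simp only [hdec]
      unfold followerEpoch
      have hC1 : C.length = 1 := by simp [hπ]
      rw [if_pos hC1, hnum j 0 (by omega)]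
      simp [hmsgs, hπ]
  · intro hC1
    unfold commRounds
    rw [progsAt_add, hp2]
    refine ⟨?_, fun j => ?_⟩
    · simp only [Fin.cases_zero]
      rw [htail]
      unfold leaderTail
      split
      · rename_i h
        simp only at h
        simp [h] at hC1
      · rfl
    · simp only [Fin.cases_succ]
      rw [hfnext]
      simp only [hdec, hnum0, hnum1]
      unfold followerEpoch
      rw [if_neg hC1, hnumC, hnum0, hnum1]

end Epoch

/-! ### The loss from an epoch on -/

section EpochLoss

variable {n K : ℕ} [NeZero K]

/-- The loss from the last epoch on, in which the only candidate is optimal. -/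
theorem totalLoss_last_epoch {μ : Fin (n + 1) → Fin K → ℝ} (hμ0 : ∀ m k, 0 ≤ μ m k)
    (hμ1 : ∀ m k, μ m k ≤ 1) (tie : TieBreak K) (T c fuel p : ℕ)
    (E : List (Fin (n + 1) × Fin K)) (w : Fin (n + 1) → Fin K → ℝ)
    {κ : Fin (n + 1) → Fin K} (hκ : Function.Injective κ) (y : Fin (n + 1) → Fin K → ℕ → ℝ)
    (R : ℕ) {π π₁ : Fin (n + 1) → Fin K} {E' : List (Fin (n + 1) × Fin K)}
    (hd : decision tie T c p E w = (E', [π], π₁)) (hπ : Function.Injective π)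
    (hgap : gap μ π = 0) :
    totalLoss μ (loopProgs tie T c (fuel + 1) p E w κ) y R ≤
      commRounds n K 1 * (2 + gap μ κ) := by
  have hpos : 0 ≤ 2 + gap μ κ := by linarith [gap_nonneg μ hκ]
  obtain ⟨prog, hp, hl, h1, -⟩ := run_announcement hμ0 hμ1 tie T c fuel p E w hκ y hd
    (by
      have : 0 < K := Nat.pos_of_ne_zero (NeZero.ne K)
      simp only [List.length_singleton]
      nlinarith)
  have := totalLoss_le_phase (R := R) (b := fun _ => 2 + gap μ κ) hl (fun _ _ => hpos) le_rfl hp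
    fun R' _ => by
      rw [h1 π rfl]
      exact totalLoss_done_le hπ hgap _ _
  simpa [mul_add] using this

/-- The loss from an epoch on in which there are several candidates. -/
theorem totalLoss_epoch {μ : Fin (n + 1) → Fin K → ℝ} (hμ0 : ∀ m k, 0 ≤ μ m k)
    (hμ1 : ∀ m k, μ m k ≤ 1) (tie : TieBreak K) (T c fuel p : ℕ)
    (E : List (Fin (n + 1) × Fin K)) (w : Fin (n + 1) → Fin K → ℝ)
    {κ : Fin (n + 1) → Fin K} (hκ : Function.Injective κ) (y : Fin (n + 1) → Fin K → ℕ → ℝ)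
    (s R : ℕ) {C : List (Fin (n + 1) → Fin K)} {π₁ : Fin (n + 1) → Fin K}
    {E' : List (Fin (n + 1) × Fin K)} (hd : decision tie T c p E w = (E', C, π₁))
    (hClen : C.length ≤ (n + 1) * K) (hC1 : C.length ≠ 1)
    (hC : ∀ π ∈ C, Function.Injective π) (hπ₁ : Function.Injective π₁) {B D : ℝ} (hB : 0 ≤ B)
    (hD0 : 0 ≤ D)
    (hD : ∀ R', R = commRounds n K C.length + (C.length * 2 ^ p ^ c + R') →
      ((n * (K * meanBits c p) : ℕ) : ℝ) * (2 + gap μ π₁) ≤ D)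
    (hrest : ∀ R', R = commRounds n K C.length + (C.length * 2 ^ p ^ c +
        (n * (K * meanBits c p) + R')) →
      totalLoss μ (loopProgs tie T c fuel (p + 1) E'
        (newWeights c p C y (s + commRounds n K C.length)) π₁)
        (shift (s + commRounds n K C.length + C.length * 2 ^ p ^ c + n * (K * meanBits c p)) y) R'
        ≤ B) :
    totalLoss μ (loopProgs tie T c (fuel + 1) p E w κ) (shift s y) R ≤
      commRounds n K C.length * (2 + gap μ κ) +
        (2 ^ p ^ c * (C.map (gap μ)).sum + (D + B)) := by
  have hpos : 0 ≤ 2 + gap μ κ := by linarith [gap_nonneg μ hκ]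
  have hpos₁ : 0 ≤ 2 + gap μ π₁ := by linarith [gap_nonneg μ hπ₁]
  obtain ⟨prog, hp, hl, -, h2⟩ := run_announcement hμ0 hμ1 tie T c fuel p E w hκ (shift s y)
    hd hClen
  obtain ⟨h20, h2S⟩ := h2 hC1
  set s₁ := s + commRounds n K C.length with hs₁
  have hsum0 : 0 ≤ (2 : ℝ) ^ p ^ c * (C.map (gap μ)).sum := by
    refine mul_nonneg (by positivity) (List.sum_nonneg fun x hx => ?_)
    obtain ⟨π, hπ, rfl⟩ := List.mem_map.1 hx
    exact gap_nonneg μ (hC π hπ)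
  have h3 := totalLoss_le_phase (R := R) (b := fun _ => 2 + gap μ κ)
    (B := 2 ^ p ^ c * (C.map (gap μ)).sum + (D + B)) hl (fun _ _ => hpos) (by linarith) hp ?_
  · simpa [mul_add] using h3
  intro R₁ hR₁
  rw [shift_shift]
  obtain ⟨he1, he2, he3⟩ := run_explore (μ := μ) (c := c) (p := p) hC y s₁
    (prog := prog) (F := Fin.cases (fun obs => (listen (π₁ 0) (n * (K * meanBits c p))).andThen
      fun msg => leaderLoop tie T c n fuel (p + 1) E' (Fin.cons
            (empiricalMean (exploreArms c p (C.map fun π => π 0)) obs) fun i k =>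
            (ofBits (block (meanBits c p) (block (K * meanBits c p) msg i) k) : ℝ) /
              2 ^ meanBits c p) π₁)
      (fun j obs => (Prog.pullList (reportArms c n j p (π₁ 0) (π₁ j.succ) fun k =>
              truncBits (meanBits c p) (empiricalMean (exploreArms c p (C.map fun π => π j.succ))
                obs k))).andThen fun _ => followerLoop c n j fuel (p + 1) (π₁ 0) (π₁ j.succ)))
    (fun m => by
      refine Fin.cases ?_ (fun j => ?_) m
      · exact h20
      · exact h2S j)
  have h4 := totalLoss_le_phase (R := R₁) (B := D + B) he2 he3 (by linarith) he1 ?_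
  · rw [sum_range_gap] at h4
    simpa using h4
  intro R₂ hR₂
  rw [shift_shift]
  have hDle := hD R₂ (by rw [hR₁, hR₂])
  obtain ⟨bits, hb, hp5, hl5⟩ := run_followersSend (n := n) hμ0 hμ1 hπ₁ (b := K * meanBits c p)
    (B := fun j => (List.finRange K).flatMap fun k => toBits (meanBits c p)
      (truncBits (meanBits c p) (rawEstimate c p C y s₁ j.succ k)))
    (fun i => by
      rw [length_flatMap_const _ _ fun _ _ => length_toBits _ _, List.length_finRange])
    (prog := fun m => (Fin.cases (fun obs => (listen (π₁ 0) (n * (K * meanBits c p))).andThen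
      fun msg => leaderLoop tie T c n fuel (p + 1) E' (Fin.cons
            (empiricalMean (exploreArms c p (C.map fun π => π 0)) obs) fun i k =>
            (ofBits (block (meanBits c p) (block (K * meanBits c p) msg i) k) : ℝ) /
              2 ^ meanBits c p) π₁)
      (fun j obs => (Prog.pullList (reportArms c n j p (π₁ 0) (π₁ j.succ) fun k =>
              truncBits (meanBits c p) (empiricalMean (exploreArms c p (C.map fun π => π j.succ))
                obs k))).andThen fun _ => followerLoop c n j fuel (p + 1) (π₁ 0) (π₁ j.succ)) :
                Fin (n + 1) → List (ℝ × Bool) → Prog K (Fin K)) m (exploreObs c p C y s₁ m))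
    (F₀ := fun msg => leaderLoop tie T c n fuel (p + 1) E' (Fin.cons
            (rawEstimate c p C y s₁ 0) fun i k =>
            (ofBits (block (meanBits c p) (block (K * meanBits c p) msg i) k) : ℝ) /
              2 ^ meanBits c p) π₁)
    (F := fun j => followerLoop c n j fuel (p + 1) (π₁ 0) (π₁ j.succ))
    (shift (s₁ + C.length * 2 ^ p ^ c) y)
    (by
      simp only [Fin.cases_zero]
      rw [listen_andThen]
      rfl)
    (by
      intro j
      simp only [Fin.cases_succ]
      rfl)
  -- The reports are decoded without error, so the leader continues with `newWeights`, a function of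
  -- the qualities alone.
  have hw : (Fin.cons (rawEstimate c p C y s₁ 0) fun i k =>
      (ofBits (block (meanBits c p) (block (K * meanBits c p) bits (i : Fin n)) (k : Fin K)) : ℝ) /
        2 ^ meanBits c p : Fin (n + 1) → Fin K → ℝ) = newWeights c p C y s₁ := by
    unfold newWeights
    congr 1
    funext i k
    rw [hb, block_flatMap _ _ (fun _ _ => length_toBits _ _) k (by simp),
      ofBits_toBits (truncBits_lt _ _)]
    simp
  have h5 := totalLoss_le_phase (R := R₂) (b := fun _ => 2 + gap μ π₁) (B := B) hl5
    (fun _ _ => hpos₁) hB hp5 ?_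
  · simp only [Finset.sum_const, Finset.card_range, nsmul_eq_mul] at h5
    linarith
  intro R₃ hR₃
  rw [shift_shift, hw]
  exact hrest R₃ (by rw [hR₁, hR₂, hR₃])

end EpochLoss

/-! ### The leader's decisions -/

section Decisions

variable {M K : ℕ}

theorem argmax_spec (tie : TieBreak K) {S : Finset (Fin M → Fin K)} (hS : S.Nonempty)
    (w : Fin M → Fin K → ℝ) :
    argmax tie S w ∈ S ∧ ∀ π ∈ S, utility w π ≤ utility w (argmax tie S w) := by
  classical
  obtain ⟨π, hπ, hmax⟩ := S.exists_max_image (utility w) hS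
  have h := tie.pick_mem (S.filter fun π => ∀ π' ∈ S, utility w π' ≤ utility w π)
    ⟨π, Finset.mem_filter.2 ⟨hπ, hmax⟩⟩
  rw [Finset.mem_filter] at h
  unfold argmax
  convert h

theorem mem_matchings {π : Fin M → Fin K} : π ∈ matchings M K ↔ Function.Injective π := by
  simp [matchings]

theorem exists_matching_through {π : Fin M → Fin K} (hπ : Function.Injective π) (m : Fin M)
    (k : Fin K) : ∃ π' : Fin M → Fin K, Function.Injective π' ∧ π' m = k :=
  ⟨fun m' => Equiv.swap (π m) k (π m'), (Equiv.injective _).comp hπ, Equiv.swap_apply_left _ _⟩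

theorem bestMatching_spec (tie : TieBreak K) (w : Fin M → Fin K → ℝ) {π : Fin M → Fin K}
    (hπ : Function.Injective π) : Function.Injective (bestMatching tie w) ∧
      utility w π ≤ utility w (bestMatching tie w) := by
  have h := argmax_spec tie ⟨π, mem_matchings.2 hπ⟩ w
  exact ⟨mem_matchings.1 h.1, h.2 π (mem_matchings.2 hπ)⟩

theorem edgeMatching_spec (tie : TieBreak K) (w : Fin M → Fin K → ℝ) {π : Fin M → Fin K}
    (hπ : Function.Injective π) (e : Fin M × Fin K) :
    Function.Injective (edgeMatching tie w e) ∧ edgeMatching tie w e e.1 = e.2 ∧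
      (π e.1 = e.2 → utility w π ≤ utility w (edgeMatching tie w e)) := by
  classical
  obtain ⟨π', hπ', h'⟩ := exists_matching_through hπ e.1 e.2
  have h := argmax_spec tie (S := (matchings M K).filter fun π => π e.1 = e.2)
    ⟨π', Finset.mem_filter.2 ⟨mem_matchings.2 hπ', h'⟩⟩ w
  have h1 := Finset.mem_filter.1 h.1
  have h2 : ∀ x, argmax tie ((matchings M K).filter fun π => π e.1 = e.2) w = x →
      edgeMatching tie w e = x := by
    rintro x rfl
    unfold edgeMatching
    congr!
  rw [h2 _ rfl]
  exact ⟨mem_matchings.1 h1.1, h1.2, fun h3 =>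
    h.2 π (Finset.mem_filter.2 ⟨mem_matchings.2 hπ, h3⟩)⟩

/-- The leader's weights `w` overestimate no mean by more than `r` and underestimate the means of
the edges of `π` by at most `r`; all edges of `π` belong to `E`. -/
structure GoodWeights (μ : Fin M → Fin K → ℝ) (π : Fin M → Fin K) (r : ℝ)
    (E : List (Fin M × Fin K)) (w : Fin M → Fin K → ℝ) : Prop where
  le : ∀ m k, w m k ≤ μ m k + r
  ge : ∀ m, μ m (π m) - r ≤ w m (π m)
  mem : ∀ m, (m, π m) ∈ E
  nodup : E.Nodup

theorem GoodWeights.utility_le {μ : Fin M → Fin K → ℝ} {π : Fin M → Fin K} {r : ℝ}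
    {E : List (Fin M × Fin K)} {w : Fin M → Fin K → ℝ} (h : GoodWeights μ π r E w)
    (π' : Fin M → Fin K) : utility w π' ≤ utility μ π' + M * r := by
  calc utility w π' ≤ ∑ m, (μ m (π' m) + r) := Finset.sum_le_sum fun m _ => h.le m _
    _ = _ := by simp [Finset.sum_add_distrib, utility]

theorem GoodWeights.le_utility {μ : Fin M → Fin K → ℝ} {π : Fin M → Fin K} {r : ℝ}
    {E : List (Fin M × Fin K)} {w : Fin M → Fin K → ℝ} (h : GoodWeights μ π r E w) :
    utility μ π - M * r ≤ utility w π := by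
  calc utility μ π - M * r = ∑ m, (μ m (π m) - r) := by
        simp [Finset.sum_sub_distrib, utility]
    _ ≤ _ := Finset.sum_le_sum fun m _ => h.ge m

variable {μ : Fin M → Fin K → ℝ} {π : Fin M → Fin K} {tie : TieBreak K} {T c p : ℕ}
  {E E' : List (Fin M × Fin K)} {w : Fin M → Fin K → ℝ} {C : List (Fin M → Fin K)}
  {π₁ : Fin M → Fin K}

/-- The weight of `π` falls short of U⋆ by at most 2Mε, that of `π₁` exceeds its utility by at most
2Mε, and `π₁` has the larger weight. -/
theorem decision_best (hπ : Function.Injective π) (hopt : utility μ π = maxUtility μ)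
    (h : GoodWeights μ π (2 * epsRadius M K T c (p - 1)) E w)
    (hd : decision tie T c p E w = (E', C, π₁)) :
    Function.Injective π₁ ∧ gap μ π₁ ≤ 4 * M * epsRadius M K T c (p - 1) := by
  obtain rfl : bestMatching tie w = π₁ := congrArg (fun d => d.2.2) hd
  obtain ⟨h1, h2⟩ := bestMatching_spec tie w hπ
  refine ⟨h1, ?_⟩
  have h3 := h.utility_le (bestMatching tie w)
  have h4 := h.le_utility
  unfold gap
  linarith

theorem mem_survivors (hd : decision tie T c p E w = (E', C, π₁)) (e : Fin M × Fin K) :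
    e ∈ E' ↔ e ∈ E ∧ utility w (bestMatching tie w) - utility w (edgeMatching tie w e)
      ≤ 4 * M * epsRadius M K T c (p - 1) := by
  obtain rfl : survivingEdges tie T c p E w = E' := congrArg (fun d => d.1) hd
  simp [survivingEdges]

theorem mem_candidates (hd : decision tie T c p E w = (E', C, π₁)) (π' : Fin M → Fin K) :
    π' ∈ C ↔ ∃ e ∈ E', edgeMatching tie w e = π' := by
  obtain rfl : survivingEdges tie T c p E w = E' := congrArg (fun d => d.1) hd
  obtain rfl : candidates tie (survivingEdges tie T c p E w) w = C :=
    congrArg (fun d => d.2.1) hd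
  simp [candidates]

/-- The matching of an edge of `π` weighs at least as much as `π`, thus at least U⋆ - 2Mε, while no
matching weighs more than U⋆ + 2Mε. So the difference stays within the threshold 4Mε. -/
theorem decision_optimal_survives (hπ : Function.Injective π) (hopt : utility μ π = maxUtility μ)
    (h : GoodWeights μ π (2 * epsRadius M K T c (p - 1)) E w)
    (hd : decision tie T c p E w = (E', C, π₁)) (m : Fin M) : (m, π m) ∈ E' := by
  rw [mem_survivors hd]
  refine ⟨h.mem m, ?_⟩
  have h1 := (edgeMatching_spec tie w hπ (m, π m)).2.2 rfl
  have h2 := h.le_utility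
  have h3 := h.utility_le (bestMatching tie w)
  have h4 := utility_le_maxUtility μ (bestMatching_spec tie w hπ).1
  linarith

theorem candidate_injective (hπ : Function.Injective π)
    (hd : decision tie T c p E w = (E', C, π₁)) {π' : Fin M → Fin K} (h' : π' ∈ C) :
    Function.Injective π' := by
  obtain ⟨e, -, rfl⟩ := (mem_candidates hd π').1 h'
  exact (edgeMatching_spec tie w hπ e).1

/-- The elimination threshold contributes 4Mε, the estimation errors of `π` and of the edge matching
2Mε each. -/
theorem gap_edgeMatching_le (hπ : Function.Injective π) (hopt : utility μ π = maxUtility μ)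
    (h : GoodWeights μ π (2 * epsRadius M K T c (p - 1)) E w)
    (hd : decision tie T c p E w = (E', C, π₁)) {e : Fin M × Fin K} (he : e ∈ E') :
    gap μ (edgeMatching tie w e) ≤ 8 * M * epsRadius M K T c (p - 1) := by
  have h1 := ((mem_survivors hd e).1 he).2
  have h2 := h.le_utility
  have h3 := h.utility_le (edgeMatching tie w e)
  have h4 := (bestMatching_spec tie w hπ).2
  unfold gap
  linarith

theorem length_candidates_le (h : E.Nodup) (hd : decision tie T c p E w = (E', C, π₁)) :
    E'.Nodup ∧ C.length ≤ M * K := by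
  classical
  obtain rfl : survivingEdges tie T c p E w = E' := congrArg (fun d => d.1) hd
  obtain rfl : candidates tie (survivingEdges tie T c p E w) w = C :=
    congrArg (fun d => d.2.1) hd
  have h1 : (survivingEdges tie T c p E w).Nodup := h.filter _
  refine ⟨h1, ?_⟩
  unfold candidates
  calc _ ≤ ((survivingEdges tie T c p E w).map (edgeMatching tie w)).length :=
        (List.dedup_sublist _).length_le
    _ = (survivingEdges tie T c p E w).length := List.length_map _
    _ ≤ Fintype.card (Fin M × Fin K) := h1.length_le_card
    _ = M * K := by simp

/-- Gaps of matchings are nonnegative, so restoring the duplicates only increases the sum. This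
charges the exploration loss to edges instead of matchings. -/
theorem sum_gap_candidates_le (hπ : Function.Injective π)
    (hE : E.Nodup) (hd : decision tie T c p E w = (E', C, π₁)) {g : Fin M × Fin K → ℝ}
    (hg0 : ∀ e, 0 ≤ g e) (hg : ∀ e ∈ E', gap μ (edgeMatching tie w e) ≤ g e) :
    (C.map (gap μ)).sum ≤ ∑ e, g e := by
  classical
  have hE' := (length_candidates_le hE hd).1
  obtain rfl : candidates tie E' w = C := by
    have h1 : survivingEdges tie T c p E w = E' := congrArg (fun d => d.1) hd
    have h2 : candidates tie (survivingEdges tie T c p E w) w = C := congrArg (fun d => d.2.1) hd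
    rw [h1] at h2
    exact h2
  have h1 : ((candidates tie E' w).map (gap μ)).sum ≤
      ((E'.map (edgeMatching tie w)).map (gap μ)).sum := by
    refine List.Sublist.sum_le_sum ((List.dedup_sublist _).map _) fun x hx => ?_
    simp only [List.map_map, List.mem_map, Function.comp_apply] at hx
    obtain ⟨e, -, rfl⟩ := hx
    exact gap_nonneg μ (edgeMatching_spec tie w hπ e).1
  refine h1.trans ?_
  rw [List.map_map]
  calc (E'.map (gap μ ∘ edgeMatching tie w)).sum ≤ (E'.map g).sum :=
        List.sum_le_sum fun e he => hg e he
    _ = ∑ e ∈ E'.toFinset, g e := (List.sum_toFinset g hE').symm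
    _ ≤ ∑ e, g e := Finset.sum_le_univ_sum_of_nonneg hg0

end Decisions

/-! ### The estimates of an epoch -/

section Radius

/-- Twice the number of bits is at least `1 + p ^ c`, so the square of the truncation error is at
most 2^(-(1 + p^c)), and ε_p² is this number times a logarithm that is at least 1. -/
theorem inv_two_pow_meanBits_le {M K T c p : ℕ}
    (hL : 1 ≤ Real.log (2 / (1 / ((M : ℝ) ^ 2 * K * (T : ℝ) ^ 2)))) :
    1 / (2 : ℝ) ^ meanBits c p ≤ epsRadius M K T c p := by
  unfold epsRadius
  apply Real.le_sqrt_of_sq_le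
  rw [div_pow, one_pow, ← pow_mul]
  have h1 : (2 : ℝ) ^ (1 + p ^ c) ≤ 2 ^ (meanBits c p * 2) := by
    refine pow_le_pow_right₀ (by norm_num) ?_
    unfold meanBits
    omega
  calc 1 / (2 : ℝ) ^ (meanBits c p * 2) ≤ 1 / 2 ^ (1 + p ^ c) :=
        one_div_le_one_div_of_le (by positivity) h1
    _ ≤ _ := by gcongr

theorem epsRadius_nonneg (M K T c p : ℕ) : 0 ≤ epsRadius M K T c p := Real.sqrt_nonneg _

end Radius

/-! ### Empirical means of an exploration phase and the resulting weights -/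

section Estimates

variable {n K : ℕ} [NeZero K]

/-- The rounds of the exploration phase in which player `m` pulls arm `k`. -/
def exploreRounds (c p : ℕ) (C : List (Fin (n + 1) → Fin K)) (m : Fin (n + 1)) (k : Fin K) :
    Finset ℕ :=
  (Finset.range (C.length * 2 ^ p ^ c)).filter fun t =>
    (exploreArms c p (C.map fun π => π m)).getD t 0 = k

theorem list_sum_filter_range (N : ℕ) (q : ℕ → Prop) [DecidablePred q] (f : ℕ → ℝ) :
    (((List.range N).filter fun t => q t).map f).sum =
      ∑ t ∈ (Finset.range N).filter q, f t := by
  induction N with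
  | zero => simp
  | succ N ih =>
    rw [List.range_succ, List.filter_append, List.map_append, List.sum_append, ih,
      Finset.range_add_one, Finset.filter_insert]
    by_cases h : q N <;> simp [h, add_comm]

theorem list_length_filter_range (N : ℕ) (q : ℕ → Prop) [DecidablePred q] :
    ((List.range N).filter fun t => q t).length = ((Finset.range N).filter q).card := by
  induction N with
  | zero => simp
  | succ N ih =>
    rw [List.range_succ, List.filter_append, List.length_append, ih,
      Finset.range_add_one, Finset.filter_insert]
    by_cases h : q N <;> simp [h]

/-- For given candidates, the rounds in which an arm is explored form a fixed set, and the mean over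
a list becomes an average over fixed indices, the form needed for concentration. If there is no such
round, both sides are 0 because of division by zero. -/
theorem rawEstimate_eq (c p : ℕ) (C : List (Fin (n + 1) → Fin K))
    (y : Fin (n + 1) → Fin K → ℕ → ℝ) (s : ℕ) (m : Fin (n + 1)) (k : Fin K) :
    rawEstimate c p C y s m k = (∑ t ∈ exploreRounds c p C m k, y m k (s + t)) /
      (exploreRounds c p C m k).card := by
  classical
  set arms := exploreArms c p (C.map fun π => π m) with harms
  have hlen : arms.length = C.length * 2 ^ p ^ c := by
    rw [harms, length_exploreArms, List.length_map]
  have hz : arms.zip (exploreObs c p C y s m) = (List.range (C.length * 2 ^ p ^ c)).map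
      fun t => (arms.getD t 0, y m (arms.getD t 0) (s + t), false) := by
    conv_lhs => rw [list_eq_map_getD arms 0]
    rw [hlen]
    unfold exploreObs
    rw [← harms, List.zip_map', ]
  have hf : ((arms.zip (exploreObs c p C y s m)).filter fun x => x.1 = k).map (fun x => x.2.1) =
      ((List.range (C.length * 2 ^ p ^ c)).filter fun t => arms.getD t 0 = k).map
        fun t => y m k (s + t) := by
    rw [hz, List.filter_map, List.map_map]
    refine List.map_congr_left fun t ht => ?_
    have := (List.mem_filter.1 ht).2
    simp only [Function.comp_apply, decide_eq_true_eq] at this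
    simp only [Function.comp_apply, this]
  have hs := list_sum_filter_range (C.length * 2 ^ p ^ c) (fun t => arms.getD t 0 = k)
    fun t => y m k (s + t)
  have hl := list_length_filter_range (C.length * 2 ^ p ^ c) (fun t => arms.getD t 0 = k)
  have hI : (Finset.range (C.length * 2 ^ p ^ c)).filter (fun t => arms.getD t 0 = k) =
      exploreRounds c p C m k := rfl
  rw [hI] at hs hl
  have hraw : rawEstimate c p C y s m k =
      if (((arms.zip (exploreObs c p C y s m)).filter fun x => x.1 = k).map
        (fun x => x.2.1)).length = 0 then 0 else
      (((arms.zip (exploreObs c p C y s m)).filter fun x => x.1 = k).map (fun x => x.2.1)).sum /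
      (((arms.zip (exploreObs c p C y s m)).filter fun x => x.1 = k).map
        (fun x => x.2.1)).length := by
    unfold rawEstimate empiricalMean
    congr!
  rw [hraw, hf, List.length_map, hl, hs]
  split_ifs with h0
  · simp [h0]
  · rfl

theorem exploreRounds_eq_empty {c p : ℕ} {C : List (Fin (n + 1) → Fin K)} {m : Fin (n + 1)}
    {k : Fin K} (h : ∀ π ∈ C, π m ≠ k) : exploreRounds c p C m k = ∅ := by
  unfold exploreRounds
  rw [Finset.filter_eq_empty_iff]
  intro t ht
  rw [Finset.mem_range] at ht
  have hlen : t < (exploreArms c p (C.map fun π => π m)).length := by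
    rw [length_exploreArms, List.length_map]
    exact ht
  rw [List.getD_eq_getElem _ _ hlen]
  obtain ⟨k', hk', h'⟩ := List.mem_flatMap.1 (List.getElem_mem hlen)
  obtain ⟨π, hπ, rfl⟩ := List.mem_map.1 hk'
  rw [List.eq_of_mem_replicate h']
  exact h π hπ

/-- The `i`-th block of `2 ^ p ^ c` rounds belongs to the `i`-th candidate. Only an inequality
holds, as several candidates may share an edge. -/
theorem two_pow_le_card_exploreRounds {c p : ℕ} {C : List (Fin (n + 1) → Fin K)}
    {m : Fin (n + 1)} {π : Fin (n + 1) → Fin K} (hπ : π ∈ C) :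
    2 ^ p ^ c ≤ (exploreRounds c p C m (π m)).card := by
  obtain ⟨i, hi, rfl⟩ := List.getElem_of_mem hπ
  have h1 : (Finset.range (2 ^ p ^ c)).image (fun r => i * 2 ^ p ^ c + r) ⊆
      exploreRounds c p C m (C[i] m) := by
    intro t ht
    obtain ⟨r, hr, rfl⟩ := Finset.mem_image.1 ht
    rw [Finset.mem_range] at hr
    refine Finset.mem_filter.2 ⟨?_, ?_⟩
    · rw [Finset.mem_range]
      have : (i + 1) * 2 ^ p ^ c ≤ C.length * 2 ^ p ^ c := Nat.mul_le_mul_right _ hi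
      rw [add_mul] at this
      omega
    · rw [← getD_block hr]
      unfold exploreArms
      rw [block_flatMap _ _ (fun _ _ => by simp) i (by simpa using hi)]
      simp [hr]
  calc 2 ^ p ^ c = ((Finset.range (2 ^ p ^ c)).image (fun r => i * 2 ^ p ^ c + r)).card := by
        rw [Finset.card_image_of_injective _ (add_right_injective _), Finset.card_range]
    _ ≤ _ := Finset.card_le_card h1

theorem rawEstimate_mem_Icc {c p : ℕ} {C : List (Fin (n + 1) → Fin K)}
    {y : Fin (n + 1) → Fin K → ℕ → ℝ} (hy : ∀ m k t, y m k t ∈ Set.Icc (0 : ℝ) 1) (s : ℕ)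
    (m : Fin (n + 1)) (k : Fin K) : rawEstimate c p C y s m k ∈ Set.Icc (0 : ℝ) 1 := by
  rw [rawEstimate_eq]
  constructor
  · exact div_nonneg (Finset.sum_nonneg fun t _ => (hy m k _).1) (Nat.cast_nonneg _)
  · refine div_le_one_of_le₀ ?_ (Nat.cast_nonneg _)
    calc _ ≤ ∑ _t ∈ exploreRounds c p C m k, (1 : ℝ) := Finset.sum_le_sum fun t _ => (hy m k _).2
      _ = _ := by simp

theorem truncBits_close {b : ℕ} {x : ℝ} (hx : x ∈ Set.Icc (0 : ℝ) 1) :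
    (truncBits b x : ℝ) / 2 ^ b ≤ x ∧ x ≤ (truncBits b x : ℝ) / 2 ^ b + 1 / 2 ^ b := by
  have hb : (0 : ℝ) < 2 ^ b := by positivity
  have hx0 : 0 ≤ x * 2 ^ b := mul_nonneg hx.1 hb.le
  rw [← add_div, div_le_iff₀ hb, le_div_iff₀ hb]
  constructor
  · calc (truncBits b x : ℝ) ≤ (⌊x * 2 ^ b⌋₊ : ℝ) := by
          unfold truncBits
          exact Nat.cast_le.2 (min_le_left _ _)
      _ ≤ x * 2 ^ b := Nat.floor_le hx0
  · unfold truncBits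
    rcases min_choice ⌊x * 2 ^ b⌋₊ (2 ^ b - 1) with h | h <;> rw [h]
    · exact (Nat.lt_floor_add_one _).le
    · rw [Nat.cast_sub (Nat.one_le_two_pow)]
      push_cast
      have := hx.2
      nlinarith

/-- The empirical means of the arms pulled in the exploration phase of epoch `p` which starts in
round `s` are within the confidence radius of the true means. -/
def Accurate (μ : Fin (n + 1) → Fin K → ℝ) (T c p : ℕ) (C : List (Fin (n + 1) → Fin K))
    (y : Fin (n + 1) → Fin K → ℕ → ℝ) (s : ℕ) : Prop :=
  ∀ m, ∀ π ∈ C, |rawEstimate c p C y s m (π m) - μ m (π m)| ≤ epsRadius (n + 1) K T c p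

/-- One radius pays for sampling and one for truncation, which only lowers a value. An unexplored
arm gets the weight 0, which cannot overestimate; this is why `GoodWeights` demands a lower bound
for the edges of `π` only, all of which the candidates cover. -/
theorem Accurate.goodWeights {μ : Fin (n + 1) → Fin K → ℝ} (hμ0 : ∀ m k, 0 ≤ μ m k)
    {T c p : ℕ} {C : List (Fin (n + 1) → Fin K)} {y : Fin (n + 1) → Fin K → ℕ → ℝ} {s : ℕ}
    (h : Accurate μ T c p C y s) (hy : ∀ m k t, y m k t ∈ Set.Icc (0 : ℝ) 1)
    (hL : 1 ≤ Real.log (2 / (1 / (((n + 1 : ℕ) : ℝ) ^ 2 * K * (T : ℝ) ^ 2))))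
    {π : Fin (n + 1) → Fin K} (hπ : ∀ m, ∃ π' ∈ C, π' m = π m) {E : List (Fin (n + 1) × Fin K)}
    (hE : ∀ m, (m, π m) ∈ E) (hnd : E.Nodup) :
    GoodWeights μ π (2 * epsRadius (n + 1) K T c p) E (newWeights c p C y s) := by
  have hε := epsRadius_nonneg (n + 1) K T c p
  have hb := inv_two_pow_meanBits_le (c := c) (p := p) hL
  have hw : ∀ m k, newWeights c p C y s m k ≤ rawEstimate c p C y s m k ∧
      rawEstimate c p C y s m k ≤ newWeights c p C y s m k + epsRadius (n + 1) K T c p := by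
    intro m k
    refine Fin.cases ?_ (fun j => ?_) m
    · simp only [newWeights, Fin.cons_zero]
      exact ⟨le_rfl, by linarith⟩
    · simp only [newWeights, Fin.cons_succ]
      have := truncBits_close (b := meanBits c p) (rawEstimate_mem_Icc (c := c) (p := p) (C := C)
        hy s j.succ k)
      exact ⟨this.1, by linarith⟩
  refine ⟨fun m k => ?_, fun m => ?_, hE, hnd⟩
  · by_cases hk : ∃ π' ∈ C, π' m = k
    · obtain ⟨π', hπ', rfl⟩ := hk
      have h1 := (abs_le.1 (h m π' hπ')).2
      have h2 := (hw m (π' m)).1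
      linarith
    · push Not at hk
      have h1 := (hw m k).1
      rw [rawEstimate_eq, exploreRounds_eq_empty hk] at h1
      simp only [Finset.sum_empty, zero_div] at h1
      have := hμ0 m k
      linarith
  · obtain ⟨π', hπ', hm⟩ := hπ m
    have h1 := (abs_le.1 (h m π' hπ')).1
    have h2 := (hw m (π' m)).2
    rw [hm] at h1 h2
    linarith

end Estimates

/-! ### The loss of a run with accurate estimates -/

section Ideal

variable {n K : ℕ} [NeZero K]

/-- All pairs of a player and an arm. -/
def allEdges (n K : ℕ) : List (Fin (n + 1) × Fin K) :=
  (List.finRange (n + 1)).product (List.finRange K)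

/-- What the leader decides at the beginning of an epoch (remaining edges, candidate matchings,
estimated best matching), and the round in which the exploration phase starts. -/
abbrev EpochState (n K : ℕ) : Type :=
  List (Fin (n + 1) × Fin K) × List (Fin (n + 1) → Fin K) × (Fin (n + 1) → Fin K) × ℕ

/-- The state of an epoch which begins in round `s` with the edges `E` and the weights `w`. -/
noncomputable def epochState (tie : TieBreak K) (T c p : ℕ) (E : List (Fin (n + 1) × Fin K))
    (w : Fin (n + 1) → Fin K → ℝ) (s : ℕ) : EpochState n K :=
  let d := decision tie T c p E w
  (d.1, d.2.1, d.2.2, s + commRounds n K d.2.1.length)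

/-- The state of epoch `p + 1` if epoch `p` has the state `x`. -/
noncomputable def nextState (tie : TieBreak K) (T c p : ℕ) (x : EpochState n K)
    (y : Fin (n + 1) → Fin K → ℕ → ℝ) : EpochState n K :=
  epochState tie T c (p + 1) x.1 (newWeights c p x.2.1 y x.2.2.2)
    (x.2.2.2 + x.2.1.length * 2 ^ p ^ c + n * (K * meanBits c p))

/-- The state of epoch `q + 1` when no epoch is the last one. -/
noncomputable def epochStateAt (tie : TieBreak K) (T c : ℕ) (y : Fin (n + 1) → Fin K → ℕ → ℝ) :
    ℕ → EpochState n K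
  | 0 => epochState tie T c 1 (allEdges n K) (fun _ _ => 0) 0
  | q + 1 => nextState tie T c (q + 1) (epochStateAt tie T c y q) y

/-- Bound for the loss while the leader announces her decisions in epoch `p`. -/
noncomputable def announceCost (n K T c p : ℕ) : ℝ :=
  if p = 1 ∨ 2 * 2 ^ (p - 1) ^ c ≤ T then
    commRounds n K ((n + 1) * K) *
      (2 + min ((n + 1 : ℕ) : ℝ) (4 * (n + 1 : ℕ) * epsRadius (n + 1) K T c (p - 2)))
  else 0

/-- Bound for the loss caused in epoch `p` by an edge whose smallest positive gap is `D`, if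
there is one (`S`). -/
noncomputable def edgeCost (n K T c p : ℕ) (S : Prop) [Decidable S] (D : ℝ) : ℝ :=
  if S ∧ D ≤ 8 * (n + 1 : ℕ) * epsRadius (n + 1) K T c (p - 1) then
    8 * (n + 1 : ℕ) * epsRadius (n + 1) K T c (p - 1) else 0

/-- Bound for the loss while the followers report their estimates in epoch `p`. -/
noncomputable def reportCost (n K T c p : ℕ) : ℝ :=
  if 2 * 2 ^ p ^ c ≤ T then ((n * (K * meanBits c p) : ℕ) : ℝ) *
    (2 + 4 * (n + 1 : ℕ) * epsRadius (n + 1) K T c (p - 1)) else 0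

theorem announceCost_nonneg (n K T c p : ℕ) : 0 ≤ announceCost n K T c p := by
  unfold announceCost
  have := epsRadius_nonneg (n + 1) K T c (p - 2)
  split_ifs <;> positivity

theorem edgeCost_nonneg (n K T c p : ℕ) (S : Prop) [Decidable S] (D : ℝ) :
    0 ≤ edgeCost n K T c p S D := by
  unfold edgeCost
  have := epsRadius_nonneg (n + 1) K T c (p - 1)
  split_ifs <;> positivity

theorem reportCost_nonneg (n K T c p : ℕ) : 0 ≤ reportCost n K T c p := by
  unfold reportCost
  have := epsRadius_nonneg (n + 1) K T c (p - 1)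
  split_ifs <;> positivity

/-- Bound for the loss in epoch `p`. -/
noncomputable def epochCost (n K T c p : ℕ) (S : Fin (n + 1) → Fin K → Prop) [∀ m k, Decidable (S m k)]
    (D : Fin (n + 1) → Fin K → ℝ) : ℝ :=
  announceCost n K T c p +
    (2 ^ p ^ c * ∑ e : Fin (n + 1) × Fin K, edgeCost n K T c p (S e.1 e.2) (D e.1 e.2) +
      reportCost n K T c p)

theorem epochCost_nonneg (n K T c p : ℕ) (S : Fin (n + 1) → Fin K → Prop)
    [∀ m k, Decidable (S m k)] (D : Fin (n + 1) → Fin K → ℝ) : 0 ≤ epochCost n K T c p S D := by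
  unfold epochCost
  have h1 := announceCost_nonneg n K T c p
  have h2 := reportCost_nonneg n K T c p
  have h3 : 0 ≤ ∑ e : Fin (n + 1) × Fin K, edgeCost n K T c p (S e.1 e.2) (D e.1 e.2) :=
    Finset.sum_nonneg fun e _ => edgeCost_nonneg _ _ _ _ _ _ _
  positivity

theorem commRounds_mono (n K : ℕ) : Monotone (commRounds n K) := by
  intro a b h
  unfold commRounds
  gcongr

/-- Induction over the epochs, following the process `epochStateAt`: in round `s`, exactly `q`
epochs are complete. Each takes at least one round, whence `q ≤ s`. The hypothesis `hq` records that
a completed epoch explored at least two candidates within the horizon; it limits the number of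
epochs that are charged. `D` bounds from below all positive gaps of matchings through an edge. -/
theorem totalLoss_loop_le {μ : Fin (n + 1) → Fin K → ℝ} (hμ0 : ∀ m k, 0 ≤ μ m k)
    (hμ1 : ∀ m k, μ m k ≤ 1) {tie : TieBreak K} {T c : ℕ}
    {y : Fin (n + 1) → Fin K → ℕ → ℝ} (hy : ∀ m k t, y m k t ∈ Set.Icc (0 : ℝ) 1)
    (hL : 1 ≤ Real.log (2 / (1 / (((n + 1 : ℕ) : ℝ) ^ 2 * K * (T : ℝ) ^ 2))))
    (hacc : ∀ q < T, Accurate μ T c (q + 1) (epochStateAt tie T c y q).2.1 y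
      (epochStateAt tie T c y q).2.2.2)
    {π : Fin (n + 1) → Fin K} (hπ : Function.Injective π) (hopt : utility μ π = maxUtility μ)
    {S : Fin (n + 1) → Fin K → Prop} [∀ m k, Decidable (S m k)] {D : Fin (n + 1) → Fin K → ℝ}
    (hSD : ∀ π', Function.Injective π' → 0 < gap μ π' → ∀ m, S m (π' m) ∧ D m (π' m) ≤ gap μ π')
    (fuel q s R : ℕ) {E : List (Fin (n + 1) × Fin K)} {w : Fin (n + 1) → Fin K → ℝ}
    (hw : GoodWeights μ π (2 * epsRadius (n + 1) K T c q) E w) {κ : Fin (n + 1) → Fin K}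
    (hκ : Function.Injective κ)
    (hgκ : gap μ κ ≤ 4 * (n + 1 : ℕ) * epsRadius (n + 1) K T c (q - 1))
    (hst : epochState tie T c (q + 1) E w s = epochStateAt tie T c y q) (hfuel : fuel + q = T)
    (hqs : q ≤ s) (hsR : s + R ≤ T) (hq : q = 0 ∨ 2 * 2 ^ q ^ c ≤ T) :
    totalLoss μ (loopProgs tie T c fuel (q + 1) E w κ) (shift s y) R ≤
      ∑ p ∈ Finset.range fuel, epochCost n K T c (q + 1 + p) S D := by
  induction fuel generalizing q s R E w κ with
  | zero =>
    -- Here `q = T ≤ s`, so no round is left.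
    obtain rfl : R = 0 := by omega
    simp [totalLoss]
  | succ fuel ih =>
    rw [Finset.sum_range_succ']
    obtain ⟨E', C, π₁, hd⟩ : ∃ E' C π₁, decision tie T c (q + 1) E w = (E', C, π₁) :=
      ⟨_, _, _, rfl⟩
    have hst' : epochStateAt tie T c y q = (E', C, π₁, s + commRounds n K C.length) := by
      rw [← hst, epochState, hd]
    have hw' : GoodWeights μ π (2 * epsRadius (n + 1) K T c (q + 1 - 1)) E w := hw
    have hbest := decision_best hπ hopt hw' hd
    have hsurv := decision_optimal_survives hπ hopt hw' hd
    have hlen := length_candidates_le hw.nodup hd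
    have hC : ∀ π' ∈ C, Function.Injective π' := fun π' h => candidate_injective hπ hd h
    have hthrough : ∀ m, ∃ π' ∈ C, π' m = π m := fun m =>
      ⟨_, (mem_candidates hd _).2 ⟨_, hsurv m, rfl⟩, (edgeMatching_spec tie w hπ (m, π m)).2.1⟩
    have hannounce : commRounds n K C.length * (2 + gap μ κ) ≤ announceCost n K T c (q + 1) := by
      unfold announceCost
      rw [if_pos (by simpa using hq)]
      have h1 : (commRounds n K C.length : ℝ) ≤ commRounds n K ((n + 1) * K) :=
        Nat.cast_le.2 (commRounds_mono n K hlen.2)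
      have h2 : gap μ κ ≤ min ((n + 1 : ℕ) : ℝ)
          (4 * (n + 1 : ℕ) * epsRadius (n + 1) K T c (q + 1 - 2)) :=
        le_min (gap_le_card hμ0 hμ1 κ) hgκ
      have h3 := gap_nonneg μ hκ
      gcongr
    have hsum : (C.map (gap μ)).sum ≤
        ∑ e : Fin (n + 1) × Fin K, edgeCost n K T c (q + 1) (S e.1 e.2) (D e.1 e.2) := by
      refine sum_gap_candidates_le hπ hw.nodup hd (fun e => edgeCost_nonneg _ _ _ _ _ _ _)
        fun e he => ?_
      have h1 := gap_edgeMatching_le hπ hopt hw' hd he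
      obtain ⟨h2, h3, -⟩ := edgeMatching_spec tie w hπ e
      -- An optimal edge matching costs nothing. A suboptimal one goes through `e`, so `D` is at
      -- most its gap and the indicator in `edgeCost` is active.
      rcases (gap_nonneg μ h2).eq_or_lt with h4 | h4
      · rw [← h4]
        exact edgeCost_nonneg _ _ _ _ _ _ _
      · have h5 := hSD _ h2 h4 e.1
        rw [h3] at h5
        unfold edgeCost
        rw [if_pos ⟨h5.1, h5.2.trans h1⟩]
        exact h1
    have hrest0 : 0 ≤ ∑ p ∈ Finset.range fuel, epochCost n K T c (q + 1 + (p + 1)) S D :=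
      Finset.sum_nonneg fun p _ => epochCost_nonneg _ _ _ _ _ _ _
    have hsum0 : 0 ≤ (2 : ℝ) ^ (q + 1) ^ c *
        ∑ e : Fin (n + 1) × Fin K, edgeCost n K T c (q + 1) (S e.1 e.2) (D e.1 e.2) :=
      mul_nonneg (by positivity) (Finset.sum_nonneg fun e _ => edgeCost_nonneg _ _ _ _ _ _ _)
    have hrep0 := reportCost_nonneg n K T c (q + 1)
    simp only [add_zero]
    unfold epochCost at hrest0 ⊢
    by_cases hC1 : C.length = 1
    · obtain ⟨π', rfl⟩ := List.length_eq_one_iff.1 hC1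
      -- All edges of `π` survive and are covered by candidates, so a single candidate must be `π`.
      obtain rfl : π' = π := by
        funext m
        obtain ⟨π'', h, h'⟩ := hthrough m
        rw [List.mem_singleton] at h
        rw [← h', h]
      have h1 := totalLoss_last_epoch hμ0 hμ1 tie T c fuel (q + 1) E w hκ (shift s y) R hd hπ
        (by simp [gap, hopt])
      simp only [List.length_singleton] at hannounce
      linarith
    · have hC2 : 2 ≤ C.length := by
        obtain ⟨π'', h, -⟩ := hthrough 0
        have := List.length_pos_of_mem h
        omega
      have hpow : 2 * 2 ^ (q + 1) ^ c ≤ C.length * 2 ^ (q + 1) ^ c := Nat.mul_le_mul_right _ hC2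
      have h1 := totalLoss_epoch (R := R) hμ0 hμ1 tie T c fuel (q + 1) E w hκ y s hd hlen.2 hC1 hC
        hbest.1 hrest0 hrep0 (fun R' hR' => by
          unfold reportCost
          rw [if_pos (by omega)]
          have := hbest.2
          gcongr) (fun R' hR' => by
          have hpos : 1 ≤ 2 ^ (q + 1) ^ c := Nat.one_le_two_pow
          have h2 := hacc q (by omega)
          rw [hst'] at h2
          have h3 := ih (q + 1) (s + commRounds n K C.length + C.length * 2 ^ (q + 1) ^ c +
            n * (K * meanBits c (q + 1))) R' (E := E')
            (w := newWeights c (q + 1) C y (s + commRounds n K C.length)) (κ := π₁)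
            (h2.goodWeights hμ0 hy hL hthrough hsurv hlen.1) hbest.1 hbest.2
            (by
              rw [epochStateAt, hst']
              rfl) (by omega) (by omega) (by omega) (Or.inr (by omega))
          refine h3.trans (le_of_eq (Finset.sum_congr rfl fun x _ => ?_))
          rw [show q + 1 + 1 + x = q + 1 + (x + 1) by ring]
          rfl)
      have h2 : (2 : ℝ) ^ (q + 1) ^ c * (C.map (gap μ)).sum ≤ 2 ^ (q + 1) ^ c *
        ∑ e : Fin (n + 1) × Fin K, edgeCost n K T c (q + 1) (S e.1 e.2) (D e.1 e.2) := by gcongr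
      linarith

theorem rankedProgs_eq_loopProgs (tie : TieBreak K) (T c : ℕ) :
    rankedProgs tie T c n = loopProgs tie T c T 1 (allEdges n K) (fun _ _ => 0)
      (fun i : Fin (n + 1) => Fin.ofNat K i) := by
  funext m
  refine Fin.cases ?_ (fun j => ?_) m
  · rfl
  · simp only [rankedProgs, loopProgs, Fin.cases_succ]
    rfl

/-- The loss after the initialization if all estimates are accurate. -/
theorem totalLoss_ranked_le (hnK : n + 1 ≤ K) {μ : Fin (n + 1) → Fin K → ℝ}
    (hμ0 : ∀ m k, 0 ≤ μ m k)
    (hμ1 : ∀ m k, μ m k ≤ 1) {tie : TieBreak K} {T c : ℕ} (hc : c ≠ 0)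
    {y : Fin (n + 1) → Fin K → ℕ → ℝ} (hy : ∀ m k t, y m k t ∈ Set.Icc (0 : ℝ) 1)
    (hL : 1 ≤ Real.log (2 / (1 / (((n + 1 : ℕ) : ℝ) ^ 2 * K * (T : ℝ) ^ 2))))
    (hacc : ∀ q < T, Accurate μ T c (q + 1) (epochStateAt tie T c y q).2.1 y
      (epochStateAt tie T c y q).2.2.2)
    {S : Fin (n + 1) → Fin K → Prop} [∀ m k, Decidable (S m k)] {D : Fin (n + 1) → Fin K → ℝ}
    (hSD : ∀ π', Function.Injective π' → 0 < gap μ π' → ∀ m, S m (π' m) ∧ D m (π' m) ≤ gap μ π')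
    (R : ℕ) (hR : R ≤ T) :
    totalLoss μ (rankedProgs tie T c n) y R ≤
      ∑ p ∈ Finset.range T, epochCost n K T c (p + 1) S D := by
  obtain ⟨π, hπ, hopt⟩ := exists_optimal hnK μ
  -- Because `0 ^ c = 0`, the radius ε_0 is at least 1/2. Hence the initial weights 0 are good for
  -- free, 2ε_0 ≥ 1 being a trivial error bound, and 4Mε_0 ≥ M bounds the gap of the initial
  -- communication arms.
  have hε : 1 / 2 ≤ epsRadius (n + 1) K T c 0 := by
    unfold epsRadius
    apply Real.le_sqrt_of_sq_le
    rw [zero_pow hc]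
    linarith
  have hκ : Function.Injective fun i : Fin (n + 1) => Fin.ofNat K i := by
    intro i j hij
    have := congrArg Fin.val hij
    simp only [Fin.ofNat, Nat.mod_eq_of_lt (i.2.trans_le hnK),
      Nat.mod_eq_of_lt (j.2.trans_le hnK)] at this
    exact Fin.ext this
  have h := totalLoss_loop_le hμ0 hμ1 hy hL hacc hπ hopt hSD T 0 0 R
    (E := allEdges n K) (w := fun _ _ => 0) ⟨fun m k => by linarith [hμ0 m k],
      fun m => by linarith [hμ1 m (π m)], fun m => List.pair_mem_product.2
        ⟨List.mem_finRange _, List.mem_finRange _⟩,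
      (List.nodup_finRange _).product (List.nodup_finRange _)⟩ hκ
    ((gap_le_card hμ0 hμ1 _).trans (by
      have : (0 : ℝ) ≤ (n + 1 : ℕ) := Nat.cast_nonneg _
      simp only [zero_tsub]
      nlinarith)) rfl rfl le_rfl (by omega) (Or.inl rfl)
  rw [shift_zero] at h
  rw [rankedProgs_eq_loopProgs]
  simpa only [zero_add, add_comm 1] using h

end Ideal

/-! ### Elementary estimates for the costs -/

section Horizon

theorem epsRadius_eq (M K T c p : ℕ) : epsRadius M K T c p =
    √(Real.log (2 * (M : ℝ) ^ 2 * K * (T : ℝ) ^ 2)) * (√2)⁻¹ ^ (1 + p ^ c) := by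
  unfold epsRadius
  have h1 : √((2 : ℝ) ^ (1 + p ^ c)) = √2 ^ (1 + p ^ c) := by
    rw [Real.sqrt_eq_iff_mul_self_eq (by positivity) (by positivity), ← mul_pow,
      Real.mul_self_sqrt (by norm_num)]
  rw [Real.sqrt_div' _ (by positivity), h1, inv_pow, div_eq_mul_inv]
  congr 3
  rw [div_div_eq_mul_div, div_one]
  ring

/-- The largest value is ln(3/2), and already the cubic Taylor polynomial of exp at 5/12 exceeds
3/2. -/
theorem log_one_add_le {c : ℕ} (hc : 1 ≤ c) :
    0 < Real.log (1 + 1 / (2 * (c : ℝ))) ∧ Real.log (1 + 1 / (2 * (c : ℝ))) ≤ 5 / 12 := by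
  have hc' : (1 : ℝ) ≤ c := by exact_mod_cast hc
  have h0 : 0 < 1 / (2 * (c : ℝ)) := by positivity
  refine ⟨Real.log_pos (by linarith), ?_⟩
  have h1 : 1 / (2 * (c : ℝ)) ≤ 1 / 2 := one_div_le_one_div_of_le (by norm_num) (by linarith)
  rw [Real.log_le_iff_le_exp (by linarith)]
  have h2 := Real.quadratic_le_exp_of_nonneg (x := 5 / 12) (by norm_num)
  have h3 := Real.sum_le_exp_of_nonneg (x := 5 / 12) (by norm_num) 4
  simp only [Finset.sum_range_succ, Finset.sum_range_zero, Nat.factorial] at h3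
  norm_num at h3
  linarith

theorem le_logb_log_of_minHorizon_le {c T : ℕ} (hT : minHorizon c ≤ T) :
    ((c : ℝ) / Real.log (1 + 1 / (2 * (c : ℝ)))) ^ c ≤ Real.logb 2 (Real.log T) ∧
      1 < (T : ℝ) ∧ 0 < Real.log T := by
  unfold minHorizon at hT
  rw [← div_pow] at hT
  have h0 : (0 : ℝ) < T := (Real.exp_pos _).trans_le hT
  have h1 := (Real.le_log_iff_exp_le h0).2 hT
  have h2 : 0 < Real.log T := lt_of_lt_of_le (by positivity) h1
  refine ⟨?_, ?_, h2⟩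
  · rw [Real.le_logb_iff_rpow_le (by norm_num) h2]
    exact h1
  · by_contra h
    exact absurd (Real.log_nonpos h0.le (not_lt.1 h)) (not_le.2 h2)

/-- The base of the power in T₀(c) is at least 12/5, and (12/5)^c = (6/5)^c · 2^c. The purpose is to
absorb the factor `2 ^ c` of the reporting costs into lg(ln T). -/
theorem two_pow_le_logb_log {c T : ℕ} (hc : 1 ≤ c) (hT : minHorizon c ≤ T) :
    6 / 5 * (2 : ℝ) ^ c ≤ Real.logb 2 (Real.log T) := by
  refine le_trans ?_ (le_logb_log_of_minHorizon_le hT).1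
  have hc' : (1 : ℝ) ≤ c := by exact_mod_cast hc
  obtain ⟨h0, h1⟩ := log_one_add_le hc
  have h2 : (12 / 5 : ℝ) ≤ c / Real.log (1 + 1 / (2 * (c : ℝ))) := by
    rw [le_div_iff₀ h0]
    linarith
  calc 6 / 5 * (2 : ℝ) ^ c ≤ (6 / 5) ^ c * 2 ^ c := by
        gcongr
        exact le_self_pow₀ (by norm_num) (by omega)
    _ = (12 / 5) ^ c := by rw [← mul_pow]; norm_num
    _ ≤ _ := by gcongr

/-- lg(ln T) ≥ 12/5 > 9/4, and the fourth power of 2^(9/4) is 512, more than that of 9/2. -/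
theorem log_horizon_ge {c T : ℕ} (hc : 1 ≤ c) (hT : minHorizon c ≤ T) :
    9 / 2 ≤ Real.log T := by
  have h1 := two_pow_le_logb_log hc hT
  have h2 := (le_logb_log_of_minHorizon_le hT).2.2
  have h3 : (2 : ℝ) ≤ 2 ^ c := le_self_pow₀ (by norm_num) (by omega)
  rw [Real.le_logb_iff_rpow_le (by norm_num) h2] at h1
  refine le_trans ?_ h1
  have h4 : ((2 : ℝ) ^ ((9 : ℝ) / 4)) ≤ 2 ^ (6 / 5 * (2 : ℝ) ^ c) :=
    Real.rpow_le_rpow_of_exponent_le (by norm_num) (by linarith)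
  refine le_trans ?_ h4
  have h5 : (((2 : ℝ) ^ ((9 : ℝ) / 4))) ^ 4 = 512 := by
    rw [← Real.rpow_natCast, ← Real.rpow_mul (by norm_num)]
    norm_num
  by_contra h
  have h6 := pow_lt_pow_left₀ (not_le.1 h) (by positivity) (n := 4) (by norm_num)
  rw [h5] at h6
  norm_num at h6

theorem log_confidence_ge {M K T : ℕ} (hM : 1 ≤ M) (hK : 1 ≤ K) (hT : 1 < (T : ℝ)) :
    2 * Real.log T ≤ Real.log (2 * (M : ℝ) ^ 2 * K * (T : ℝ) ^ 2) := by
  have hM' : (1 : ℝ) ≤ M := by exact_mod_cast hM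
  have hK' : (1 : ℝ) ≤ K := by exact_mod_cast hK
  rw [show 2 * Real.log T = Real.log ((T : ℝ) ^ 2) by rw [Real.log_pow]; norm_num]
  apply Real.log_le_log (by positivity)
  have h1 : 1 ≤ 2 * (M : ℝ) ^ 2 * K := by nlinarith [mul_nonneg (sq_nonneg (M : ℝ)) (sub_nonneg.2 hK')]
  have h2 : 0 ≤ (T : ℝ) ^ 2 := by positivity
  nlinarith

end Horizon

/-! ### Growth of the powers and geometric sums -/

section Powers

theorem inv_sqrt_two_bounds : 0 < (√2)⁻¹ ∧ (√2)⁻¹ < 1 ∧ (√2)⁻¹ = √2 / 2 := by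
  have h : (√2 : ℝ) * √2 = 2 := Real.mul_self_sqrt (by norm_num)
  have h0 : 0 < √2 := by positivity
  refine ⟨by positivity, inv_lt_one_of_one_lt₀ ?_, ?_⟩
  · nlinarith
  · field_simp
    linarith

theorem sqrt_two_bounds : 1.414 < √2 ∧ √2 < 1.4143 := by
  constructor
  · rw [Real.lt_sqrt (by norm_num)]; norm_num
  · rw [Real.sqrt_lt' (by norm_num)]; norm_num

/-- Increments of powers increase. -/
theorem pow_sub_pow_le_add {a b h : ℝ} (ha : 0 ≤ a) (hab : a ≤ b) (hh : 0 ≤ h) (c : ℕ) :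
    b ^ c - a ^ c ≤ (b + h) ^ c - (a + h) ^ c := by
  rw [← geom_sum₂_mul, ← geom_sum₂_mul, add_sub_add_right_eq_sub]
  have hb : 0 ≤ b := ha.trans hab
  refine mul_le_mul_of_nonneg_right (Finset.sum_le_sum fun i _ => ?_) (sub_nonneg.2 hab)
  gcongr <;> linarith

/-- Convexity gives 2(q+1)^c ≤ (q+2)^c + q^c, and strict growth gives (q+1)^c + 1 ≤ (q+2)^c. -/
theorem two_mul_pow_succ_le {c : ℕ} (hc : 1 ≤ c) (q : ℕ) :
    3 * (q + 1) ^ c + 1 ≤ 2 * (q + 2) ^ c + q ^ c := by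
  have h1 := pow_sub_pow_le_add (a := q) (b := q + 1) (h := 1) (by positivity) (by simp)
    zero_le_one c
  have h2 : (2 * (q + 1) ^ c : ℝ) ≤ (q + 2) ^ c + q ^ c := by
    rw [show (q : ℝ) + 2 = q + 1 + 1 by ring]
    linarith
  have h3 : 2 * (q + 1) ^ c ≤ (q + 2) ^ c + q ^ c := by exact_mod_cast h2
  have h4 : (q + 1) ^ c < (q + 2) ^ c := Nat.pow_lt_pow_left (by omega) (by omega)
  omega

/-- A sum of terms which grow geometrically. -/
theorem sum_range_ite_le_of_geometric {f : ℕ → ℝ} {r : ℝ} (hr0 : 0 < r) (hr1 : r < 1)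
    (hf0 : ∀ q, 0 ≤ f q) (hf : ∀ q, f q ≤ r * f (q + 1)) (q' : ℕ → Prop) [DecidablePred q']
    (N : ℕ) {B : ℝ} (hB0 : 0 ≤ B) (hB : ∀ q < N, q' q → f q ≤ B) :
    ∑ q ∈ Finset.range N, (if q' q then f q else 0) ≤ B / (1 - r) := by
  have hr : 0 < 1 - r := by linarith
  have hmono : Monotone f := monotone_nat_of_le_succ fun q =>
    (hf q).trans (mul_le_of_le_one_left (hf0 _) hr1.le)
  induction N generalizing B with
  | zero =>
    simp only [Finset.range_zero, Finset.sum_empty]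
    positivity
  | succ N ih =>
    rw [Finset.sum_range_succ]
    by_cases h : q' N
    · rw [if_pos h]
      -- By monotonicity all earlier terms are at most `r * f N`; the sum is a geometric series read
      -- backwards from its last admissible term.
      have h1 := ih (B := r * f N) (mul_nonneg hr0.le (hf0 N)) fun q hq _ =>
        (hf q).trans (mul_le_mul_of_nonneg_left (hmono hq) hr0.le)
      have h2 := hB N (Nat.lt_succ_self N) h
      calc _ ≤ r * f N / (1 - r) + f N := by gcongr
        _ = f N / (1 - r) := by field_simp; ring
        _ ≤ _ := by gcongr
    · rw [if_neg h, add_zero]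
      exact ih hB0 fun q hq => hB q (hq.trans (Nat.lt_succ_self N))

/-- Compared as powers of √2, the claim is 2(q+1)^c + (q+1)^c + 1 ≤ 2(q+2)^c + q^c. -/
theorem explore_term_le {c : ℕ} (hc : 1 ≤ c) (q : ℕ) :
    (2 : ℝ) ^ (q + 1) ^ c * (√2)⁻¹ ^ q ^ c ≤
      (√2)⁻¹ * ((2 : ℝ) ^ (q + 1 + 1) ^ c * (√2)⁻¹ ^ (q + 1) ^ c) := by
  have h2 : (2 : ℝ) = √2 ^ 2 := (Real.sq_sqrt (by norm_num)).symm
  have h1 : (1 : ℝ) ≤ √2 := by linarith [sqrt_two_bounds.1]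
  have h0 : 0 < √2 := by positivity
  have h3 := pow_le_pow_right₀ h1 (two_mul_pow_succ_le hc q)
  have h4 : ∀ k, (2 : ℝ) ^ k = √2 ^ (2 * k) := fun k => by
    rw [pow_mul, Real.sq_sqrt (by norm_num)]
  rw [h4, h4, inv_pow, inv_pow, ← div_eq_mul_inv, ← div_eq_mul_inv, ← div_eq_inv_mul, div_div,
    div_le_div_iff₀ (by positivity) (by positivity), ← pow_succ, ← pow_add, ← pow_add]
  refine le_trans (le_of_eq ?_) (h3.trans (le_of_eq ?_)) <;> congr 1
  ring

end Powers

/-! ### The loss in the exploration phases -/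

section Explore

/-- (1 + 1/v)^c ≤ exp(c/v), and the condition on `v`, which is the origin of T₀(c), says that c/v ≤
ln(1 + 1/(2c)). -/
theorem one_add_inv_pow_le {c : ℕ} (hc : 1 ≤ c) {v : ℝ}
    (hv : (c : ℝ) / Real.log (1 + 1 / (2 * (c : ℝ))) ≤ v) :
    (1 + 1 / v) ^ c ≤ 1 + 1 / (2 * (c : ℝ)) := by
  have hc' : (1 : ℝ) ≤ c := by exact_mod_cast hc
  obtain ⟨h0, -⟩ := log_one_add_le hc
  have hv0 : 0 < v := lt_of_lt_of_le (by positivity) hv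
  calc (1 + 1 / v) ^ c ≤ (Real.exp (1 / v)) ^ c := by
        gcongr
        rw [add_comm]
        exact Real.add_one_le_exp _
    _ = Real.exp (c * (1 / v)) := (Real.exp_nat_mul _ _).symm
    _ ≤ Real.exp (Real.log (1 + 1 / (2 * (c : ℝ)))) := by
        apply Real.exp_le_exp.2
        rw [mul_one_div, div_le_iff₀ hv0]
        rwa [div_le_iff₀ h0, mul_comm] at hv
    _ = _ := Real.exp_log (by positivity)

/-- Write X = 2^(v^c), so that q ≤ v. The exponent is ((q+1)^c - q^c) + q^c/2. Increments of powers
increase, so it is at most ((v+1)^c - v^c) + v^c/2, and (v+1)^c ≤ (1 + 1/(2c)) v^c leaves (1/2 +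
1/(2c)) v^c. -/
theorem explore_term_le_rpow {c : ℕ} (hc : 1 ≤ c) {X : ℝ} (hX0 : 0 < X)
    (hX : ((c : ℝ) / Real.log (1 + 1 / (2 * (c : ℝ)))) ^ c ≤ Real.logb 2 X) {q : ℕ}
    (hq : (2 : ℝ) ^ q ^ c ≤ X) :
    (2 : ℝ) ^ (q + 1) ^ c * (√2)⁻¹ ^ q ^ c ≤ X ^ (1 / 2 + 1 / (2 * (c : ℝ))) := by
  have hc' : (1 : ℝ) ≤ c := by exact_mod_cast hc
  obtain ⟨h0, -⟩ := log_one_add_le hc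
  set v₀ := (c : ℝ) / Real.log (1 + 1 / (2 * (c : ℝ))) with hv₀
  have hv₀0 : 0 < v₀ := by positivity
  set l := Real.logb 2 X
  have hl0 : 0 ≤ l := le_trans (by positivity) hX
  set v := l ^ (1 / (c : ℝ)) with hv
  have hvc : v ^ c = l := by
    rw [hv, one_div, Real.rpow_inv_natCast_pow hl0 (by omega)]
  have hv0 : 0 ≤ v := by positivity
  have hvv : v₀ ≤ v := by
    rw [← hvc] at hX
    exact le_of_pow_le_pow_left₀ (by omega) hv0 hX
  have hvpos : 0 < v := hv₀0.trans_le hvv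
  have hqv : (q : ℝ) ≤ v := by
    refine le_of_pow_le_pow_left₀ (n := c) (by omega) hv0 ?_
    rw [hvc, Real.le_logb_iff_rpow_le (by norm_num) hX0]
    refine le_trans (le_of_eq ?_) hq
    rw [← Nat.cast_pow, Real.rpow_natCast]
  have h1 := pow_sub_pow_le_add (a := q) (b := v) (h := 1) (by positivity) hqv zero_le_one c
  have h2 := one_add_inv_pow_le hc hvv
  have h3 : (v + 1) ^ c ≤ l * (1 + 1 / (2 * (c : ℝ))) := by
    rw [show v + 1 = v * (1 + 1 / v) by field_simp, mul_pow, hvc]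
    gcongr
  have h4 : (q : ℝ) ^ c ≤ v ^ c := by gcongr
  have h5 : (q + 1 : ℝ) ^ c - (q : ℝ) ^ c / 2 ≤ l * (1 / 2 + 1 / (2 * (c : ℝ))) := by
    rw [hvc] at h1 h4
    linarith
  have h6 : (2 : ℝ) ^ (q + 1) ^ c * (√2)⁻¹ ^ q ^ c =
      2 ^ ((q + 1 : ℝ) ^ c - (q : ℝ) ^ c / 2) := by
    rw [Real.rpow_sub (by norm_num), div_eq_mul_inv]
    congr 1
    · rw [← Real.rpow_natCast]
      push_cast
      rfl
    · rw [inv_pow, Real.sqrt_eq_rpow, ← Real.rpow_natCast, ← Real.rpow_mul (by norm_num)]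
      push_cast
      congr 2
      ring
  rw [h6]
  calc (2 : ℝ) ^ ((q + 1 : ℝ) ^ c - (q : ℝ) ^ c / 2) ≤ 2 ^ (l * (1 / 2 + 1 / (2 * (c : ℝ)))) :=
        Real.rpow_le_rpow_of_exponent_le (by norm_num) h5
    _ = _ := by rw [Real.rpow_mul (by norm_num), Real.rpow_logb (by norm_num) (by norm_num) hX0]

/-- The loss which an edge causes in the exploration phases. -/
theorem sum_edgeCost_le {n K T c : ℕ} (hK : 1 ≤ K) (hc : 1 ≤ c) (hT : minHorizon c ≤ T) {S : Prop}
    [Decidable S] {D : ℝ} (hD0 : S → 0 < D) (hD1 : S → D ≤ (n + 1 : ℕ)) :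
    ∑ q ∈ Finset.range T, 2 ^ (q + 1) ^ c * edgeCost n K T c (q + 1) S D ≤
      (2 * √2 - 1) / (√2 - 1) * if S then
        (32 * ((n + 1 : ℕ) : ℝ) ^ 2 *
          Real.log (2 * ((n + 1 : ℕ) : ℝ) ^ 2 * K * (T : ℝ) ^ 2) / D) ^ (1 + 1 / (c : ℝ))
        else 0 := by
  by_cases hS : S
  swap
  · simp [edgeCost, hS]
  have hD0 := hD0 hS
  have hD1 := hD1 hS
  obtain ⟨hT1, hT2, hT3⟩ := le_logb_log_of_minHorizon_le hT
  have hL2 := log_confidence_ge (M := n + 1) (by omega) hK hT2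
  have hlog := log_horizon_ge hc hT
  have hM : (1 : ℝ) ≤ (n + 1 : ℕ) := by simp
  have hc' : (1 : ℝ) ≤ c := by exact_mod_cast hc
  simp only [edgeCost, hS, true_and, if_true, epsRadius_eq, Nat.add_sub_cancel]
  set M : ℝ := ((n + 1 : ℕ) : ℝ)
  set L := Real.log (2 * M ^ 2 * K * (T : ℝ) ^ 2)
  have hL0 : 0 < L := by linarith
  -- `X` is chosen so that 8Mε_q = D √X / √2^(q^c); the edge is in play exactly while 2^(q^c) ≤ X.
  set X := 32 * M ^ 2 * L / D ^ 2 with hXdef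
  have hX0 : 0 < X := by positivity
  -- Because `D ≤ M`, this gives X ≥ 32 L ≥ ln T, and the lower bound for lg(ln T) passes on to lg
  -- X.
  have hXT : Real.log T ≤ X := by
    rw [hXdef, le_div_iff₀ (by positivity)]
    have : D ^ 2 ≤ M ^ 2 := by gcongr
    nlinarith [mul_nonneg hT3.le (sub_nonneg.2 this), sq_nonneg M, mul_nonneg (sq_nonneg M) (sub_nonneg.2 hL2)]
  have hXv := hT1.trans (Real.logb_le_logb_of_le (by norm_num) hT3 hXT)
  have hr := inv_sqrt_two_bounds
  have hs := sqrt_two_bounds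
  have hsq : √2 * √2 = (2 : ℝ) := Real.mul_self_sqrt (by norm_num)
  have hrad : 8 * M * (√L * (√2)⁻¹) = D * √X := by
    rw [hXdef, Real.sqrt_div' _ (by positivity), Real.sqrt_sq hD0.le, mul_div_cancel₀ _ hD0.ne',
      Real.sqrt_mul' _ hL0.le, Real.sqrt_mul' _ (by positivity), Real.sqrt_sq (by positivity),
      show (32 : ℝ) = 4 ^ 2 * 2 by norm_num, Real.sqrt_mul' _ (by norm_num),
      Real.sqrt_sq (by norm_num), hr.2.2]
    ring
  have hcond : ∀ q : ℕ, 8 * M * (√L * (√2)⁻¹ ^ (1 + q ^ c)) = D * √X * (√2)⁻¹ ^ q ^ c := by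
    intro q
    rw [← hrad, pow_add, pow_one]
    ring
  have hcond' : ∀ q : ℕ, D ≤ D * √X * (√2)⁻¹ ^ q ^ c → (2 : ℝ) ^ q ^ c ≤ X := by
    intro q h
    have h1 : 1 ≤ √X * (√2)⁻¹ ^ q ^ c := by
      rw [mul_assoc] at h
      exact (le_mul_iff_one_le_right hD0).1 h
    rw [inv_pow, ← div_eq_mul_inv, one_le_div (by positivity)] at h1
    have h2 := pow_le_pow_left₀ (by positivity) h1 2
    rwa [Real.sq_sqrt hX0.le, ← pow_mul, mul_comm, pow_mul, Real.sq_sqrt (by norm_num)] at h2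
  simp only [hcond]
  have hsum := sum_range_ite_le_of_geometric (f := fun q => (2 : ℝ) ^ (q + 1) ^ c *
      (√2)⁻¹ ^ q ^ c) hr.1 hr.2.1 (fun q => by positivity) (explore_term_le hc)
    (fun q => D ≤ D * √X * (√2)⁻¹ ^ q ^ c) T (B := X ^ (1 / 2 + 1 / (2 * (c : ℝ))))
    (by positivity) fun q _ hq => explore_term_le_rpow hc hX0 hXv (hcond' q hq)
  have hpow : D * √X * X ^ (1 / 2 + 1 / (2 * (c : ℝ))) ≤
      (32 * M ^ 2 * L / D) ^ (1 + 1 / (c : ℝ)) := by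
    set A := 32 * M ^ 2 * L / D with hA
    have hA0 : 0 < A := by positivity
    have hXA : X = A / D := by
      rw [hXdef, hA]
      field_simp
    -- X = A/D, and A D = 32 M² L ≥ 1.
    have hXA2 : X ≤ A ^ 2 := by
      rw [hXA, div_le_iff₀ hD0, sq, mul_assoc]
      refine le_mul_of_one_le_right hA0.le ?_
      rw [hA, div_mul_cancel₀ _ hD0.ne']
      nlinarith
    calc D * √X * X ^ (1 / 2 + 1 / (2 * (c : ℝ))) = D * X * X ^ (1 / (2 * (c : ℝ))) := by
          rw [Real.rpow_add hX0, ← Real.sqrt_eq_rpow]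
          have := Real.mul_self_sqrt hX0.le
          linear_combination (D * X ^ (1 / (2 * (c : ℝ)))) * this
      _ = A * X ^ (1 / (2 * (c : ℝ))) := by
          rw [hXA, mul_div_cancel₀ _ hD0.ne']
      _ ≤ A * (A ^ 2) ^ (1 / (2 * (c : ℝ))) := by gcongr
      _ = A ^ (1 + 1 / (c : ℝ)) := by
          rw [Real.rpow_add hA0, Real.rpow_one, ← Real.rpow_natCast, ← Real.rpow_mul hA0.le]
          congr 2
          push_cast
          field_simp
  -- The left side is 2 + √2, the right side 3 + √2.
  have hcoef : 1 / (1 - (√2)⁻¹) ≤ (2 * √2 - 1) / (√2 - 1) := by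
    rw [div_le_div_iff₀ (by linarith) (by linarith), hr.2.2]
    nlinarith
  calc ∑ q ∈ Finset.range T, 2 ^ (q + 1) ^ c *
        (if D ≤ D * √X * (√2)⁻¹ ^ q ^ c then D * √X * (√2)⁻¹ ^ q ^ c else 0)
      = D * √X * ∑ q ∈ Finset.range T, (if D ≤ D * √X * (√2)⁻¹ ^ q ^ c then
          (2 : ℝ) ^ (q + 1) ^ c * (√2)⁻¹ ^ q ^ c else 0) := by
        rw [Finset.mul_sum]
        refine Finset.sum_congr rfl fun q _ => ?_
        split_ifs <;> ring
    _ ≤ D * √X * (X ^ (1 / 2 + 1 / (2 * (c : ℝ))) / (1 - (√2)⁻¹)) := by gcongr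
    _ = 1 / (1 - (√2)⁻¹) * (D * √X * X ^ (1 / 2 + 1 / (2 * (c : ℝ)))) := by ring
    _ ≤ (2 * √2 - 1) / (√2 - 1) * (32 * M ^ 2 * L / D) ^ (1 + 1 / (c : ℝ)) := by
        refine mul_le_mul hcoef hpow (by positivity) ?_
        exact div_nonneg (by linarith) (by linarith)

end Explore

/-! ### The loss in the announcements -/

section Announce

/-- If the rounded logarithm is b + 1, then K > 2^b, and 2^(3(b+1)) ≤ K^4 is to be shown. For b ≥ 3
the bound K ≥ 2^b suffices; for smaller b one uses K ≥ 2^b + 1. -/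
theorem three_mul_clog_le {K : ℕ} (hK : 2 ≤ K) :
    (Nat.clog 2 K : ℝ) ≤ 4 / 3 * Real.logb 2 K := by
  have hK0 : (0 : ℝ) < K := by positivity
  obtain ⟨b, hb⟩ : ∃ b, Nat.clog 2 K = b + 1 :=
    Nat.exists_eq_succ_of_ne_zero (Nat.clog_pos (by norm_num) hK).ne'
  have hlt : 2 ^ b < K := by
    by_contra h
    have := Nat.clog_le_of_le_pow (not_lt.1 h)
    omega
  have h : ∀ x : ℝ, (2 : ℝ) ^ x ≤ K → x ≤ Real.logb 2 K := fun x hx =>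
    (Real.le_logb_iff_rpow_le (by norm_num) hK0).2 hx
  rw [hb]
  push_cast
  have key : 3 * (b + 1 : ℝ) ≤ 4 * Real.logb 2 K := by
    have h4 : ∀ k : ℕ, 2 ^ k ≤ K ^ 4 → (k : ℝ) ≤ 4 * Real.logb 2 K := by
      intro k hk
      have h1 : (2 : ℝ) ^ k ≤ (K : ℝ) ^ 4 := by exact_mod_cast hk
      have h2 := Real.logb_le_logb_of_le (b := 2) (by norm_num) (by positivity) h1
      rw [Real.logb_pow, Real.logb_pow, Real.logb_self_eq_one (by norm_num)] at h2
      push_cast at h2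
      linarith
    have h5 := h4 (3 * (b + 1)) ?_
    · push_cast at h5
      exact h5
    · rcases Nat.lt_or_ge b 3 with hb3 | hb3
      · have h6 : (2 ^ b + 1) ^ 4 ≤ K ^ 4 := Nat.pow_le_pow_left hlt 4
        refine le_trans ?_ h6
        interval_cases b <;> norm_num
      · calc 2 ^ (3 * (b + 1)) ≤ 2 ^ (b * 4) := Nat.pow_le_pow_right (by norm_num) (by omega)
          _ = (2 ^ b) ^ 4 := pow_mul _ _ _
          _ ≤ K ^ 4 := Nat.pow_le_pow_left hlt.le 4
  linarith

/-- The factor 3/2 is 9/8 · 4/3. The number of candidates takes at most as many bits as three arms,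
which leaves n(MK + 5) ≤ (9/8)M²K transmitted arms, and 4/3 is the price of rounding lg K up. -/
theorem commRounds_le {n K : ℕ} (hn : 1 ≤ n) (hnK : n + 1 ≤ K) :
    (commRounds n K ((n + 1) * K) : ℝ) ≤
      3 / 2 * ((n + 1 : ℕ) : ℝ) ^ 2 * K * Real.logb 2 K := by
  have hK : 2 ≤ K := by omega
  set b := Nat.clog 2 K with hb
  have hb1 : 1 ≤ b := Nat.clog_pos (by norm_num) hK
  have hKb : K ≤ 2 ^ b := Nat.le_pow_clog (by norm_num) K
  have hsize : sizeBits (n + 1) K ≤ 3 * b := by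
    unfold sizeBits
    rw [Nat.clog_le_iff_le_pow (by norm_num)]
    have h2 : 2 ≤ 2 ^ b := le_self_pow₀ (by norm_num) (by omega)
    calc (n + 1) * K + 1 ≤ 2 ^ b * 2 ^ b + 1 := by gcongr; exact hnK.trans hKb
      _ ≤ 2 ^ b * 2 ^ b * 2 ^ b := by
          generalize 2 ^ b = x at h2
          nlinarith [Nat.mul_le_mul h2 h2, Nat.mul_le_mul (Nat.mul_le_mul h2 h2) h2,
            Nat.mul_le_mul_left (x * x) h2]
      _ = 2 ^ (3 * b) := by rw [← pow_add, ← pow_add]; congr 1; ring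
  have hN : commRounds n K ((n + 1) * K) ≤ n * ((n + 1) * K + 5) * b := by
    unfold commRounds armBits
    calc _ ≤ n * (3 * b) + n * (((n + 1) * K + 2) * b) := by gcongr
      _ = _ := by ring
  have hN2 : 8 * (n * ((n + 1) * K + 5)) ≤ 9 * ((n + 1) ^ 2 * K) := by
    rcases Nat.lt_or_ge K 5 with h5 | h5
    · interval_cases K <;> (have : n ≤ 3 := by omega) <;> interval_cases n <;> norm_num at *
    · nlinarith [Nat.mul_le_mul_left n h5, Nat.mul_le_mul_left (n * n) h5]
  have h1 : (commRounds n K ((n + 1) * K) : ℝ) ≤ n * ((n + 1) * K + 5) * b := by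
    exact_mod_cast hN
  have h2 : (8 * (n * ((n + 1) * K + 5)) : ℝ) ≤ 9 * ((n + 1) ^ 2 * K) := by exact_mod_cast hN2
  have h3 := three_mul_clog_le hK
  rw [← hb] at h3
  have h4 : (0 : ℝ) ≤ b := Nat.cast_nonneg _
  push_cast
  calc (commRounds n K ((n + 1) * K) : ℝ) ≤ n * ((n + 1) * K + 5) * b := h1
    _ ≤ (9 / 8 * ((n + 1) ^ 2 * K)) * b := mul_le_mul_of_nonneg_right (by linarith) h4
    _ ≤ (9 / 8 * ((n + 1) ^ 2 * K)) * (4 / 3 * Real.logb 2 K) := by gcongr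
    _ = _ := by ring

theorem card_filter_le_logb {c T : ℕ} (hc : 1 ≤ c) {Q : ℝ} (hQ : 0 ≤ Q)
    (hQc : Q ^ c = Real.logb 2 T) (hT : 0 < (T : ℝ)) {q : ℕ} (h : 2 * 2 ^ q ^ c ≤ T) :
    (q : ℝ) ≤ Q := by
  refine le_of_pow_le_pow_left₀ (n := c) (by omega) hQ ?_
  rw [hQc, Real.le_logb_iff_rpow_le (by norm_num) hT, ← Nat.cast_pow, Real.rpow_natCast]
  have : 2 ^ q ^ c ≤ T := by omega
  exact_mod_cast this

theorem sum_ite_le_floor {Q : ℝ} (hQ : 0 ≤ Q) (q' : ℕ → Prop) [DecidablePred q']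
    (h : ∀ q, q' q → (q : ℝ) ≤ Q) (N : ℕ) :
    ∑ q ∈ Finset.range N, (if q' q then (1 : ℝ) else 0) ≤ Q + 1 := by
  rw [← Finset.sum_filter, Finset.sum_const, nsmul_one]
  have h1 : (Finset.range N).filter q' ⊆ Finset.range (⌊Q⌋₊ + 1) := by
    intro q hq
    rw [Finset.mem_range, Nat.lt_succ_iff]
    exact Nat.le_floor (h q (Finset.mem_filter.1 hq).2)
  have h2 := Finset.card_le_card h1
  rw [Finset.card_range] at h2
  calc ((Finset.filter q' (Finset.range N)).card : ℝ) ≤ (⌊Q⌋₊ + 1 : ℕ) := Nat.cast_le.2 h2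
    _ ≤ Q + 1 := by
      push_cast
      gcongr
      exact Nat.floor_le hQ

/-- The first eight terms are estimated by `M`. From then on the exponent is at least `8 + q`, and a
geometric tail starting with √2^(-8) = 1/16 remains. -/
theorem sum_min_le {M L : ℝ} (hM : 0 ≤ M) {c : ℕ} (hc : 1 ≤ c) (N : ℕ) :
    ∑ q ∈ Finset.range N, min M (4 * M * (√L * (√2)⁻¹ ^ (1 + (q - 1) ^ c))) ≤
      8 * M + (2 + √2) / 4 * (M * √L) := by
  have hr := inv_sqrt_two_bounds
  have hL : 0 ≤ √L := Real.sqrt_nonneg L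
  have hs := sqrt_two_bounds
  have hsq : √2 * √2 = (2 : ℝ) := Real.mul_self_sqrt (by norm_num)
  have hterm : ∀ q, 0 ≤ min M (4 * M * (√L * (√2)⁻¹ ^ (1 + (q - 1) ^ c))) := fun q =>
    le_min hM (by positivity)
  have h1 : ∑ q ∈ Finset.range N, min M (4 * M * (√L * (√2)⁻¹ ^ (1 + (q - 1) ^ c))) ≤
      ∑ q ∈ Finset.range (8 + N), min M (4 * M * (√L * (√2)⁻¹ ^ (1 + (q - 1) ^ c))) :=
    Finset.sum_le_sum_of_subset_of_nonneg (Finset.range_mono (by omega)) fun q _ _ => hterm q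
  refine h1.trans ?_
  rw [Finset.sum_range_add]
  refine add_le_add ?_ ?_
  · calc _ ≤ ∑ _q ∈ Finset.range 8, M := Finset.sum_le_sum fun q _ => min_le_left _ _
      _ = 8 * M := by simp
  · have h2 : ∀ q, min M (4 * M * (√L * (√2)⁻¹ ^ (1 + (8 + q - 1) ^ c))) ≤
        M * √L / 4 * (√2)⁻¹ ^ q := by
      intro q
      refine (min_le_right _ _).trans ?_
      have h3 : 8 + q ≤ 1 + (8 + q - 1) ^ c := by
        have : 8 + q - 1 ≤ (8 + q - 1) ^ c := le_self_pow₀ (by omega) (by omega)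
        omega
      have h4 := pow_le_pow_of_le_one hr.1.le hr.2.1.le h3
      have h5 : (√2)⁻¹ ^ 8 = (1 / 16 : ℝ) := by
        rw [inv_pow, show (8 : ℕ) = 2 * 4 by norm_num, pow_mul, Real.sq_sqrt (by norm_num)]
        norm_num
      rw [pow_add (√2)⁻¹ 8 q, h5] at h4
      calc 4 * M * (√L * (√2)⁻¹ ^ (1 + (8 + q - 1) ^ c)) ≤
          4 * M * (√L * (1 / 16 * (√2)⁻¹ ^ q)) := by gcongr
        _ = _ := by ring
    calc _ ≤ ∑ q ∈ Finset.range N, M * √L / 4 * (√2)⁻¹ ^ q := Finset.sum_le_sum fun q _ => h2 q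
      _ = M * √L / 4 * ∑ q ∈ Finset.range N, (√2)⁻¹ ^ q := (Finset.mul_sum _ _ _).symm
      _ ≤ M * √L / 4 * ∑' q : ℕ, (√2)⁻¹ ^ q := by
          gcongr
          exact (summable_geometric_of_lt_one hr.1.le hr.2.1).sum_le_tsum _
            fun q _ => by positivity
      _ = M * √L / 4 * (2 + √2) := by
          rw [tsum_geometric_of_lt_one hr.1.le hr.2.1]
          congr 1
          rw [inv_eq_one_div, div_eq_iff (by linarith), hr.2.2]
          linarith
      _ = _ := by ring

/-- The loss which the leader's announcements cause. -/
theorem sum_announceCost_le {n K T c : ℕ} (hnK : n + 1 ≤ K) (hc : 1 ≤ c) (hT : minHorizon c ≤ T) :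
    ∑ q ∈ Finset.range T, announceCost n K T c (q + 1) ≤
      6 * ((n + 1 : ℕ) : ℝ) ^ 2 * K * Real.logb 2 K * Real.logb 2 T ^ (1 / (c : ℝ)) +
      2 * ((n + 1 : ℕ) : ℝ) ^ 3 * K * Real.logb 2 K / (√2 - 1) *
        √(Real.log (2 * ((n + 1 : ℕ) : ℝ) ^ 2 * K * (T : ℝ) ^ 2)) := by
  have hK1 : (1 : ℝ) ≤ K := by
    have : 1 ≤ K := by omega
    exact_mod_cast this
  obtain ⟨hT1, hT2, hT3⟩ := le_logb_log_of_minHorizon_le hT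
  have hlog := log_horizon_ge hc hT
  have hs := sqrt_two_bounds
  have hsq : √2 * √2 = (2 : ℝ) := Real.mul_self_sqrt (by norm_num)
  have hs1 : 0 < √2 - 1 := by linarith
  have hlgK : 0 ≤ Real.logb 2 (K : ℝ) := Real.logb_nonneg (by norm_num) hK1
  have hlgT0 : Real.log T ≤ Real.logb 2 T := by
    unfold Real.logb
    rw [le_div_iff₀ (Real.log_pos (by norm_num))]
    have := Real.log_two_lt_d9
    nlinarith
  have hlgT : 1 ≤ Real.logb 2 (T : ℝ) := by linarith
  set Q := Real.logb 2 (T : ℝ) ^ (1 / (c : ℝ)) with hQ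
  have hQ1 : 1 ≤ Q := Real.one_le_rpow hlgT (by positivity)
  have hQc : Q ^ c = Real.logb 2 T := by
    rw [hQ, one_div, Real.rpow_inv_natCast_pow (by linarith) (by omega)]
  -- A single player sends nothing. Otherwise `M` and `K` are at least 2, which the constants below
  -- require.
  rcases Nat.eq_zero_or_pos n with rfl | hn
  · have h0 : ∀ q, announceCost 0 K T c (q + 1) = 0 := fun q => by
      simp [announceCost, commRounds]
    simp only [h0, Finset.sum_const_zero]
    positivity
  have hN := commRounds_le hn hnK
  have hM2 : (2 : ℝ) ≤ (n + 1 : ℕ) := by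
    have : 2 ≤ n + 1 := by omega
    exact_mod_cast this
  have hK2 : (2 : ℝ) ≤ K := by
    have : 2 ≤ K := by omega
    exact_mod_cast this
  simp only [announceCost, epsRadius_eq, Nat.add_sub_cancel]
  set M : ℝ := ((n + 1 : ℕ) : ℝ)
  set L := Real.log (2 * M ^ 2 * K * (T : ℝ) ^ 2) with hLdef
  -- 2M²K ≥ 2^4 and ln T ≥ 9/2 give L ≥ 4 ln 2 + 9; the value 11.45 is just large enough for `hfac`.
  have hL : 11.45 ≤ L := by
    have h1 : Real.log (2 ^ 4 * (T : ℝ) ^ 2) ≤ L := by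
      refine Real.log_le_log (by positivity) ?_
      have h3 : (2 : ℝ) ^ 4 ≤ 2 * M ^ 2 * K := by nlinarith [mul_le_mul hM2 hM2 (by norm_num) (by linarith)]
      gcongr
    rw [Real.log_mul (by positivity) (by positivity), Real.log_pow, Real.log_pow] at h1
    have := Real.log_two_gt_d9
    push_cast at h1
    linarith
  have hsL : 3.3837 ≤ √L := Real.le_sqrt_of_sq_le (by norm_num at hL ⊢; linarith)
  set N : ℝ := (commRounds n K ((n + 1) * K) : ℝ)
  have hN0 : 0 ≤ N := Nat.cast_nonneg _
  have hterm : ∀ q : ℕ, (if q + 1 = 1 ∨ 2 * 2 ^ q ^ c ≤ T then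
      N * (2 + min M (4 * M * (√L * (√2)⁻¹ ^ (1 + (q + 1 - 2) ^ c)))) else 0) ≤
      N * (2 * (if q + 1 = 1 ∨ 2 * 2 ^ q ^ c ≤ T then (1 : ℝ) else 0) +
        min M (4 * M * (√L * (√2)⁻¹ ^ (1 + (q - 1) ^ c)))) := by
    intro q
    rw [show q + 1 - 2 = q - 1 by omega]
    split_ifs
    · simp
    · have : 0 ≤ min M (4 * M * (√L * (√2)⁻¹ ^ (1 + (q - 1) ^ c))) :=
        le_min (by linarith) (by positivity)
      simp only [mul_zero, zero_add]
      positivity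
  have hcount := sum_ite_le_floor (Q := Q) (by linarith)
    (fun q => q + 1 = 1 ∨ 2 * 2 ^ q ^ c ≤ T) (fun q hq => by
      rcases hq with hq | hq
      · obtain rfl : q = 0 := by omega
        simp only [Nat.cast_zero]
        linarith
      · exact card_filter_le_logb hc (by linarith) hQc (by linarith) hq) T
  have hmin := sum_min_le (M := M) (L := L) (by linarith) hc T
  have htotal : ∑ q ∈ Finset.range T, (if q + 1 = 1 ∨ 2 * 2 ^ q ^ c ≤ T then
      N * (2 + min M (4 * M * (√L * (√2)⁻¹ ^ (1 + (q + 1 - 2) ^ c)))) else 0) ≤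
      N * (2 * (Q + 1) + (8 * M + (2 + √2) / 4 * (M * √L))) := by
    refine (Finset.sum_le_sum fun q _ => hterm q).trans ?_
    rw [← Finset.mul_sum, Finset.sum_add_distrib, ← Finset.mul_sum]
    gcongr
  refine htotal.trans ?_
  -- As Q ≥ 1, 3Q + 3 ≤ 6Q. The 12M from the first eight terms is absorbed by M√L, because (2(√2 +
  -- 1) - 3(2 + √2)/8)√L ≥ 12.
  have hfac : 3 / 2 * (2 * (Q + 1) + (8 * M + (2 + √2) / 4 * (M * √L))) ≤
      6 * Q + 2 * M / (√2 - 1) * √L := by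
    have h1 : 2 * M / (√2 - 1) = 2 * M * (√2 + 1) := by
      rw [div_eq_iff hs1.ne']
      linear_combination (-2 * M) * hsq
    rw [h1]
    nlinarith [mul_nonneg (by linarith : 0 ≤ M) (sub_nonneg.2 hsL),
      mul_nonneg (mul_nonneg (by linarith : 0 ≤ M) (Real.sqrt_nonneg L)) (sub_nonneg.2 hs.1.le)]
  have hbr : 0 ≤ 2 * (Q + 1) + (8 * M + (2 + √2) / 4 * (M * √L)) := by positivity
  calc N * (2 * (Q + 1) + (8 * M + (2 + √2) / 4 * (M * √L)))
      ≤ (3 / 2 * M ^ 2 * K * Real.logb 2 K) *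
        (2 * (Q + 1) + (8 * M + (2 + √2) / 4 * (M * √L))) := by gcongr
    _ = (M ^ 2 * K * Real.logb 2 K) *
        (3 / 2 * (2 * (Q + 1) + (8 * M + (2 + √2) / 4 * (M * √L)))) := by ring
    _ ≤ (M ^ 2 * K * Real.logb 2 K) * (6 * Q + 2 * M / (√2 - 1) * √L) := by gcongr
    _ = _ := by ring

end Announce

/-! ### The loss in the reports -/

section Report

/-- Write q^(c-1) = e + 1, so q^c = q + qe. For q ≥ 2 the surplus factor is (e + 1) √2^(-qe) ≤ (e +
1) 2^(-e) ≤ 1. -/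
theorem pow_mul_inv_sqrt_two_pow_le {c : ℕ} (hc : 1 ≤ c) (q : ℕ) :
    (q : ℝ) ^ c * (√2)⁻¹ ^ q ^ c ≤ q * (√2)⁻¹ ^ q := by
  obtain ⟨d, rfl⟩ : ∃ d, c = d + 1 := ⟨c - 1, by omega⟩
  have hr := inv_sqrt_two_bounds
  rcases Nat.lt_or_ge q 2 with h | h
  · interval_cases q <;> simp
  obtain ⟨e, he⟩ : ∃ e, q ^ d = e + 1 := Nat.exists_eq_succ_of_ne_zero (by positivity)
  have h1 : (q : ℝ) ^ (d + 1) = q * (e + 1 : ℕ) := by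
    rw [pow_succ, ← he]
    push_cast
    ring
  have h2 : q ^ (d + 1) = q + q * e := by
    rw [pow_succ, he]
    ring
  rw [h1, h2, pow_add]
  have h3 : ((e + 1 : ℕ) : ℝ) * (√2)⁻¹ ^ (q * e) ≤ 1 := by
    have h4 : (√2)⁻¹ ^ (q * e) ≤ (√2)⁻¹ ^ (2 * e) :=
      pow_le_pow_of_le_one hr.1.le hr.2.1.le (Nat.mul_le_mul_right _ h)
    have h5 : (√2)⁻¹ ^ (2 * e) = ((2 : ℝ) ^ e)⁻¹ := by
      rw [inv_pow, pow_mul, Real.sq_sqrt (by norm_num)]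
    have h6 : ((e + 1 : ℕ) : ℝ) ≤ 2 ^ e := by
      have : e + 1 ≤ 2 ^ e := Nat.lt_two_pow_self
      exact_mod_cast this
    rw [h5] at h4
    calc ((e + 1 : ℕ) : ℝ) * (√2)⁻¹ ^ (q * e) ≤ 2 ^ e * ((2 : ℝ) ^ e)⁻¹ := by gcongr
      _ = 1 := mul_inv_cancel₀ (by positivity)
  calc (q : ℝ) * (e + 1 : ℕ) * ((√2)⁻¹ ^ q * (√2)⁻¹ ^ (q * e))
      = q * (√2)⁻¹ ^ q * ((e + 1 : ℕ) * (√2)⁻¹ ^ (q * e)) := by ring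
    _ ≤ q * (√2)⁻¹ ^ q * 1 := by gcongr
    _ = _ := mul_one _

/-- For q ≥ 1, (q+1)^c ≤ 2^c q^c and the preceding lemma reduce the sum to the series of q r^q and
r^q with r = 1/√2. At q = 0 the term is 3 and that of the majorant only 2, whence the additional 1
in `h8`. -/
theorem sum_reported_bits_le {c : ℕ} (hc : 1 ≤ c) (N : ℕ) :
    ∑ q ∈ Finset.range N, ((q + 1 : ℝ) ^ c + 2) * (√2)⁻¹ ^ q ^ c ≤
      (2 ^ c * √2 + 7 - 4 * √2) / (3 - 2 * √2) := by
  have hr := inv_sqrt_two_bounds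
  have hs := sqrt_two_bounds
  have hsq : √2 * √2 = (2 : ℝ) := Real.mul_self_sqrt (by norm_num)
  have h32 : 0 < 3 - 2 * √2 := by linarith
  have hpos : ∀ q : ℕ, 0 ≤ ((q + 1 : ℝ) ^ c + 2) * (√2)⁻¹ ^ q ^ c := fun q => by positivity
  have h1 : ∑ q ∈ Finset.range N, ((q + 1 : ℝ) ^ c + 2) * (√2)⁻¹ ^ q ^ c ≤
      ∑ q ∈ Finset.range (N + 1), ((q + 1 : ℝ) ^ c + 2) * (√2)⁻¹ ^ q ^ c :=
    Finset.sum_le_sum_of_subset_of_nonneg (Finset.range_mono (by omega)) fun q _ _ => hpos q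
  refine h1.trans ?_
  have hterm : ∀ q : ℕ, 1 ≤ q → ((q + 1 : ℝ) ^ c + 2) * (√2)⁻¹ ^ q ^ c ≤
      2 ^ c * (q * (√2)⁻¹ ^ q) + 2 * (√2)⁻¹ ^ q := by
    intro q hq
    have hq' : (1 : ℝ) ≤ q := by exact_mod_cast hq
    have h2 : (q + 1 : ℝ) ^ c ≤ 2 ^ c * (q : ℝ) ^ c := by
      rw [← mul_pow]
      gcongr
      linarith
    have h3 := pow_mul_inv_sqrt_two_pow_le hc q
    have h4 : (√2)⁻¹ ^ q ^ c ≤ (√2)⁻¹ ^ q :=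
      pow_le_pow_of_le_one hr.1.le hr.2.1.le (le_self_pow₀ hq (by omega))
    calc _ ≤ (2 ^ c * (q : ℝ) ^ c + 2) * (√2)⁻¹ ^ q ^ c := by gcongr
      _ = 2 ^ c * ((q : ℝ) ^ c * (√2)⁻¹ ^ q ^ c) + 2 * (√2)⁻¹ ^ q ^ c := by ring
      _ ≤ _ := by gcongr
  have hn : ‖(√2)⁻¹‖ < 1 := by rw [Real.norm_of_nonneg hr.1.le]; exact hr.2.1
  have hs1 := hasSum_coe_mul_geometric_of_norm_lt_one hn
  have hs2 := hasSum_geometric_of_lt_one hr.1.le hr.2.1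
  have hsum := (hs1.mul_left ((2 : ℝ) ^ c)).add (hs2.mul_left 2)
  have hle := sum_le_hasSum (Finset.range (N + 1)) (fun q _ => by positivity) hsum
  rw [Finset.sum_range_succ'] at hle ⊢
  have hfirst : ((((0 : ℕ) : ℝ) + 1) ^ c + 2) * (√2)⁻¹ ^ 0 ^ c = 3 := by
    rw [zero_pow (by omega)]
    norm_num
  have hzero : (2 : ℝ) ^ c * (((0 : ℕ) : ℝ) * (√2)⁻¹ ^ 0) + 2 * (√2)⁻¹ ^ 0 = 2 := by simp
  rw [hzero] at hle
  rw [hfirst]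
  have h5 : ∑ q ∈ Finset.range N, ((((q + 1 : ℕ) : ℝ) + 1) ^ c + 2) * (√2)⁻¹ ^ (q + 1) ^ c ≤
      ∑ q ∈ Finset.range N, (2 ^ c * (((q + 1 : ℕ) : ℝ) * (√2)⁻¹ ^ (q + 1)) +
        2 * (√2)⁻¹ ^ (q + 1)) := Finset.sum_le_sum fun q _ => hterm (q + 1) (by omega)
  have h6 : (√2)⁻¹ / (1 - (√2)⁻¹) ^ 2 = √2 / (3 - 2 * √2) := by
    rw [div_eq_div_iff (by have := hr.2.1; exact (pow_pos (by linarith) 2).ne') h32.ne', hr.2.2]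
    nlinarith
  have h7 : (1 - (√2)⁻¹)⁻¹ = (2 - √2) / (3 - 2 * √2) := by
    rw [inv_eq_one_div, div_eq_div_iff (by linarith [hr.2.1]) h32.ne', hr.2.2]
    nlinarith
  rw [h6, h7] at hle
  have h8 : (2 ^ c * √2 + 7 - 4 * √2) / (3 - 2 * √2) =
      2 ^ c * (√2 / (3 - 2 * √2)) + 2 * ((2 - √2) / (3 - 2 * √2)) + 1 := by
    rw [div_eq_iff h32.ne', add_mul, add_mul, mul_assoc, mul_assoc, div_mul_cancel₀ _ h32.ne',
      div_mul_cancel₀ _ h32.ne']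
    ring
  rw [h8]
  linarith

/-- The loss which the reports of the followers cause. -/
theorem sum_reportCost_le {n K T c : ℕ} (hc : 1 ≤ c) (hT : minHorizon c ≤ T) :
    ∑ q ∈ Finset.range T, reportCost n K T c (q + 1) ≤
      Real.exp 1 ^ 2 * ((n + 1 : ℕ) : ℝ) * K * Real.logb 2 T ^ (1 + 1 / (c : ℝ)) +
      2 * √2 / (3 - 2 * √2) * ((n + 1 : ℕ) : ℝ) ^ 2 * K *
        √(Real.log (2 * ((n + 1 : ℕ) : ℝ) ^ 2 * K * (T : ℝ) ^ 2)) *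
        Real.logb 2 (Real.log T) := by
  have hr := inv_sqrt_two_bounds
  have hs := sqrt_two_bounds
  have hsq : √2 * √2 = (2 : ℝ) := Real.mul_self_sqrt (by norm_num)
  have h32 : 0 < 3 - 2 * √2 := by linarith
  obtain ⟨hT1, hT2, hT3⟩ := le_logb_log_of_minHorizon_le hT
  have hlog := log_horizon_ge hc hT
  have hlam := two_pow_le_logb_log hc hT
  have hlgT0 : Real.log T ≤ Real.logb 2 T := by
    unfold Real.logb
    rw [le_div_iff₀ (Real.log_pos (by norm_num))]
    have := Real.log_two_lt_d9
    nlinarith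
  have hlgT : 1 ≤ Real.logb 2 (T : ℝ) := by linarith
  have hlgpow : Real.logb 2 (T : ℝ) ^ (1 + 1 / (c : ℝ)) =
      Real.logb 2 (T : ℝ) ^ (1 / (c : ℝ)) * Real.logb 2 T := by
    rw [add_comm, Real.rpow_add (by linarith), Real.rpow_one]
  rw [hlgpow]
  set Q := Real.logb 2 (T : ℝ) ^ (1 / (c : ℝ)) with hQ
  have hQ1 : 1 ≤ Q := Real.one_le_rpow hlgT (by positivity)
  have hQc : Q ^ c = Real.logb 2 T := by
    rw [hQ, one_div, Real.rpow_inv_natCast_pow (by linarith) (by omega)]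
  simp only [reportCost, epsRadius_eq, Nat.add_sub_cancel]
  set M : ℝ := ((n + 1 : ℕ) : ℝ) with hM
  set L := Real.log (2 * M ^ 2 * K * (T : ℝ) ^ 2)
  set lam := Real.logb 2 (Real.log T)
  have hnM : (n : ℝ) ≤ M := by
    rw [hM]
    push_cast
    linarith
  have hM0 : 0 ≤ M := Nat.cast_nonneg _
  have hbits : ∀ q : ℕ, (meanBits c (q + 1) : ℝ) ≤ ((q + 1 : ℝ) ^ c + 2) / 2 := by
    intro q
    unfold meanBits
    have := @Nat.cast_div_le ℝ _ _ _ ((q + 1) ^ c + 2) 2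
    push_cast at this
    exact this
  have hterm : ∀ q : ℕ, (if 2 * 2 ^ (q + 1) ^ c ≤ T then
      ((n * (K * meanBits c (q + 1)) : ℕ) : ℝ) * (2 + 4 * M * (√L * (√2)⁻¹ ^ (1 + q ^ c)))
      else 0) ≤ M * K * ((if 2 * 2 ^ (q + 1) ^ c ≤ T then (q + 1 : ℝ) ^ c + 2 else 0) +
        √2 * (M * √L) * (((q + 1 : ℝ) ^ c + 2) * (√2)⁻¹ ^ q ^ c)) := by
    intro q
    split_ifs with h
    · have h1 : ((n * (K * meanBits c (q + 1)) : ℕ) : ℝ) ≤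
          M * (K * (((q + 1 : ℝ) ^ c + 2) / 2)) := by
        push_cast
        have := hbits q
        gcongr
      calc _ ≤ M * (K * (((q + 1 : ℝ) ^ c + 2) / 2)) *
            (2 + 4 * M * (√L * (√2)⁻¹ ^ (1 + q ^ c))) := by gcongr
        _ = _ := by
          rw [pow_add, pow_one, hr.2.2]
          ring
    · positivity
  -- At most Q epochs are counted, and in each of them (q+1)^c + 2 ≤ 3 lg T. The factor 3 is then
  -- weakened to e².
  have hcount : ∑ q ∈ Finset.range T, (if 2 * 2 ^ (q + 1) ^ c ≤ T then (q + 1 : ℝ) ^ c + 2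
      else 0) ≤ 3 * (Q * Real.logb 2 T) := by
    have h1 : ∀ q : ℕ, 2 * 2 ^ (q + 1) ^ c ≤ T → (((q + 1 : ℕ) : ℝ)) ≤ Q := fun q hq =>
      card_filter_le_logb hc (by linarith) hQc (by linarith) hq
    have h2 := sum_ite_le_floor (Q := Q - 1) (by linarith) (fun q => 2 * 2 ^ (q + 1) ^ c ≤ T)
      (fun q hq => by
        have := h1 q hq
        push_cast at this
        linarith) T
    calc _ ≤ ∑ q ∈ Finset.range T, 3 * Real.logb 2 T *
          (if 2 * 2 ^ (q + 1) ^ c ≤ T then (1 : ℝ) else 0) := by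
          refine Finset.sum_le_sum fun q _ => ?_
          split_ifs with h
          · have h3 := pow_le_pow_left₀ (by positivity) (h1 q h) c
            rw [hQc] at h3
            push_cast at h3
            linarith
          · simp
      _ = 3 * Real.logb 2 T * ∑ q ∈ Finset.range T,
          (if 2 * 2 ^ (q + 1) ^ c ≤ T then (1 : ℝ) else 0) := (Finset.mul_sum _ _ _).symm
      _ ≤ 3 * Real.logb 2 T * (Q - 1 + 1) := by gcongr
      _ = _ := by ring
  have hsecond : √2 * ∑ q ∈ Finset.range T, ((q + 1 : ℝ) ^ c + 2) * (√2)⁻¹ ^ q ^ c ≤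
      2 * √2 / (3 - 2 * √2) * lam := by
    have h2c : (2 : ℝ) ≤ 2 ^ c := le_self_pow₀ (by norm_num) (by omega)
    -- Here lg(ln T) ≥ (6/5)·2^c swallows the factor `2 ^ c`.
    have h1 : 2 ^ c * √2 + 7 - 4 * √2 ≤ 2 * lam := by nlinarith
    calc _ ≤ √2 * ((2 ^ c * √2 + 7 - 4 * √2) / (3 - 2 * √2)) := by
          gcongr
          exact sum_reported_bits_le hc T
      _ ≤ √2 * (2 * lam / (3 - 2 * √2)) := by gcongr
      _ = _ := by ring
  have he : 3 ≤ Real.exp 1 ^ 2 := by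
    have := Real.exp_one_gt_d9
    nlinarith
  calc _ ≤ ∑ q ∈ Finset.range T, M * K * ((if 2 * 2 ^ (q + 1) ^ c ≤ T then (q + 1 : ℝ) ^ c + 2
          else 0) + √2 * (M * √L) * (((q + 1 : ℝ) ^ c + 2) * (√2)⁻¹ ^ q ^ c)) :=
        Finset.sum_le_sum fun q _ => hterm q
    _ = M * K * (∑ q ∈ Finset.range T, (if 2 * 2 ^ (q + 1) ^ c ≤ T then (q + 1 : ℝ) ^ c + 2
          else 0) + M * √L * (√2 * ∑ q ∈ Finset.range T, ((q + 1 : ℝ) ^ c + 2) *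
            (√2)⁻¹ ^ q ^ c)) := by
        rw [← Finset.mul_sum, Finset.sum_add_distrib, ← Finset.mul_sum]
        ring
    _ ≤ M * K * (Real.exp 1 ^ 2 * (Q * Real.logb 2 T) +
          M * √L * (2 * √2 / (3 - 2 * √2) * lam)) := by
        have h0 : 0 ≤ Q * Real.logb 2 T := by positivity
        have := hcount.trans (mul_le_mul_of_nonneg_right he h0)
        gcongr
    _ = _ := by ring

end Report

/-! ### The sum of all costs -/

section Total

/-- The total loss after the initialization in a run with accurate estimates. -/
theorem sum_epochCost_le {n K T c : ℕ} (hnK : n + 1 ≤ K) (hc : 1 ≤ c) (hT : minHorizon c ≤ T)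
    {S : Fin (n + 1) → Fin K → Prop} [∀ m k, Decidable (S m k)] {D : Fin (n + 1) → Fin K → ℝ}
    (hD0 : ∀ m k, S m k → 0 < D m k) (hD1 : ∀ m k, S m k → D m k ≤ (n + 1 : ℕ)) :
    ∑ q ∈ Finset.range T, epochCost n K T c (q + 1) S D ≤
      6 * ((n + 1 : ℕ) : ℝ) ^ 2 * K * Real.logb 2 K * Real.logb 2 T ^ (1 / (c : ℝ)) +
      Real.exp 1 ^ 2 * ((n + 1 : ℕ) : ℝ) * K * Real.logb 2 T ^ (1 + 1 / (c : ℝ)) +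
      2 * ((n + 1 : ℕ) : ℝ) ^ 3 * K * Real.logb 2 K / (√2 - 1) *
        √(Real.log (2 * ((n + 1 : ℕ) : ℝ) ^ 2 * K * (T : ℝ) ^ 2)) +
      2 * √2 / (3 - 2 * √2) * ((n + 1 : ℕ) : ℝ) ^ 2 * K *
        √(Real.log (2 * ((n + 1 : ℕ) : ℝ) ^ 2 * K * (T : ℝ) ^ 2)) *
        Real.logb 2 (Real.log T) +
      (2 * √2 - 1) / (√2 - 1) * ∑ m, ∑ k, if S m k then
        (32 * ((n + 1 : ℕ) : ℝ) ^ 2 *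
          Real.log (2 * ((n + 1 : ℕ) : ℝ) ^ 2 * K * (T : ℝ) ^ 2) / D m k) ^ (1 + 1 / (c : ℝ))
        else 0 := by
  have h1 := sum_announceCost_le hnK hc hT
  have h2 := sum_reportCost_le (n := n) (K := K) hc hT
  have h3 : ∑ q ∈ Finset.range T, 2 ^ (q + 1) ^ c *
      ∑ e : Fin (n + 1) × Fin K, edgeCost n K T c (q + 1) (S e.1 e.2) (D e.1 e.2) ≤
      (2 * √2 - 1) / (√2 - 1) * ∑ m, ∑ k, if S m k then
        (32 * ((n + 1 : ℕ) : ℝ) ^ 2 *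
          Real.log (2 * ((n + 1 : ℕ) : ℝ) ^ 2 * K * (T : ℝ) ^ 2) / D m k) ^ (1 + 1 / (c : ℝ))
        else 0 := by
    simp only [Finset.mul_sum]
    rw [Finset.sum_comm, Fintype.sum_prod_type]
    refine Finset.sum_le_sum fun m _ => Finset.sum_le_sum fun k _ => ?_
    exact sum_edgeCost_le (by omega) hc hT (hD0 m k) (hD1 m k)
  simp only [epochCost, Finset.sum_add_distrib]
  linarith

end Total

/-! ### The accuracy of the estimates -/

section Concentration

variable {Ω : Type*} [MeasurableSpace Ω] {P : Measure Ω} {M K : ℕ}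
  {μ : Fin M → Fin K → ℝ} {Y : Fin M → Fin K → ℕ → Ω → ℝ} {U : Fin M → ℕ → Ω → Fin K}

theorem IsBandit.integral_eq (h : IsBandit P μ Y U) (m : Fin M) (k : Fin K) (t : ℕ) :
    ∫ ω, Y m k t ω ∂P = μ m k := by
  rw [(h.identDistrib m k t).integral_eq, h.mean]

variable [IsProbabilityMeasure P]

theorem IsBandit.mean_mem_Icc (h : IsBandit P μ Y U) (m : Fin M) (k : Fin K) :
    μ m k ∈ Set.Icc (0 : ℝ) 1 := by
  rw [← h.mean]
  constructor
  · exact integral_nonneg fun ω => (h.mem_Icc m k 0 ω).1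
  · calc ∫ ω, Y m k 0 ω ∂P ≤ ∫ _ω, (1 : ℝ) ∂P :=
          integral_mono (Integrable.of_mem_Icc 0 1 (h.measurable_Y m k 0).aemeasurable
            (Filter.Eventually.of_forall (h.mem_Icc m k 0))) (integrable_const _)
            fun ω => (h.mem_Icc m k 0 ω).2
      _ = 1 := by simp

/-- Centered variables with values in [0, 1] are sub-Gaussian with parameter 1/4. The one-sided
bound is applied to them and to their negatives, for a deterministic set of rounds. -/
theorem IsBandit.hoeffding (h : IsBandit P μ Y U) (m : Fin M) (k : Fin K) (a : ℕ) (I : Finset ℕ)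
    (hI : I.Nonempty) {ε : ℝ} (hε : 0 ≤ ε) :
    P.real {ω | ¬ |(∑ t ∈ I, Y m k (a + t) ω) / I.card - μ m k| ≤ ε} ≤
      2 * Real.exp (-(2 * I.card * ε ^ 2)) := by
  have hcard : (0 : ℝ) < I.card := by exact_mod_cast hI.card_pos
  have hind : iIndepFun (fun t : ℕ => fun ω => Y m k (a + t) ω - μ m k) P := by
    have h1 := h.indep_Y.precomp (g := fun t : ℕ => a + t) (add_right_injective a)
    exact h1.comp (fun _ z => z m k - μ m k) fun _ =>
      ((measurable_pi_apply k).comp (measurable_pi_apply m)).sub_const _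
  have hsub : ∀ t, HasSubgaussianMGF (fun ω => Y m k (a + t) ω - μ m k)
      ((‖(1 : ℝ) - 0‖₊ / 2) ^ 2) P := by
    intro t
    have := hasSubgaussianMGF_of_mem_Icc (μ := P) (X := Y m k (a + t)) (a := 0) (b := 1)
      (h.measurable_Y m k _).aemeasurable (Filter.Eventually.of_forall (h.mem_Icc m k _))
    rwa [h.integral_eq] at this
  have hexp : ∀ X : ℕ → Ω → ℝ, iIndepFun X P → (∀ t, HasSubgaussianMGF (X t)
      ((‖(1 : ℝ) - 0‖₊ / 2) ^ 2) P) → P.real {ω | I.card * ε ≤ ∑ t ∈ I, X t ω} ≤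
        Real.exp (-(2 * I.card * ε ^ 2)) := by
    intro X hX hX'
    refine (HasSubgaussianMGF.measure_sum_ge_le_of_iIndepFun hX (fun i _ => hX' i)
      (by positivity)).trans (le_of_eq ?_)
    congr 1
    simp only [sub_zero, nnnorm_one, Finset.sum_const, nsmul_eq_mul]
    push_cast
    field_simp
  have hneg : iIndepFun (fun t : ℕ => -fun ω => Y m k (a + t) ω - μ m k) P :=
    hind.comp (fun _ x => -x) fun _ => measurable_neg
  calc P.real {ω | ¬ |(∑ t ∈ I, Y m k (a + t) ω) / I.card - μ m k| ≤ ε}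
      ≤ P.real ({ω | I.card * ε ≤ ∑ t ∈ I, (Y m k (a + t) ω - μ m k)} ∪
          {ω | I.card * ε ≤ ∑ t ∈ I, (-fun ω => Y m k (a + t) ω - μ m k) ω}) := by
        refine measureReal_mono fun ω hω => ?_
        have hω : ε < |(∑ t ∈ I, Y m k (a + t) ω) / I.card - μ m k| := not_le.1 hω
        have e1 : ∑ t ∈ I, (Y m k (a + t) ω - μ m k) =
            I.card * ((∑ t ∈ I, Y m k (a + t) ω) / I.card - μ m k) := by
          rw [Finset.sum_sub_distrib, Finset.sum_const, nsmul_eq_mul, mul_sub,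
            mul_div_cancel₀ _ hcard.ne']
        rcases lt_abs.1 hω with h1 | h1
        · left
          rw [Set.mem_ofPred_eq, e1]
          gcongr
        · right
          change I.card * ε ≤ ∑ t ∈ I, -(Y m k (a + t) ω - μ m k)
          rw [Finset.sum_neg_distrib, e1, ← mul_neg]
          gcongr
    _ ≤ _ := measureReal_union_le _ _
    _ ≤ Real.exp (-(2 * I.card * ε ^ 2)) + Real.exp (-(2 * I.card * ε ^ 2)) :=
        add_le_add (hexp _ hind hsub) (hexp _ hneg fun t => (hsub t).neg)
    _ = _ := by ring

/-- The private randomness and the qualities of the first `s` rounds are independent of the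
qualities of the next rounds. -/
theorem IsBandit.indepFun_past_future (h : IsBandit P μ Y U) (s N : ℕ) :
    IndepFun (fun ω => ((fun (t : Fin s) (m : Fin M) (k : Fin K) => Y m k t ω),
      fun (m : Fin M) (i : ℕ) => U m i ω))
      (fun ω (t : Fin N) (m : Fin M) (k : Fin K) => Y m k (s + t) ω) P := by
  have hY : ∀ t, Measurable fun ω (m : Fin M) (k : Fin K) => Y m k t ω := fun t =>
    measurable_pi_iff.2 fun m => measurable_pi_iff.2 fun k => h.measurable_Y m k t
  refine IndepFun.prodMk_left_of_prodMk (measurable_pi_iff.2 fun t => hY t)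
    (measurable_pi_iff.2 fun m => measurable_pi_iff.2 fun i => h.measurable_U m i) ?_ ?_
  · exact iIndepFun.indepFun_tuples h.indep_Y hY (fun t : Fin s => (t : ℕ)) (fun t : Fin N => s + t)
      fun a b hab => by
        have := a.2
        omega
  · refine h.indep_YU.comp (φ := fun y => ((fun (t : Fin s) m k => y t m k),
      fun (t : Fin N) m k => y (s + t) m k)) (ψ := id) ?_ measurable_id
    refine Measurable.prodMk ?_ ?_ <;>
    · refine measurable_pi_iff.2 fun t => measurable_pi_iff.2 fun m => measurable_pi_iff.2 fun k => ?_
      exact (measurable_pi_apply k).comp ((measurable_pi_apply m).comp (measurable_pi_apply _))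

end Concentration

/-! ### The epoch states as measurable, nonanticipating functions of the qualities -/

section EpochStates

variable {n K : ℕ}

theorem measurableSet_epochState (tie : TieBreak K) (T c p : ℕ) (E : List (Fin (n + 1) × Fin K))
    {X : Type*} [MeasurableSpace X] {w : X → Fin (n + 1) → Fin K → ℝ} (hw : Measurable w) (s : ℕ)
    (st : EpochState n K) : MeasurableSet {x | epochState tie T c p E (w x) s = st} := by
  have : {x | epochState tie T c p E (w x) s = st} =
      ⋃ d ∈ {d : List (Fin (n + 1) × Fin K) × List (Fin (n + 1) → Fin K) × (Fin (n + 1) → Fin K) |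
        (d.1, d.2.1, d.2.2, s + commRounds n K d.2.1.length) = st},
        {x | decision tie T c p E (w x) = d} := by
    ext x
    simp [epochState]
  rw [this]
  exact MeasurableSet.biUnion (Set.to_countable _) fun d _ => measurableSet_decision tie T c p E hw d

variable [NeZero K]

theorem measurable_rawEstimate (c p : ℕ) (C : List (Fin (n + 1) → Fin K)) {X : Type*}
    [MeasurableSpace X] {y : X → Fin (n + 1) → Fin K → ℕ → ℝ}
    (hy : ∀ m k t, Measurable fun x => y x m k t) (s : ℕ) (m : Fin (n + 1)) (k : Fin K) :
    Measurable fun x => rawEstimate c p C (y x) s m k := by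
  simp only [rawEstimate_eq]
  exact (Finset.measurable_sum _ fun t _ => hy m k (s + t)).div_const _

theorem measurable_newWeights (c p : ℕ) (C : List (Fin (n + 1) → Fin K)) {X : Type*}
    [MeasurableSpace X] {y : X → Fin (n + 1) → Fin K → ℕ → ℝ}
    (hy : ∀ m k t, Measurable fun x => y x m k t) (s : ℕ) :
    Measurable fun x => newWeights c p C (y x) s := by
  unfold newWeights
  refine measurable_finCons (measurable_pi_iff.2 fun k => measurable_rawEstimate c p C hy s 0 k)
    (measurable_pi_iff.2 fun i => measurable_pi_iff.2 fun k => ?_)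
  exact (measurable_from_top.comp ((measurable_truncBits _).comp
    (measurable_rawEstimate c p C hy s i.succ k))).div_const _

theorem measurableSet_accurate (μ : Fin (n + 1) → Fin K → ℝ) (T c p : ℕ)
    (C : List (Fin (n + 1) → Fin K)) {X : Type*}
    [MeasurableSpace X] {y : X → Fin (n + 1) → Fin K → ℕ → ℝ}
    (hy : ∀ m k t, Measurable fun x => y x m k t) (s : ℕ) :
    MeasurableSet {x | Accurate μ T c p C (y x) s} := by
  have : {x | Accurate μ T c p C (y x) s} = ⋂ m, ⋂ π ∈ {π | π ∈ C},
      {x | |rawEstimate c p C (y x) s m (π m) - μ m (π m)| ≤ epsRadius (n + 1) K T c p} := by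
    ext x
    simp [Accurate]
  rw [this]
  refine MeasurableSet.iInter fun m => MeasurableSet.biInter (Set.to_countable _) fun π _ => ?_
  exact measurableSet_le ((measurable_rawEstimate c p C hy s m (π m)).sub_const _).abs
    measurable_const

theorem measurableSet_epochStateAt (tie : TieBreak K) (T c q : ℕ)
    {X : Type*} [MeasurableSpace X] {y : X → Fin (n + 1) → Fin K → ℕ → ℝ}
    (hy : ∀ m k t, Measurable fun x => y x m k t) (st : EpochState n K) :
    MeasurableSet {x | epochStateAt tie T c (y x) q = st} := by
  induction q generalizing st with
  | zero =>
    simp only [epochStateAt]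
    exact MeasurableSet.const _
  | succ q ih =>
    have : {x | epochStateAt tie T c (y x) (q + 1) = st} =
        ⋃ i, {x | epochStateAt tie T c (y x) q = i} ∩
          {x | nextState tie T c (q + 1) i (y x) = st} := by
      ext x
      simp [epochStateAt]
    rw [this]
    exact MeasurableSet.iUnion fun i => (ih i).inter
      (measurableSet_epochState tie T c _ _ (measurable_newWeights c _ _ hy _) _ _)

theorem rawEstimate_congr (c p : ℕ) (C : List (Fin (n + 1) → Fin K))
    {y y' : Fin (n + 1) → Fin K → ℕ → ℝ} {s : ℕ}
    (h : ∀ t < s + C.length * 2 ^ p ^ c, ∀ m k, y m k t = y' m k t) :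
    rawEstimate c p C y s = rawEstimate c p C y' s := by
  funext m k
  rw [rawEstimate_eq, rawEstimate_eq]
  congr 1
  refine Finset.sum_congr rfl fun t ht => h _ ?_ m k
  have := Finset.mem_range.1 (Finset.mem_filter.1 ht).1
  omega

/-- An epoch is determined by the qualities observed before its exploration phase. -/
theorem epochStateAt_congr (tie : TieBreak K) (T c q : ℕ) {y y' : Fin (n + 1) → Fin K → ℕ → ℝ}
    (h : ∀ t < (epochStateAt tie T c y q).2.2.2, ∀ m k, y m k t = y' m k t) :
    epochStateAt tie T c y q = epochStateAt tie T c y' q := by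
  induction q with
  | zero => rfl
  | succ q ih =>
    have hle : (epochStateAt tie T c y q).2.2.2 +
        (epochStateAt tie T c y q).2.1.length * 2 ^ (q + 1) ^ c ≤
        (epochStateAt tie T c y (q + 1)).2.2.2 := by
      simp only [epochStateAt, nextState, epochState]
      omega
    have h1 := ih fun t ht => h t (by omega)
    have h2 := rawEstimate_congr c (q + 1) (epochStateAt tie T c y q).2.1 (y := y) (y' := y')
      (s := (epochStateAt tie T c y q).2.2.2) fun t ht => h t (by omega)
    simp only [epochStateAt]
    rw [← h1]
    unfold nextState newWeights
    rw [h2]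

end EpochStates

/-! ### The probability of an inaccurate estimate -/

section Clean

variable {Ω : Type*} [MeasurableSpace Ω] {P : Measure Ω} [IsProbabilityMeasure P] {n K : ℕ}
  [NeZero K] {μ : Fin (n + 1) → Fin K → ℝ} {Y : Fin (n + 1) → Fin K → ℕ → Ω → ℝ}
  {U : Fin (n + 1) → ℕ → Ω → Fin K}

/-- Ranks, candidates and starting round are fixed here. An explored edge has at least 2^(p^c)
samples, so Hoeffding's bound is at most 2 exp(-ln(2/δ)) = δ, and MKδ = 1/(MT²). -/
theorem IsBandit.measureReal_not_accurate_le (h : IsBandit P μ Y U) {T c p : ℕ} (hT : 0 < T)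
    (σ : Equiv.Perm (Fin (n + 1))) (C : List (Fin (n + 1) → Fin K)) (s₀ s : ℕ) :
    P.real {ω | ¬ Accurate (fun j => μ (σ j)) T c p C (fun j k t => Y (σ j) k (s₀ + t) ω) s} ≤
      1 / ((n + 1 : ℕ) * (T : ℝ) ^ 2) := by
  classical
  have hT' : (0 : ℝ) < T := by exact_mod_cast hT
  have hK' : (0 : ℝ) < K := by exact_mod_cast Nat.pos_of_ne_zero (NeZero.ne K)
  have hM' : (0 : ℝ) < (n + 1 : ℕ) := by positivity
  set δ : ℝ := 1 / (((n + 1 : ℕ) : ℝ) ^ 2 * K * (T : ℝ) ^ 2) with hδ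
  have hδ0 : 0 < δ := by positivity
  have hδ1 : δ ≤ 1 := by
    rw [hδ, div_le_one (by positivity)]
    have h1 : (1 : ℝ) ≤ (n + 1 : ℕ) := by simp
    have h2 : (1 : ℝ) ≤ K := by exact_mod_cast Nat.pos_of_ne_zero (NeZero.ne K)
    have h3 : (1 : ℝ) ≤ T := by exact_mod_cast hT
    exact one_le_mul_of_one_le_of_one_le (one_le_mul_of_one_le_of_one_le (one_le_pow₀ h1) h2)
      (one_le_pow₀ h3)
  have hlog : 0 ≤ Real.log (2 / δ) := Real.log_nonneg (by rw [le_div_iff₀ hδ0]; linarith)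
  set S : Fin (n + 1) × Fin K → Set Ω := fun e =>
    {ω | (∃ π ∈ C, π e.1 = e.2) ∧ ¬ |rawEstimate c p C (fun j k t => Y (σ j) k (s₀ + t) ω) s e.1 e.2 -
      μ (σ e.1) e.2| ≤ epsRadius (n + 1) K T c p} with hS
  have hone : ∀ e, P.real (S e) ≤ δ := by
    intro e
    by_cases he : ∃ π ∈ C, π e.1 = e.2
    swap
    · have : S e = ∅ := by
        ext ω
        simp only [hS, Set.mem_ofPred_eq, he, false_and, Set.mem_empty_iff_false]
      rw [this, measureReal_empty]
      exact hδ0.le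
    · obtain ⟨π, hπ, hπe⟩ := he
      set I := exploreRounds c p C e.1 e.2 with hI
      have hcard : 2 ^ p ^ c ≤ I.card := by
        have := two_pow_le_card_exploreRounds (c := c) (p := p) (m := e.1) hπ
        rwa [hπe] at this
      have hcard' : (2 : ℝ) ^ p ^ c ≤ I.card := by exact_mod_cast hcard
      have hpos : 0 < I.card := lt_of_lt_of_le (by positivity) hcard
      have hε : epsRadius (n + 1) K T c p ^ 2 = Real.log (2 / δ) / 2 ^ (1 + p ^ c) := by
        unfold epsRadius
        exact Real.sq_sqrt (div_nonneg hlog (by positivity))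
      have h1 := h.hoeffding (σ e.1) e.2 (s₀ + s) I (Finset.card_pos.1 hpos)
        (epsRadius_nonneg (n + 1) K T c p)
      refine (measureReal_mono ?_).trans (h1.trans ?_)
      · intro ω hω
        have h2 := hω.2
        rw [rawEstimate_eq] at h2
        simp only [Set.mem_ofPred_eq, add_assoc]
        exact h2
      · rw [hε]
        have h3 : Real.log (2 / δ) ≤ 2 * I.card * (Real.log (2 / δ) / 2 ^ (1 + p ^ c)) := by
          rw [pow_add, pow_one, mul_div_assoc', le_div_iff₀ (by positivity)]
          nlinarith [mul_le_mul_of_nonneg_left hcard' hlog]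
        calc 2 * Real.exp (-(2 * I.card * (Real.log (2 / δ) / 2 ^ (1 + p ^ c))))
            ≤ 2 * Real.exp (-Real.log (2 / δ)) := by gcongr
          _ = δ := by
            rw [Real.exp_neg, Real.exp_log (by positivity)]
            field_simp
  have hsub : {ω | ¬ Accurate (fun j => μ (σ j)) T c p C (fun j k t => Y (σ j) k (s₀ + t) ω) s} ⊆
      ⋃ e ∈ (Finset.univ : Finset (Fin (n + 1) × Fin K)), S e := by
    intro ω hω
    simp only [Accurate, Set.mem_ofPred_eq, not_forall] at hω
    obtain ⟨m, π, hπ, hm⟩ := hω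
    simp only [Finset.mem_univ, Set.iUnion_true, Set.mem_iUnion]
    exact ⟨(m, π m), ⟨π, hπ, rfl⟩, hm⟩
  calc _ ≤ P.real (⋃ e ∈ (Finset.univ : Finset (Fin (n + 1) × Fin K)), S e) :=
        measureReal_mono hsub (measure_ne_top _ _)
    _ ≤ ∑ e, P.real (S e) := measureReal_biUnion_finset_le _ _
    _ ≤ ∑ _e : Fin (n + 1) × Fin K, δ := Finset.sum_le_sum fun e _ => hone e
    _ = _ := by
      rw [Finset.sum_const, Finset.card_univ, Fintype.card_prod, Fintype.card_fin,
        Fintype.card_fin, nsmul_eq_mul, hδ]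
      push_cast
      field_simp

/-- The order of the players by their ranks. -/
noncomputable def rankPerm (T : ℕ) (u : Fin (n + 1) → ℕ → Fin K) : Equiv.Perm (Fin (n + 1)) :=
  rankOrder (finalSeats u (chairRounds K T) fun _ => none)

theorem measurableSet_finalSeats {M : ℕ} (N : ℕ) (o : Fin M → Option (Fin K))
    (o' : Fin M → Option (Fin K)) :
    MeasurableSet {u : Fin M → ℕ → Fin K | finalSeats u N o = o'} := by
  have h1 : {u : Fin M → ℕ → Fin K | finalSeats u N o = o'} =
      (fun u (q : Fin M × Fin N) => u q.1 q.2) ⁻¹'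
        {f | finalSeats (fun m i => if hi : i < N then f (m, ⟨i, hi⟩) else 0) N o = o'} := by
    ext u
    simp only [Set.mem_ofPred_eq, Set.mem_preimage]
    rw [finalSeats_congr]
    intro i hi m
    simp [hi]
  rw [h1]
  refine (measurable_pi_iff.2 fun q => ?_) (Set.to_countable _).measurableSet
  exact (measurable_pi_apply (q.2 : ℕ)).comp (measurable_pi_apply q.1)

theorem measurableSet_rankPerm (T : ℕ) (σ : Equiv.Perm (Fin (n + 1))) :
    MeasurableSet {u : Fin (n + 1) → ℕ → Fin K | rankPerm T u = σ} := by
  have : {u : Fin (n + 1) → ℕ → Fin K | rankPerm T u = σ} = ⋃ o ∈ {o | rankOrder o = σ},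
      {u | finalSeats u (chairRounds K T) (fun _ => none) = o} := by
    ext u
    simp [rankPerm]
  rw [this]
  exact MeasurableSet.biUnion (Set.to_countable _) fun o _ => measurableSet_finalSeats _ _ _

/-- The qualities from round `s₀` on, for the players in the order `σ`. -/
def relabel (s₀ : ℕ) (σ : Equiv.Perm (Fin (n + 1))) (y : Fin (n + 1) → Fin K → ℕ → ℝ) :
    Fin (n + 1) → Fin K → ℕ → ℝ := fun j k t => y (σ j) k (s₀ + t)

/-- For given ranks `σ`, the estimates of epoch `q + 1` are accurate if its state is `x`. -/
def AccurateIn (T c s₀ q : ℕ) (μ : Fin (n + 1) → Fin K → ℝ)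
    (y : Fin (n + 1) → Fin K → ℕ → ℝ) (σ : Equiv.Perm (Fin (n + 1))) (x : EpochState n K) :
    Prop :=
  Accurate (fun j => μ (σ j)) T c (q + 1) x.2.1 (relabel s₀ σ y) x.2.2.2

/-- All estimates of the first `T` epochs are accurate. -/
def Clean (tie : TieBreak K) (T c s₀ : ℕ) (μ : Fin (n + 1) → Fin K → ℝ)
    (u : Fin (n + 1) → ℕ → Fin K) (y : Fin (n + 1) → Fin K → ℕ → ℝ) : Prop :=
  ∀ q < T, AccurateIn T c s₀ q μ y (rankPerm T u)
    (epochStateAt tie T c (relabel s₀ (rankPerm T u) y) q)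

/-- With `s` the exploration start recorded in `x`, the first event is decided by the private
randomness and the first `s₀ + s` rounds, the second by the next `N` rounds. `zp` and `zf` rebuild
the relevant qualities from either part and are filled up with 0. -/
theorem IsBandit.indep_epochState_accurate (h : IsBandit P μ Y U) (tie : TieBreak K) (T c s₀ q : ℕ)
    (σ : Equiv.Perm (Fin (n + 1))) (x : EpochState n K) :
    P (({ω | rankPerm T (fun m i => U m i ω) = σ} ∩
        {ω | epochStateAt tie T c (relabel s₀ σ fun m k t => Y m k t ω) q = x}) ∩
      {ω | ¬ AccurateIn T c s₀ q μ (fun m k t => Y m k t ω) σ x}) =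
    P ({ω | rankPerm T (fun m i => U m i ω) = σ} ∩
        {ω | epochStateAt tie T c (relabel s₀ σ fun m k t => Y m k t ω) q = x}) *
      P {ω | ¬ AccurateIn T c s₀ q μ (fun m k t => Y m k t ω) σ x} := by
  set s := x.2.2.2 with hs
  set N := x.2.1.length * 2 ^ (q + 1) ^ c with hN
  have hind := h.indepFun_past_future (s₀ + s) N
  set zp : (Fin (s₀ + s) → Fin (n + 1) → Fin K → ℝ) × (Fin (n + 1) → ℕ → Fin K) →
      Fin (n + 1) → Fin K → ℕ → ℝ := fun v j k t =>
    if ht : s₀ + t < s₀ + s then v.1 ⟨s₀ + t, ht⟩ (σ j) k else 0 with hzp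
  have hzpm : ∀ j k t, Measurable fun v => zp v j k t := by
    intro j k t
    simp only [hzp]
    split_ifs with ht
    · exact (measurable_pi_apply k).comp ((measurable_pi_apply (σ j)).comp
        ((measurable_pi_apply _).comp measurable_fst))
    · exact measurable_const
  set zf : (Fin N → Fin (n + 1) → Fin K → ℝ) → Fin (n + 1) → Fin K → ℕ → ℝ := fun v j k t =>
    if ht : s ≤ t ∧ t - s < N then v ⟨t - s, ht.2⟩ (σ j) k else 0 with hzf
  have hzfm : ∀ j k t, Measurable fun v => zf v j k t := by
    intro j k t
    simp only [hzf]
    split_ifs with ht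
    · exact (measurable_pi_apply k).comp ((measurable_pi_apply (σ j)).comp
        (measurable_pi_apply _))
    · exact measurable_const
  have hpast : {ω | rankPerm T (fun m i => U m i ω) = σ} ∩
      {ω | epochStateAt tie T c (relabel s₀ σ fun m k t => Y m k t ω) q = x} =
      (fun ω => ((fun (t : Fin (s₀ + s)) (m : Fin (n + 1)) (k : Fin K) => Y m k t ω),
        fun (m : Fin (n + 1)) (i : ℕ) => U m i ω)) ⁻¹'
      ({v | rankPerm T v.2 = σ} ∩ {v | epochStateAt tie T c (zp v) q = x}) := by
    ext ω
    simp only [Set.mem_inter_iff, Set.mem_ofPred_eq, Set.mem_preimage]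
    refine and_congr Iff.rfl ?_
    have hagree : ∀ t < s, ∀ j k, relabel s₀ σ (fun m k t => Y m k t ω) j k t =
        zp ((fun (t : Fin (s₀ + s)) (m : Fin (n + 1)) (k : Fin K) => Y m k t ω),
          fun (m : Fin (n + 1)) (i : ℕ) => U m i ω) j k t := by
      intro t ht j k
      simp [relabel, hzp, ht]
    -- `epochStateAt_congr` asks for agreement before the start recorded in the state computed from
    -- its first argument. In each direction the assumption says that this state is `x`.
    constructor
    · intro h1
      rw [← h1]
      refine (epochStateAt_congr tie T c q fun t ht => ?_).symm
      rw [h1] at ht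
      exact hagree t ht
    · intro h1
      rw [← h1]
      refine (epochStateAt_congr tie T c q fun t ht => ?_).symm
      rw [h1] at ht
      exact fun j k => (hagree t ht j k).symm
  have hfuture : {ω | ¬ AccurateIn T c s₀ q μ (fun m k t => Y m k t ω) σ x} =
      (fun ω (t : Fin N) (m : Fin (n + 1)) (k : Fin K) => Y m k (s₀ + s + t) ω) ⁻¹'
      {v | Accurate (fun j => μ (σ j)) T c (q + 1) x.2.1 (zf v) s}ᶜ := by
    ext ω
    simp only [Set.mem_preimage, Set.mem_compl_iff, Set.mem_ofPred_eq]
    refine not_congr ?_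
    unfold AccurateIn Accurate
    refine forall_congr' fun m => forall_congr' fun π => imp_congr Iff.rfl ?_
    rw [rawEstimate_eq, rawEstimate_eq]
    have e : ∀ t ∈ exploreRounds c (q + 1) x.2.1 m (π m), relabel s₀ σ (fun m k t => Y m k t ω) m (π m) (s + t) =
        zf (fun (t : Fin N) (m : Fin (n + 1)) (k : Fin K) => Y m k (s₀ + s + t) ω) m (π m)
          (s + t) := by
      intro t ht
      have ht' := Finset.mem_range.1 (Finset.mem_filter.1 ht).1
      simp [relabel, hzf, ht', hN, add_assoc]
    rw [Finset.sum_congr rfl e]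
  have hm1 : MeasurableSet ({v | rankPerm T v.2 = σ} ∩
      {v : (Fin (s₀ + s) → Fin (n + 1) → Fin K → ℝ) × (Fin (n + 1) → ℕ → Fin K) |
        epochStateAt tie T c (zp v) q = x}) :=
    (measurable_snd (measurableSet_rankPerm T σ)).inter
      (measurableSet_epochStateAt tie T c q hzpm x)
  have := hind.measure_inter_preimage_eq_mul _ _ hm1
    (measurableSet_accurate (fun j => μ (σ j)) T c (q + 1) x.2.1 hzfm s).compl
  rw [← hpast, ← hfuture] at this
  exact this

end Clean

section Clean

variable {Ω : Type*} [MeasurableSpace Ω] {P : Measure Ω} [IsProbabilityMeasure P] {n K : ℕ}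
  [NeZero K] {μ : Fin (n + 1) → Fin K → ℝ} {Y : Fin (n + 1) → Fin K → ℕ → Ω → ℝ}
  {U : Fin (n + 1) → ℕ → Ω → Fin K}

/-- Ranks and state together have countably many values. For each of them the accuracy is
independent of that value being taken, and the bound for a fixed state applies. -/
theorem IsBandit.measureReal_not_accurateIn_le (h : IsBandit P μ Y U) (tie : TieBreak K) {T : ℕ}
    (hT : 0 < T) (c s₀ q : ℕ) :
    P.real {ω | ¬ AccurateIn T c s₀ q μ (fun m k t => Y m k t ω) (rankPerm T fun m i => U m i ω)
      (epochStateAt tie T c (relabel s₀ (rankPerm T fun m i => U m i ω)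
        fun m k t => Y m k t ω) q)} ≤ 1 / ((n + 1 : ℕ) * (T : ℝ) ^ 2) := by
  classical
  have hUm : Measurable fun ω (m : Fin (n + 1)) (i : ℕ) => U m i ω :=
    measurable_pi_iff.2 fun m => measurable_pi_iff.2 fun i => h.measurable_U m i
  obtain ⟨X, hX⟩ : ∃ X : Ω → Equiv.Perm (Fin (n + 1)) × EpochState n K, ∀ ω, X ω =
      (rankPerm T fun m i => U m i ω, epochStateAt tie T c
        (relabel s₀ (rankPerm T fun m i => U m i ω) fun m k t => Y m k t ω) q) :=
    ⟨_, fun _ => rfl⟩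
  have hXset : ∀ x : Equiv.Perm (Fin (n + 1)) × EpochState n K, {ω | X ω = x} =
      {ω | rankPerm T (fun m i => U m i ω) = x.1} ∩
        {ω | epochStateAt tie T c (relabel s₀ x.1 fun m k t => Y m k t ω) q = x.2} := by
    rintro ⟨σ, x⟩
    ext ω
    simp only [hX, Set.mem_ofPred_eq, Prod.mk.injEq, Set.mem_inter_iff]
    constructor
    · rintro ⟨h1, h2⟩
      rw [h1] at h2
      exact ⟨h1, h2⟩
    · rintro ⟨h1, h2⟩
      rw [← h1] at h2
      exact ⟨h1, h2⟩
  have hXm : ∀ x, MeasurableSet {ω | X ω = x} := by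
    intro x
    rw [hXset]
    exact (hUm (measurableSet_rankPerm T x.1)).inter
      (measurableSet_epochStateAt tie T c q (fun j k t => h.measurable_Y _ _ _) x.2)
  have key := measure_mem_le_of_indep (P := P) X hXm
    (fun x => {ω | ¬ AccurateIn T c s₀ q μ (fun m k t => Y m k t ω) x.1 x.2}) Set.univ
    (ENNReal.ofReal (1 / ((n + 1 : ℕ) * (T : ℝ) ^ 2)))
    (fun x _ => by
      rw [hXset]
      exact h.indep_epochState_accurate tie T c s₀ q x.1 x.2)
    (fun x _ => by
      rw [← ENNReal.ofReal_toReal (measure_ne_top P _)]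
      exact ENNReal.ofReal_le_ofReal (h.measureReal_not_accurate_le hT x.1 x.2.2.1 s₀ x.2.2.2.2))
  have h1 : P {ω | X ω ∈ Set.univ} = 1 := by simp
  rw [h1, mul_one] at key
  refine ENNReal.toReal_le_of_le_ofReal (by positivity) (le_trans (measure_mono ?_) key)
  intro ω hω
  rw [Set.mem_ofPred_eq] at hω ⊢
  rw [Set.mem_ofPred_eq, hX]
  exact ⟨Set.mem_univ _, hω⟩

theorem IsBandit.measureReal_not_clean_le (h : IsBandit P μ Y U) (tie : TieBreak K) {T : ℕ}
    (hT : 0 < T) (c s₀ : ℕ) :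
    P.real {ω | ¬ Clean tie T c s₀ μ (fun m i => U m i ω) fun m k t => Y m k t ω} ≤
      1 / ((n + 1 : ℕ) * (T : ℝ)) := by
  have hT' : (0 : ℝ) < T := by exact_mod_cast hT
  calc _ ≤ P.real (⋃ q ∈ Finset.range T,
        {ω | ¬ AccurateIn T c s₀ q μ (fun m k t => Y m k t ω) (rankPerm T fun m i => U m i ω)
          (epochStateAt tie T c (relabel s₀ (rankPerm T fun m i => U m i ω)
            fun m k t => Y m k t ω) q)}) := by
        refine measureReal_mono (fun ω hω => ?_) (measure_ne_top _ _)
        simp only [Clean, Set.mem_ofPred_eq, not_forall] at hω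
        obtain ⟨q, hq, hω⟩ := hω
        simp only [Set.mem_iUnion, Finset.mem_range]
        exact ⟨q, hq, hω⟩
    _ ≤ ∑ q ∈ Finset.range T, 1 / ((n + 1 : ℕ) * (T : ℝ) ^ 2) :=
        (measureReal_biUnion_finset_le _ _).trans (Finset.sum_le_sum fun q _ =>
          h.measureReal_not_accurateIn_le tie hT c s₀ q)
    _ = _ := by
      rw [Finset.sum_const, Finset.card_range, nsmul_eq_mul]
      field_simp

end Clean

/-! ### The regret as an expected loss -/

section Regret

variable {Ω : Type*} [MeasurableSpace Ω] {P : Measure Ω} {M K : ℕ}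
  [NeZero K] {μ : Fin M → Fin K → ℝ} {Y : Fin M → Fin K → ℕ → Ω → ℝ} {U : Fin M → ℕ → Ω → Fin K}

theorem IsBandit.measurable_armsAt (h : IsBandit P μ Y U) (tie : TieBreak K) (T c t : ℕ) :
    Measurable fun ω => armsAt (fun m' => metcElim tie T c fun i => U m' i ω)
      (fun m' k s => Y m' k s ω) t :=
  _root_.measurable_armsAt (fun m => measProg_metcElim tie T c
    (measurable_pi_iff.2 fun i => h.measurable_U m i)) (fun m k t => h.measurable_Y m k t) t

variable [IsProbabilityMeasure P]

/-- The arms pulled in a round are independent of the qualities in that round. -/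
theorem IsBandit.indepFun_armsAt (h : IsBandit P μ Y U) (tie : TieBreak K) (T c t : ℕ)
    (m : Fin M) (k : Fin K) :
    IndepFun (fun ω => armsAt (fun m' => metcElim tie T c fun i => U m' i ω)
      (fun m' k s => Y m' k s ω) t) (Y m k t) P := by
  -- Qualities from round `t` on are replaced by 0, which the arms of round `t` cannot notice.
  let φ : (Fin t → Fin M → Fin K → ℝ) × (Fin M → ℕ → Fin K) → Fin M → Fin K := fun v =>
    armsAt (fun m' => metcElim tie T c (v.2 m'))
      (fun m' k s => if hs : s < t then v.1 ⟨s, hs⟩ m' k else 0) t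
  have hφ : Measurable φ := by
    refine _root_.measurable_armsAt (fun m => measProg_metcElim tie T c
      ((measurable_pi_apply m).comp measurable_snd)) (fun m k s => ?_) t
    split_ifs with hs
    · exact (measurable_pi_apply k).comp ((measurable_pi_apply m).comp
        ((measurable_pi_apply _).comp measurable_fst))
    · exact measurable_const
  have hind := (h.indepFun_past_future t 1).comp (φ := φ)
    (ψ := fun f : Fin 1 → Fin M → Fin K → ℝ => f 0 m k) hφ
    (by fun_prop)
  have e1 : (fun ω => armsAt (fun m' => metcElim tie T c fun i => U m' i ω)
      (fun m' k s => Y m' k s ω) t) = φ ∘ fun ω =>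
        ((fun (t' : Fin t) (m : Fin M) (k : Fin K) => Y m k t' ω),
          fun (m : Fin M) (i : ℕ) => U m i ω) := by
    funext ω m'
    simp only [φ, Function.comp_apply, armsAt]
    rw [progsAt_congr]
    intro s hs m k
    simp [hs]
  rw [e1]
  exact hind

/-- The reward is the sum over `k` of the quality of `k` times the indicator `f k` of being alone on
`k`. The indicator depends on the arms of the round, which are independent of its qualities, so the
expectations multiply. -/
theorem IsBandit.integral_rewardAt (h : IsBandit P μ Y U) (tie : TieBreak K) (T c t : ℕ)
    (m : Fin M) :
    Integrable (fun ω => rewardAt (fun m' => metcElim tie T c fun i => U m' i ω)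
      (fun m' k s => Y m' k s ω) t m) P ∧
    ∫ ω, rewardAt (fun m' => metcElim tie T c fun i => U m' i ω)
      (fun m' k s => Y m' k s ω) t m ∂P =
    ∫ ω, (fun a : Fin M → Fin K => if collided a m then 0 else μ m (a m))
      (armsAt (fun m' => metcElim tie T c fun i => U m' i ω) (fun m' k s => Y m' k s ω) t) ∂P := by
  set A : Ω → Fin M → Fin K := fun ω => armsAt (fun m' => metcElim tie T c fun i => U m' i ω)
    (fun m' k s => Y m' k s ω) t with hA
  have hAm : Measurable A := h.measurable_armsAt tie T c t
  set f : Fin K → (Fin M → Fin K) → ℝ := fun k a =>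
    if collided a m then 0 else if a m = k then 1 else 0 with hf
  have hf01 : ∀ k a, f k a ∈ Set.Icc (0 : ℝ) 1 := by
    intro k a
    simp only [hf]
    split_ifs <;> simp
  have hfm : ∀ k, Measurable (f k) := fun k => measurable_of_finite _
  have hsum : ∀ (a : Fin M → Fin K) (v : Fin K → ℝ),
      (if collided a m then 0 else v (a m)) = ∑ k, f k a * v k := by
    intro a v
    simp only [hf]
    split_ifs with hc
    · simp
    · simp
  have hint : ∀ k, Integrable (fun ω => f k (A ω) * Y m k t ω) P := fun k =>
    Integrable.of_mem_Icc 0 1 (((hfm k).comp hAm).mul (h.measurable_Y m k t)).aemeasurable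
      (Filter.Eventually.of_forall fun ω =>
        ⟨mul_nonneg (hf01 k _).1 (h.mem_Icc m k t ω).1,
          mul_le_one₀ (hf01 k _).2 (h.mem_Icc m k t ω).1 (h.mem_Icc m k t ω).2⟩)
  have hintf : ∀ k, Integrable (fun ω => f k (A ω) * μ m k) P := fun k =>
    (Integrable.of_mem_Icc 0 1 ((hfm k).comp hAm).aemeasurable
      (Filter.Eventually.of_forall fun ω => hf01 k (A ω))).mul_const _
  have hrew : (fun ω => rewardAt (fun m' => metcElim tie T c fun i => U m' i ω)
      (fun m' k s => Y m' k s ω) t m) = fun ω => ∑ k, f k (A ω) * Y m k t ω := by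
    funext ω
    exact hsum (A ω) fun k => Y m k t ω
  rw [hrew]
  refine ⟨integrable_finsetSum _ fun k _ => hint k, ?_⟩
  rw [integral_finsetSum _ fun k _ => hint k]
  simp only [hsum _ (μ m)]
  rw [integral_finsetSum _ fun k _ => hintf k]
  refine Finset.sum_congr rfl fun k _ => ?_
  rw [(h.indepFun_armsAt tie T c t m k).integral_fun_comp_mul_comp (f := f k) (g := fun x => x)
    hAm.aemeasurable (h.measurable_Y m k t).aemeasurable (hfm k).aestronglyMeasurable
    measurable_id.aestronglyMeasurable, h.integral_eq, integral_mul_const]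

theorem IsBandit.integrable_comp_armsAt (h : IsBandit P μ Y U) (tie : TieBreak K) (T c t : ℕ)
    (g : (Fin M → Fin K) → ℝ) : Integrable (fun ω => g
      (armsAt (fun m' => metcElim tie T c fun i => U m' i ω) (fun m' k s => Y m' k s ω) t)) P :=
  Integrable.of_bound ((measurable_of_finite g).comp
    (h.measurable_armsAt tie T c t)).aestronglyMeasurable (∑ a, ‖g a‖)
    (Filter.Eventually.of_forall fun _ => Finset.single_le_sum (f := fun a => ‖g a‖)
      (fun _ _ => norm_nonneg _) (Finset.mem_univ _))

theorem IsBandit.regret_eq (h : IsBandit P μ Y U) (tie : TieBreak K) (T c : ℕ) :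
    regret P μ Y U tie T c = ∫ ω, totalLoss μ (fun m' => metcElim tie T c fun i => U m' i ω)
      (fun m' k s => Y m' k s ω) T ∂P := by
  unfold regret totalLoss
  rw [integral_finsetSum _ fun t _ => integrable_finsetSum _ fun m _ =>
    (h.integral_rewardAt tie T c t m).1, integral_finsetSum _ fun t _ =>
    h.integrable_comp_armsAt tie T c t (loss μ)]
  have h1 : (T : ℝ) * maxUtility μ = ∑ _t ∈ Finset.range T, maxUtility μ := by simp
  rw [h1, ← Finset.sum_sub_distrib]
  refine Finset.sum_congr rfl fun t _ => ?_
  rw [integral_finsetSum _ fun m _ => (h.integral_rewardAt tie T c t m).1]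
  simp only [(h.integral_rewardAt tie T c t _).2, loss]
  rw [integral_sub (integrable_const _) (integrable_finsetSum _ fun m _ =>
    h.integrable_comp_armsAt tie T c t fun a => if collided a m then 0 else μ m (a m)),
    integral_finsetSum _ fun m _ =>
    h.integrable_comp_armsAt tie T c t fun a => if collided a m then 0 else μ m (a m)]
  simp

/-- The exceptional set need not be measurable: it is replaced by a measurable hull of the same
measure. -/
theorem integral_le_add_measureReal {f : Ω → ℝ} (hf : Integrable f P) {S : Set Ω} {b D : ℝ}
    (hb : 0 ≤ b) (h1 : ∀ ω, f ω ≤ D) (h2 : ∀ ω, ω ∉ S → f ω ≤ b) :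
    ∫ ω, f ω ∂P ≤ b + D * P.real S := by
  have hm := measurableSet_toMeasurable P S
  calc ∫ ω, f ω ∂P ≤ ∫ ω, b + (toMeasurable P S).indicator (fun _ => D) ω ∂P := by
        refine integral_mono hf ((integrable_const _).add ((integrable_const D).indicator hm))
          fun ω => ?_
        by_cases hω : ω ∈ toMeasurable P S
        · simp only [Set.indicator_of_mem hω]
          linarith [h1 ω]
        · simp only [Set.indicator_of_notMem hω, add_zero]
          exact h2 ω fun h => hω (subset_toMeasurable P S h)
    _ = b + D * P.real S := by
        rw [integral_add (integrable_const _) ((integrable_const D).indicator hm),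
          integral_indicator hm, setIntegral_const]
        simp [measureReal_def, measure_toMeasurable, mul_comm]

end Regret

/-! ### The loss of a run -/

section Relabel

variable {M K : ℕ}

theorem utility_relabel (μ : Fin M → Fin K → ℝ) (σ : Equiv.Perm (Fin M)) (π : Fin M → Fin K) :
    utility (fun j => μ (σ j)) (fun j => π (σ j)) = utility μ π :=
  Equiv.sum_comp σ fun m => μ m (π m)

theorem maxUtility_relabel (μ : Fin M → Fin K → ℝ) (σ : Equiv.Perm (Fin M)) :
    maxUtility (fun j => μ (σ j)) = maxUtility μ := by
  let e : {π : Fin M → Fin K // Function.Injective π} ≃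
      {π : Fin M → Fin K // Function.Injective π} :=
    { toFun := fun π => ⟨fun j => π.1 (σ j), π.2.comp σ.injective⟩
      invFun := fun π => ⟨fun j => π.1 (σ.symm j), π.2.comp σ.symm.injective⟩
      left_inv := fun π => by simp
      right_inv := fun π => by simp }
  unfold maxUtility
  rw [← e.iSup_comp]
  exact iSup_congr fun π => utility_relabel μ σ π.1

theorem gap_relabel (μ : Fin M → Fin K → ℝ) (σ : Equiv.Perm (Fin M)) (π : Fin M → Fin K) :
    gap (fun j => μ (σ j)) (fun j => π (σ j)) = gap μ π := by
  unfold gap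
  rw [maxUtility_relabel, utility_relabel]

theorem totalLoss_relabel (μ : Fin M → Fin K → ℝ) (prog : Fin M → Prog K (Fin K))
    (y : Fin M → Fin K → ℕ → ℝ) (σ : Equiv.Perm (Fin M)) (R : ℕ) :
    totalLoss (fun j => μ (σ j)) (fun j => prog (σ j)) (fun j => y (σ j)) R =
      totalLoss μ prog y R := by
  unfold totalLoss
  refine Finset.sum_congr rfl fun t _ => ?_
  have h1 : armsAt (fun j => prog (σ j)) (fun j => y (σ j)) t = fun j => armsAt prog y t (σ j) := by
    funext j
    simp only [armsAt, progsAt_relabel]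
  rw [h1]
  unfold loss
  rw [maxUtility_relabel]
  congr 1
  rw [← Equiv.sum_comp σ fun m => if collided (armsAt prog y t) m then 0 else
    μ m (armsAt prog y t m)]
  refine Finset.sum_congr rfl fun j _ => ?_
  rw [collided_comp]

end Relabel

/-! ### The loss on the good event -/

section Run

variable {n K : ℕ} [NeZero K]

/-- The number of rounds of the initialization. -/
noncomputable def initRounds (K T : ℕ) : ℕ := chairRounds K T + (2 * K - 2)

/-- Rounding up adds less than one round and hopping 2K - 2; the factor e² under the logarithm
provides 2K. -/
theorem initRounds_le {K T : ℕ} (hK : 1 ≤ K) (hT : 1 ≤ T) :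
    (initRounds K T : ℝ) ≤ K * Real.log (Real.exp 1 ^ 2 * (K : ℝ) ^ 2 * T) := by
  have hK' : (1 : ℝ) ≤ K := by exact_mod_cast hK
  have hT' : (1 : ℝ) ≤ T := by exact_mod_cast hT
  have e : (K : ℝ) / (1 / (K * T)) = K ^ 2 * T := by field_simp
  have h1 : 0 ≤ Real.log ((K : ℝ) ^ 2 * T) :=
    Real.log_nonneg (one_le_mul_of_one_le_of_one_le (one_le_pow₀ hK') hT')
  have h2 : (chairRounds K T : ℝ) < K * Real.log ((K : ℝ) ^ 2 * T) + 1 := by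
    unfold chairRounds
    rw [e]
    exact Nat.ceil_lt_add_one (by positivity)
  have h3 : ((2 * K - 2 : ℕ) : ℝ) = 2 * K - 2 := by
    rw [Nat.cast_sub (by omega)]
    push_cast
    ring
  unfold initRounds
  rw [mul_assoc, Real.log_mul (by positivity) (by positivity), Real.log_pow, Real.log_exp]
  push_cast
  rw [h3]
  linarith

/-- The loss of a run in which all players find an arm in the musical chairs and all estimates are
accurate. -/
theorem totalLoss_metcElim_le (hnK : n + 1 ≤ K) {μ : Fin (n + 1) → Fin K → ℝ}
    (hμ0 : ∀ m k, 0 ≤ μ m k) (hμ1 : ∀ m k, μ m k ≤ 1) {tie : TieBreak K} {T c : ℕ} (hc : 1 ≤ c)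
    (hT : minHorizon c ≤ T) {u : Fin (n + 1) → ℕ → Fin K} (hu : AllSeated T u)
    {y : Fin (n + 1) → Fin K → ℕ → ℝ} (hy : ∀ m k t, y m k t ∈ Set.Icc (0 : ℝ) 1)
    (hclean : Clean tie T c (initRounds K T) μ u y)
    {S : Fin (n + 1) → Fin K → Prop} [∀ m k, Decidable (S m k)] {D : Fin (n + 1) → Fin K → ℝ}
    (hD0 : ∀ m k, S m k → 0 < D m k) (hD1 : ∀ m k, S m k → D m k ≤ (n + 1 : ℕ))
    (hSD : ∀ π, Function.Injective π → 0 < gap μ π → ∀ m, S m (π m) ∧ D m (π m) ≤ gap μ π) :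
    totalLoss μ (fun m => metcElim tie T c (u m)) y T ≤
      (n + 1 : ℕ) * initRounds K T +
      (6 * ((n + 1 : ℕ) : ℝ) ^ 2 * K * Real.logb 2 K * Real.logb 2 T ^ (1 / (c : ℝ)) +
      Real.exp 1 ^ 2 * ((n + 1 : ℕ) : ℝ) * K * Real.logb 2 T ^ (1 + 1 / (c : ℝ)) +
      2 * ((n + 1 : ℕ) : ℝ) ^ 3 * K * Real.logb 2 K / (√2 - 1) *
        √(Real.log (2 * ((n + 1 : ℕ) : ℝ) ^ 2 * K * (T : ℝ) ^ 2)) +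
      2 * √2 / (3 - 2 * √2) * ((n + 1 : ℕ) : ℝ) ^ 2 * K *
        √(Real.log (2 * ((n + 1 : ℕ) : ℝ) ^ 2 * K * (T : ℝ) ^ 2)) *
        Real.logb 2 (Real.log T) +
      (2 * √2 - 1) / (√2 - 1) * ∑ m, ∑ k, if S m k then
        (32 * ((n + 1 : ℕ) : ℝ) ^ 2 *
          Real.log (2 * ((n + 1 : ℕ) : ℝ) ^ 2 * K * (T : ℝ) ^ 2) / D m k) ^ (1 + 1 / (c : ℝ))
        else 0) := by
  set σ := rankPerm T u with hσ
  have hK : 1 ≤ K := by omega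
  have hT2 := (le_logb_log_of_minHorizon_le hT).2.1
  have hlog := log_horizon_ge hc hT
  have hL2 := log_confidence_ge (M := n + 1) (by omega) hK hT2
  have hL : 1 ≤ Real.log (2 / (1 / (((n + 1 : ℕ) : ℝ) ^ 2 * K * (T : ℝ) ^ 2))) := by
    rw [div_div_eq_mul_div, div_one, ← mul_assoc, ← mul_assoc]
    linarith
  have hcost := sum_epochCost_le hnK hc hT (S := fun j k => S (σ j) k)
    (D := fun j k => D (σ j) k) (fun m k => hD0 _ k) fun m k => hD1 _ k
  have hperm := Equiv.sum_comp σ fun m => ∑ k, if S m k then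
    (32 * ((n + 1 : ℕ) : ℝ) ^ 2 *
      Real.log (2 * ((n + 1 : ℕ) : ℝ) ^ 2 * K * (T : ℝ) ^ 2) / D m k) ^ (1 + 1 / (c : ℝ)) else 0
  rw [hperm] at hcost
  refine le_trans ?_ (add_le_add_right hcost _)
  have h1 := totalLoss_le_phase (μ := μ) (prog := fun m => metcElim tie T c (u m)) (y := y)
    (len := initRounds K T) (R := T) (b := fun _ => ((n + 1 : ℕ) : ℝ))
    (B := ∑ q ∈ Finset.range T, epochCost n K T c (q + 1) (fun j k => S (σ j) k)
      (fun j k => D (σ j) k)) (fun t _ => loss_le_card hμ0 hμ1 _) (fun _ _ => Nat.cast_nonneg _)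
    (Finset.sum_nonneg fun q _ => epochCost_nonneg _ _ _ _ _ _ _) rfl fun R hR => ?_
  · rwa [Finset.sum_const, Finset.card_range, nsmul_eq_mul, mul_comm] at h1
  -- After the initialization the players are renamed by their ranks. The sum over edges in the
  -- bound is invariant under this permutation (`hperm`).
  · rw [← totalLoss_relabel _ _ _ σ]
    have hprog : (fun j => progsAt (fun m => metcElim tie T c (u m)) y (initRounds K T) (σ j)) =
        rankedProgs tie T c n := funext fun j => progsAt_metcElim_rankOrder tie T c hu y j
    rw [hprog]
    refine totalLoss_ranked_le hnK (fun m k => hμ0 _ k) (fun m k => hμ1 _ k) (by omega)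
      (fun m k t => hy _ _ _) hL hclean (fun π hπ hgap m => ?_) R (by omega)
    have hπσ : π = fun j => (fun m => π (σ.symm m)) (σ j) := by
      funext j
      simp
    have hg : gap (fun j => μ (σ j)) π = gap μ fun m => π (σ.symm m) := by
      conv_lhs => rw [hπσ]
      exact gap_relabel μ σ fun m => π (σ.symm m)
    rw [hg] at hgap ⊢
    have := hSD _ (hπ.comp σ.symm.injective) hgap (σ m)
    simpa [Function.comp_def] using this

end Run

open scoped Classical in
theorem theorem2 {Ω : Type*} [MeasurableSpace Ω] (P : Measure Ω) [IsProbabilityMeasure P]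
    (M K : ℕ) [NeZero K] (hMK : M ≤ K) (μ : Fin M → Fin K → ℝ)
    (Y : Fin M → Fin K → ℕ → Ω → ℝ) (U : Fin M → ℕ → Ω → Fin K) (hbandit : IsBandit P μ Y U)
    (tie : TieBreak K) (c : ℕ) (hc : 1 ≤ c) (T : ℕ) (hT : minHorizon c ≤ T)
    (hΔ : minGap μ ≠ ⊤)
    (best : Fin M → Fin K → Fin M → Fin K)
    (hbest : ∀ m k, (suboptimalThrough μ m k).Nonempty →
      best m k ∈ suboptimalThrough μ m k ∧
        ∀ π ∈ suboptimalThrough μ m k, utility μ π ≤ utility μ (best m k)) :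
    regret P μ Y U tie T c ≤
      2 + M * K * Real.log (Real.exp 1 ^ 2 * (K : ℝ) ^ 2 * T)
      + 6 * (M : ℝ) ^ 2 * K * Real.logb 2 K * Real.logb 2 T ^ (1 / (c : ℝ))
      + Real.exp 1 ^ 2 * M * K * Real.logb 2 T ^ (1 + 1 / (c : ℝ))
      + 2 * (M : ℝ) ^ 3 * K * Real.logb 2 K / (Real.sqrt 2 - 1)
        * Real.sqrt (Real.log (2 * (M : ℝ) ^ 2 * K * (T : ℝ) ^ 2))
      + 2 * Real.sqrt 2 / (3 - 2 * Real.sqrt 2) * (M : ℝ) ^ 2 * K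
        * Real.sqrt (Real.log (2 * (M : ℝ) ^ 2 * K * (T : ℝ) ^ 2)) * Real.logb 2 (Real.log T)
      + (2 * Real.sqrt 2 - 1) / (Real.sqrt 2 - 1) *
        ∑ m : Fin M, ∑ k : Fin K,
          if (suboptimalThrough μ m k).Nonempty then
            (32 * (M : ℝ) ^ 2 * Real.log (2 * (M : ℝ) ^ 2 * K * (T : ℝ) ^ 2) / gap μ (best m k))
              ^ (1 + 1 / (c : ℝ))
          else 0 := by
  have hμ0 : ∀ m k, 0 ≤ μ m k := fun m k => (hbandit.mean_mem_Icc m k).1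
  have hμ1 : ∀ m k, μ m k ≤ 1 := fun m k => (hbandit.mean_mem_Icc m k).2
  rcases M with _ | n
  · refine absurd ?_ hΔ
    have : IsEmpty {π : Fin 0 → Fin K // Function.Injective π ∧ 0 < gap μ π} :=
      ⟨fun π => by
        have := gap_le_card hμ0 hμ1 π.1
        have := π.2.2
        simp only [Nat.cast_zero] at *
        linarith⟩
    exact iInf_of_empty _
  have hT2 := (le_logb_log_of_minHorizon_le hT).2.1
  have hT0 : 0 < T := by
    have : (0 : ℝ) < T := by linarith
    exact_mod_cast this
  have hK1 : 1 ≤ K := by omega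
  have hM' : (0 : ℝ) < (n + 1 : ℕ) := by positivity
  have hK' : (0 : ℝ) < K := by exact_mod_cast hK1
  have hT' : (0 : ℝ) < T := by linarith
  have hsub : ∀ m k, (suboptimalThrough μ m k).Nonempty → 0 < gap μ (best m k) := fun m k h =>
    sub_pos.2 (hbest m k h).1.2.2
  have hrun := fun ω hu hclean => totalLoss_metcElim_le (tie := tie) (T := T) hMK hμ0 hμ1 hc hT
    (u := fun m i => U m i ω) hu (y := fun m k t => Y m k t ω)
    (fun m k t => hbandit.mem_Icc m k t ω) hclean
    (S := fun m k => (suboptimalThrough μ m k).Nonempty) (D := fun m k => gap μ (best m k))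
    hsub (fun m k _ => gap_le_card hμ0 hμ1 _) fun π hπ hgap m => by
      have hmem : π ∈ suboptimalThrough μ m (π m) := ⟨hπ, rfl, sub_pos.1 hgap⟩
      refine ⟨⟨π, hmem⟩, ?_⟩
      have := (hbest m (π m) ⟨π, hmem⟩).2 π hmem
      unfold gap
      linarith
  have hinit := initRounds_le hK1 hT0
  have hseat := hbandit.measureReal_not_allSeated_le hMK hT0
  have hclean := hbandit.measureReal_not_clean_le tie hT0 c (initRounds K T)
  set bound : ℝ := 6 * ((n + 1 : ℕ) : ℝ) ^ 2 * K * Real.logb 2 K * Real.logb 2 T ^ (1 / (c : ℝ)) +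
      Real.exp 1 ^ 2 * ((n + 1 : ℕ) : ℝ) * K * Real.logb 2 T ^ (1 + 1 / (c : ℝ)) +
      2 * ((n + 1 : ℕ) : ℝ) ^ 3 * K * Real.logb 2 K / (√2 - 1) *
        √(Real.log (2 * ((n + 1 : ℕ) : ℝ) ^ 2 * K * (T : ℝ) ^ 2)) +
      2 * √2 / (3 - 2 * √2) * ((n + 1 : ℕ) : ℝ) ^ 2 * K *
        √(Real.log (2 * ((n + 1 : ℕ) : ℝ) ^ 2 * K * (T : ℝ) ^ 2)) *
        Real.logb 2 (Real.log T) +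
      (2 * √2 - 1) / (√2 - 1) * ∑ m, ∑ k, if (suboptimalThrough μ m k).Nonempty then
        (32 * ((n + 1 : ℕ) : ℝ) ^ 2 * Real.log (2 * ((n + 1 : ℕ) : ℝ) ^ 2 * K * (T : ℝ) ^ 2) /
          gap μ (best m k)) ^ (1 + 1 / (c : ℝ)) else 0 with hbound
  have hbound0 : 0 ≤ bound := by
    refine le_trans ?_ (sum_epochCost_le hMK hc hT
      (S := fun m k => (suboptimalThrough μ m k).Nonempty) (D := fun m k => gap μ (best m k))
      hsub (fun m k _ => gap_le_card hμ0 hμ1 _))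
    exact Finset.sum_nonneg fun q _ => epochCost_nonneg _ _ _ _ _ _ _
  have hint : Integrable (fun ω => totalLoss μ (fun m' => metcElim tie T c fun i => U m' i ω)
      (fun m' k s => Y m' k s ω) T) P :=
    integrable_finsetSum _ fun t _ => hbandit.integrable_comp_armsAt tie T c t (loss μ)
  have hreg := integral_le_add_measureReal (P := P) hint
    (S := {ω | ¬ AllSeated T fun m i => U m i ω} ∪
      {ω | ¬ Clean tie T c (initRounds K T) μ (fun m i => U m i ω) fun m k t => Y m k t ω})
    (b := (n + 1 : ℕ) * initRounds K T + bound) (D := (n + 1 : ℕ) * T)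
    (by positivity) (fun ω => by
      calc _ ≤ ∑ _t ∈ Finset.range T, ((n + 1 : ℕ) : ℝ) :=
            Finset.sum_le_sum fun t _ => loss_le_card hμ0 hμ1 _
        _ = _ := by
          rw [Finset.sum_const, Finset.card_range, nsmul_eq_mul, mul_comm]) (fun ω hω => by
      rw [Set.mem_union, not_or, Set.mem_ofPred_eq, Set.mem_ofPred_eq, not_not, not_not] at hω
      exact hrun ω hω.1 hω.2)
  rw [hbandit.regret_eq tie T c]
  -- The loss is at most MT. Failed seating, of probability at most M/(K²T), costs (M/K)² ≤ 1;
  -- inaccurate estimates, of probability at most 1/(MT), cost 1. This is the constant 2 of the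
  -- theorem.
  have hbad : ((n + 1 : ℕ) : ℝ) * T * P.real ({ω | ¬ AllSeated T fun m i => U m i ω} ∪
      {ω | ¬ Clean tie T c (initRounds K T) μ (fun m i => U m i ω) fun m k t => Y m k t ω}) ≤
      2 := by
    have hMK' : ((n + 1 : ℕ) : ℝ) ≤ K := by exact_mod_cast hMK
    calc _ ≤ ((n + 1 : ℕ) : ℝ) * T * ((n + 1 : ℕ) / ((K : ℝ) ^ 2 * T) + 1 / ((n + 1 : ℕ) * T)) := by
          gcongr
          exact (measureReal_union_le _ _).trans (add_le_add hseat hclean)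
      _ = ((n + 1 : ℕ) / (K : ℝ)) ^ 2 + 1 := by
          field_simp
      _ ≤ 1 ^ 2 + 1 := by
          gcongr
          exact (div_le_one hK').2 hMK'
      _ = 2 := by norm_num
  have hinit' : ((n + 1 : ℕ) : ℝ) * initRounds K T ≤
      (n + 1 : ℕ) * (K * Real.log (Real.exp 1 ^ 2 * (K : ℝ) ^ 2 * T)) := by gcongr
  rw [← mul_assoc] at hinit'
  linarith
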